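/- Let $d\in\{1,2,3\}$, $2\le p<\infty$, $t_0\in\mathbb R$, $\varphi\in H^2(\mathbb R^d)$, and let $\gamma_+,\gamma_->0$ and $t_+\in(0,1)$. Let $\gamma:\mathbb R\to\mathbb R$ be the $1$-periodic function with $\gamma(t)=\gamma_+$ for $0<t\le t_+$ and $\gamma(t)=-\gamma_-$ for $t_+<t\le 1$, and put $\langle\gamma\rangle=\int_0^1\gamma(\tau)\,d\tau$. For $\varepsilon>0$ consider $$ i\partial_t u_\varepsilon+\gamma(t/\varepsilon)\,\Delta u_\varepsilon+|u_\varepsilon|^{p-1}u_\varepsilon=0,\qquad u_\varepsilon(t_0)=\varphi, \tag{1}$$ and the averaged equation $$ i\partial_t u_0+\langle\gamma\rangle\,\Delta u_0+|u_0|^{p-1}u_0=0,\qquad u_0(t_0)=\varphi. \tag{2}$$ A solution on $[t_0,T')$, $t_0<T'\le\infty$, of the problem with dispersion coefficient $\beta(t)$ is a function $u\in C([t_0,T'),H^2(\mathbb R^d))$ satisfying Duhamel's formula $$u(t)=U(t,t_0)\varphi+i\int_{t_0}^tU(t,s)\,|u(s)|^{p-1}u(s)\,ds,\qquad U(t,s)=e^{\,i\left(\int_s^t\beta(\tau)\,d\tau\right)\Delta},$$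 and it is maximal if it cannot be extended to a solution on a longer interval $[t_0,T'')$. Then problem (2), and for every $\varepsilon>0$ problem (1), has a unique maximal solution, of which every other solution is a restriction. Let $u_0\in C([t_0,T_*),H^2(\mathbb R^d))$ be the maximal solution of (2), and let $u_\varepsilon\in C([t_0,T^*_\varepsilon),H^2(\mathbb R^d))$ be the maximal solution of (1). For every $T$ with $t_0<T<T_*$ there is $\varepsilon_0>0$ such that $T<T^*_\varepsilon$ for all $0<\varepsilon<\varepsilon_0$ (so $u_\varepsilon$ exists on $[t_0,T]$), and $$\sup_{t\in[t_0,T]}\|u_\varepsilon(t)-u_0(t)\|_{H^2(\mathbb R^d)}\longrightarrow 0\qquad\text{as }\varepsilon\to0_+ .$$ -/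

import Mathlib

open MeasureTheory Set Filter Topology
open scoped ENNReal SchwartzMap FourierTransform

noncomputable section

namespace FastDispersionNLS

/-- The complex Hilbert space `L²(ℝ^d)`. -/
abbrev L2 (d : ℕ) : Type :=
  Lp ℂ 2 (volume : Measure (EuclideanSpace ℝ (Fin d)))

/-- The `1`-periodic piecewise constant dispersion map with value `γp` on `(0, tp]` and value
`-γm` on `(tp, 1]`. The number `t - (⌈t⌉ - 1)` is the representative of `t` modulo `1` in
`(0, 1]`. -/
def dispersionMap (γp γm tp : ℝ) (t : ℝ) : ℝ :=
  if t - ((⌈t⌉ : ℝ) - 1) ≤ tp then γp else -γm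

/-- The average `⟨γ⟩ = ∫₀¹ γ(τ) dτ` of a `1`-periodic dispersion map. -/
def average (γ : ℝ → ℝ) : ℝ := ∫ τ in (0 : ℝ)..1, γ τ

/-- Membership of an `L²` function in the Sobolev space `H²(ℝ^d)`. -/
def MemH2 {d : ℕ} (f : L2 d) : Prop :=
  TemperedDistribution.MemSobolev 2 2 (f : 𝓢'(EuclideanSpace ℝ (Fin d), ℂ))

/-- The `H²(ℝ^d)` norm `‖(1 - Δ) f‖_{L²}`, computed on the Fourier side, with values in `[0, ∞]`.
With Mathlib's normalization of the Fourier transform the symbol of `-Δ` is `(2π|ξ|)²`. -/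
def h2Norm {d : ℕ} (f : L2 d) : ℝ≥0∞ :=
  eLpNorm (fun ξ : EuclideanSpace ℝ (Fin d) =>
    ((1 + (2 * Real.pi * ‖ξ‖) ^ 2 : ℝ) : ℂ) * (𝓕 f : L2 d) ξ) 2 volume

/-- The Fourier symbol of `e^{iaΔ}` is bounded, so it preserves `L²`. -/
theorem memLp_symbol_mul {d : ℕ} (a : ℝ) (g : L2 d) :
    MemLp (fun ξ : EuclideanSpace ℝ (Fin d) =>
      Complex.exp (-(Complex.I * ((a * (2 * Real.pi * ‖ξ‖) ^ 2 : ℝ) : ℂ))) * g ξ) 2 volume := by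
  refine (Lp.memLp g).of_le ?_ (Eventually.of_forall fun ξ => ?_)
  · exact (Continuous.aestronglyMeasurable (by fun_prop)).mul (Lp.aestronglyMeasurable g)
  · rw [norm_mul, mul_comm Complex.I, ← neg_mul, ← Complex.ofReal_neg,
      Complex.norm_exp_ofReal_mul_I, one_mul]

/-- The unitary operator `e^{iaΔ}` on `L²(ℝ^d)`, i.e. the Fourier multiplier with symbol
`e^{-ia|ξ|²}`, where `ξ` is the angular frequency (`2πξ` in Mathlib's normalization). -/
def schrodingerOp {d : ℕ} (a : ℝ) (f : L2 d) : L2 d :=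
  𝓕⁻ ((memLp_symbol_mul a (𝓕 f : L2 d)).toLp _ : L2 d)

/-- The propagator `U(t, s) = e^{iΓ(t,s)Δ}` with cumulative dispersion `Γ(t, s) = ∫ₛᵗ γ(τ) dτ`. -/
def propagator {d : ℕ} (γ : ℝ → ℝ) (t s : ℝ) (f : L2 d) : L2 d :=
  schrodingerOp (∫ τ in s..t, γ τ) f

/-- The pointwise nonlinearity `|f|^{p-1} f`. -/
def powerFun {d : ℕ} (p : ℝ) (f : L2 d) (x : EuclideanSpace ℝ (Fin d)) : ℂ :=
  ((‖f x‖ ^ (p - 1) : ℝ) : ℂ) * f x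

open Classical in
/-- The nonlinearity `|f|^{p-1} f` as an element of `L²(ℝ^d)`. The value `0` is only used if
`|f|^{p-1} f` is not square integrable; solutions are required below to avoid this case. -/
def nonlinearity {d : ℕ} (p : ℝ) (f : L2 d) : L2 d :=
  if h : MemLp (powerFun p f) 2 volume then h.toLp (powerFun p f) else 0

/-- The half-open time interval `[t₀, Tmax)`, where `Tmax` may be `∞`. -/
def lifespan (t₀ : ℝ) (Tmax : EReal) : Set ℝ := {t : ℝ | t₀ ≤ t ∧ (t : EReal) < Tmax}

/-- `u` is a solution in `C([t₀, Tmax), H²(ℝ^d))` of the Cauchy problem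
`i ∂ₜu + γ(t) Δu + |u|^{p-1} u = 0`, `u(t₀) = φ`, in the sense of Duhamel's formula
`u(t) = U(t,t₀) φ + i ∫_{t₀}^t U(t,s) |u(s)|^{p-1} u(s) ds`, the integral being a Bochner integral
in `L²(ℝ^d)`. Only the values of `u` on `[t₀, Tmax)` matter. -/
structure IsSolution {d : ℕ} (p : ℝ) (γ : ℝ → ℝ) (t₀ : ℝ) (φ : L2 d) (Tmax : EReal)
    (u : ℝ → L2 d) : Prop where
  lt_Tmax : (t₀ : EReal) < Tmax
  memH2 : ∀ t ∈ lifespan t₀ Tmax, MemH2 (u t)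
  continuous_h2 : ∀ t ∈ lifespan t₀ Tmax,
    Tendsto (fun s => h2Norm (u s - u t)) (𝓝[lifespan t₀ Tmax] t) (𝓝 0)
  memLp_nonlinearity : ∀ t ∈ lifespan t₀ Tmax, MemLp (powerFun p (u t)) 2 volume
  integrable : ∀ t ∈ lifespan t₀ Tmax,
    IntervalIntegrable (fun s => propagator γ t s (nonlinearity p (u s))) volume t₀ t
  duhamel : ∀ t ∈ lifespan t₀ Tmax,
    u t = propagator γ t t₀ φ +
      Complex.I • ∫ s in t₀..t, propagator γ t s (nonlinearity p (u s))

/-- A solution on `[t₀, Tmax)` is maximal if no solution on a longer interval extends it. -/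
structure IsMaximalSolution {d : ℕ} (p : ℝ) (γ : ℝ → ℝ) (t₀ : ℝ) (φ : L2 d) (Tmax : EReal)
    (u : ℝ → L2 d) : Prop where
  isSolution : IsSolution p γ t₀ φ Tmax u
  maximal : ∀ (T' : EReal) (v : ℝ → L2 d), IsSolution p γ t₀ φ T' v → Tmax ≤ T' →
    EqOn v u (lifespan t₀ Tmax) → T' = Tmax

/-- The Cauchy problem has a maximal solution, and every solution is a restriction of it. In
particular the maximal solution is unique. -/
def HasUniqueMaximalSolution {d : ℕ} (p : ℝ) (γ : ℝ → ℝ) (t₀ : ℝ) (φ : L2 d) : Prop :=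
  ∃ (Tmax : EReal) (u : ℝ → L2 d), IsMaximalSolution p γ t₀ φ Tmax u ∧
    ∀ (T' : EReal) (v : ℝ → L2 d), IsSolution p γ t₀ φ T' v →
      T' ≤ Tmax ∧ EqOn v u (lifespan t₀ T')

end FastDispersionNLS

end

/-! Write Γ(t) for the integral of the dispersion map from t₀ to t. In the variable z =
e^{-iΓ(t)Δ}(1 - Δ)u, Duhamel's formula in H² becomes an integral equation z(t) = z₀ + ∫ F(Γ(s),
z(s)) ds in L², where F(a, z) = i e^{-iaΔ} Ñ(e^{iaΔ} z) and Ñ is the nonlinearity conjugated by 1 -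
Δ (`isSolution_iff`). The dispersion map enters only through its primitive. Over whole periods
γ(·/ε) integrates exactly like its mean, so the two primitives differ by O(ε) uniformly in time
(`abs_cumulative_sub_le`). The theorem is thereby reduced to persistence and continuous dependence
of the solution z on the phase Γ (`QuasiLipschitzField.stability`). Going back to u costs only the
strong continuity of a ↦ e^{iaΔ} on the compact orbit of the limit solution.

The difficulty is the low regularity of z ↦ |z|^{p-1}z. Its second derivative is homogeneous of
degree p - 2, hence discontinuous at 0 when p = 2 and merely Hölder there when 2 < p < 3, so a local
Lipschitz bound in H² is not at hand. Two weaker facts replace it. On H²-bounded sets the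
nonlinearity is Lipschitz in L² (`exists_norm_nonlinearity_sub_le`), and it is Lipschitz in H² up to
an additive error ρ as soon as the arguments are L²-close (`exists_h2Norm_nonlinearity_sub_le`).
Picard iteration, uniqueness and stability all survive: the L² estimate first makes the two
functions L²-close, after which the H² estimate closes up to ρ, and ρ is arbitrary.

The H² estimate is proved with centered second differences, so that no weak derivatives occur. The
dangerous term is D²f(v)(∇v)² - D²f(u)(∇u)². Where |u| ≥ η it is handled by uniform continuity of
D²f off the origin (`exists_powerRem_compare`). Where |u| ≤ η, only boundedness is available, but
there ∇u is small in L⁴, by a truncated Gagliardo–Nirenberg inequality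
(`integral_diff_pow_four_small_le_real`). The difference v - u is small in L^∞ by interpolating
between L² and H², which uses d ≤ 3 (`exists_norm_rep_le_small`). -/

noncomputable section

namespace FastDispersionNLS

/-! ### Integral equations with a quasi-Lipschitz field: gluing, stability on a short interval,
uniqueness. -/

section AbstractODE

set_option linter.unusedSectionVars false

variable {X : Type*} [NormedAddCommGroup X] [NormedSpace ℝ X]

/-- A non-autonomous field `F` on a Banach space `X` which is bounded on balls, Lipschitz on balls
for the weak norm `‖J ·‖`, and Lipschitz for the strong norm up to an error that is
small for `‖J ·‖`-close arguments. -/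
structure QuasiLipschitzField (J : X →L[ℝ] X) (F : ℝ → X → X) : Prop where
  cont : Continuous fun q : ℝ × X => F q.1 q.2
  bdd : ∀ M : ℝ, ∃ B : ℝ, ∀ a z, ‖z‖ ≤ M → ‖F a z‖ ≤ B
  weak : ∀ M : ℝ, ∃ L : ℝ, ∀ a z z', ‖z‖ ≤ M → ‖z'‖ ≤ M →
    ‖J (F a z) - J (F a z')‖ ≤ L * ‖J z - J z'‖
  strong : ∀ M : ℝ, ∃ C : ℝ, ∀ ρ > 0, ∃ σ > 0, ∀ a z z', ‖z‖ ≤ M → ‖z'‖ ≤ M →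
    ‖J z - J z'‖ ≤ σ → ‖F a z - F a z'‖ ≤ C * ‖z - z'‖ + ρ

/-- The bounds of a quasi-Lipschitz field on the ball of radius `M`, with a common constant `K`. -/
structure FieldBound (J : X →L[ℝ] X) (F : ℝ → X → X) (M K : ℝ) : Prop where
  pos : 0 < K
  bdd : ∀ a z, ‖z‖ ≤ M → ‖F a z‖ ≤ K
  weak : ∀ a z z', ‖z‖ ≤ M → ‖z'‖ ≤ M → ‖J (F a z) - J (F a z')‖ ≤ K * ‖J z - J z'‖
  strong : ∀ ρ > 0, ∃ σ > 0, ∀ a z z', ‖z‖ ≤ M → ‖z'‖ ≤ M →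
    ‖J z - J z'‖ ≤ σ → ‖F a z - F a z'‖ ≤ K * ‖z - z'‖ + ρ

theorem QuasiLipschitzField.exists_bound {J : X →L[ℝ] X} {F : ℝ → X → X}
    (hF : QuasiLipschitzField J F) (M : ℝ) : ∃ K, FieldBound J F M K := by
  obtain ⟨B, hB⟩ := hF.bdd M
  obtain ⟨L, hL⟩ := hF.weak M
  obtain ⟨C, hC⟩ := hF.strong M
  refine ⟨max 1 (max B (max L C)), by positivity, fun a z hz => (hB a z hz).trans (by simp),
    fun a z z' hz hz' => (hL a z z' hz hz').trans ?_, fun ρ hρ => ?_⟩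
  · gcongr; simp
  · obtain ⟨σ, hσ, h⟩ := hC ρ hρ
    refine ⟨σ, hσ, fun a z z' hz hz' hJ => (h a z z' hz hz' hJ).trans ?_⟩
    gcongr; simp

/-- `z` solves the integral equation `z(t) = z₀ + ∫_a^t F(G(s), z(s)) ds` on `[a, b]`. -/
def IsMild (F : ℝ → X → X) (G : ℝ → ℝ) (a b : ℝ) (z₀ : X) (z : ℝ → X) : Prop :=
  ContinuousOn z (Icc a b) ∧ ∀ t ∈ Icc a b, z t = z₀ + ∫ s in a..t, F (G s) (z s)

/-- Absorption of a supremum: the hypothesis is applied with E the maximum of f, which is attained.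
This plays the part of Gronwall's inequality on short intervals. -/
theorem le_two_mul_of_sup_bound {f : ℝ → ℝ} {a b A : ℝ} (hf : ContinuousOn f (Icc a b))
    (h : ∀ E, (∀ t ∈ Icc a b, f t ≤ E) → ∀ t ∈ Icc a b, f t ≤ A + E / 2) :
    ∀ t ∈ Icc a b, f t ≤ 2 * A := by
  intro t ht
  obtain ⟨m, hm, hmax⟩ := isCompact_Icc.exists_isMaxOn ⟨t, ht⟩ hf
  have h1 := h (f m) (fun s hs => hmax hs) m hm
  have h2 : f t ≤ f m := hmax ht
  linarith

variable {F : ℝ → X → X} {J : X →L[ℝ] X} {G G' : ℝ → ℝ}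

theorem continuousOn_field (hF : Continuous fun q : ℝ × X => F q.1 q.2) (hG : Continuous G)
    {z : ℝ → X} {s : Set ℝ} (hz : ContinuousOn z s) :
    ContinuousOn (fun t => F (G t) (z t)) s :=
  hF.comp_continuousOn (hG.continuousOn.prodMk hz)

theorem intervalIntegrable_field (hF : Continuous fun q : ℝ × X => F q.1 q.2) (hG : Continuous G)
    {z : ℝ → X} {a b s t : ℝ} (hz : ContinuousOn z (Icc a b)) (hs : s ∈ Icc a b)
    (ht : t ∈ Icc a b) : IntervalIntegrable (fun r => F (G r) (z r)) volume s t := by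
  refine ((continuousOn_field hF hG hz).mono ?_).intervalIntegrable
  exact uIcc_subset_Icc hs ht

theorem IsMild.left {a b : ℝ} {z₀ : X} {z : ℝ → X} (h : IsMild F G a b z₀ z) (hab : a ≤ b) :
    z a = z₀ := by
  simpa using h.2 a (left_mem_Icc.2 hab)

theorem IsMild.mono {a b b' : ℝ} {z₀ : X} {z : ℝ → X} (h : IsMild F G a b z₀ z) (hb : b' ≤ b) :
    IsMild F G a b' z₀ z :=
  ⟨h.1.mono (Icc_subset_Icc_right hb), fun t ht => h.2 t (Icc_subset_Icc_right hb ht)⟩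

theorem IsMild.congr {a b : ℝ} {z₀ : X} {z z' : ℝ → X} (h : IsMild F G a b z₀ z)
    (hz : EqOn z' z (Icc a b)) : IsMild F G a b z₀ z' := by
  refine ⟨h.1.congr hz, fun t ht => ?_⟩
  rw [hz ht, h.2 t ht]
  congr 1
  refine intervalIntegral.integral_congr fun s hs => ?_
  rw [uIcc_of_le ht.1] at hs
  simp only [hz ⟨hs.1, hs.2.trans ht.2⟩]

theorem IsMild.restart (hF : Continuous fun q : ℝ × X => F q.1 q.2) (hG : Continuous G)
    {a b c : ℝ} {z₀ : X} {z : ℝ → X} (h : IsMild F G a c z₀ z) (hab : a ≤ b) (hbc : b ≤ c) :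
    IsMild F G b c (z b) z := by
  refine ⟨h.1.mono (Icc_subset_Icc_left hab), fun t ht => ?_⟩
  rw [h.2 t ⟨hab.trans ht.1, ht.2⟩, h.2 b ⟨hab, hbc⟩, add_assoc,
    intervalIntegral.integral_add_adjacent_intervals]
  · exact intervalIntegrable_field hF hG h.1 ⟨le_rfl, hab.trans hbc⟩ ⟨hab, hbc⟩
  · exact intervalIntegrable_field hF hG h.1 ⟨hab, hbc⟩ ⟨hab.trans ht.1, ht.2⟩

theorem IsMild.glue (hF : Continuous fun q : ℝ × X => F q.1 q.2) (hG : Continuous G)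
    {a b c : ℝ} {z₀ : X} {z z' : ℝ → X} (h : IsMild F G a b z₀ z) (hab : a ≤ b) (hbc : b ≤ c)
    (h' : IsMild F G b c (z b) z') :
    IsMild F G a c z₀ (fun t => if t ≤ b then z t else z' t) := by
  set y : ℝ → X := fun t => if t ≤ b then z t else z' t with hy
  have e1 : EqOn y z (Icc a b) := fun t ht => if_pos ht.2
  have e2 : EqOn y z' (Icc b c) := by
    intro t ht
    rcases ht.1.eq_or_lt with rfl | hlt
    · simp only [hy, le_refl, if_true, h'.left hbc]
    · simp only [hy, not_le.2 hlt, if_false]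
  have m1 := h.congr e1
  have m2 := h'.congr e2
  have hc : ContinuousOn y (Icc a c) := by
    rw [← Icc_union_Icc_eq_Icc hab hbc]
    exact m1.1.union_of_isClosed m2.1 isClosed_Icc isClosed_Icc
  refine ⟨hc, fun t ht => ?_⟩
  rcases le_total t b with htb | hbt
  · exact m1.2 t ⟨ht.1, htb⟩
  · rw [m2.2 t ⟨hbt, ht.2⟩, ← e1 ⟨hab, le_rfl⟩, m1.2 b ⟨hab, le_rfl⟩, add_assoc,
      intervalIntegral.integral_add_adjacent_intervals]
    · exact intervalIntegrable_field hF hG hc ⟨le_rfl, hab.trans hbc⟩ ⟨hab, hbc⟩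
    · exact intervalIntegrable_field hF hG hc ⟨hab, hbc⟩ ⟨hab.trans hbt, ht.2⟩

variable [CompleteSpace X]

/-- The argument has two levels. The weak Lipschitz bound, absorbed thanks to (b - a)K ≤ 1/2, gives
‖J z - J z'‖ ≤ 4‖J‖δ ≤ σ. This licenses the strong bound, whose Lipschitz part is absorbed in the
same way, leaving the error ρ. The change of phase is paid for only along z, so no uniformity of F
in its first argument is needed. -/
theorem IsMild.stability_step (hF : Continuous fun q : ℝ × X => F q.1 q.2) {M K : ℝ}
    (hK : FieldBound J F M K) (hG : Continuous G) (hG' : Continuous G') {a b δ : ℝ}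
    (hτ : b - a ≤ 1) (hτK : (b - a) * K ≤ 1 / 2) {z₀ z₀' : X} {z z' : ℝ → X}
    (h : IsMild F G a b z₀ z) (h' : IsMild F G' a b z₀' z') (hM : ∀ t ∈ Icc a b, ‖z t‖ ≤ M)
    (hM' : ∀ t ∈ Icc a b, ‖z' t‖ ≤ M) (h0 : ‖z₀ - z₀'‖ ≤ δ)
    (hd : ∀ t ∈ Icc a b, ‖F (G t) (z t) - F (G' t) (z t)‖ ≤ δ) {ρ σ : ℝ}
    (hσ : ∀ a z z', ‖z‖ ≤ M → ‖z'‖ ≤ M →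
      ‖J z - J z'‖ ≤ σ → ‖F a z - F a z'‖ ≤ K * ‖z - z'‖ + ρ) (hδσ : 4 * ‖J‖ * δ ≤ σ)
    (hρ : 0 ≤ ρ) :
    ∀ t ∈ Icc a b, ‖z t - z' t‖ ≤ 4 * δ + 2 * ρ := by
  have hδ : 0 ≤ δ := (norm_nonneg _).trans h0
  have key : ∀ t ∈ Icc a b, z t - z' t = (z₀ - z₀') +
      (∫ s in a..t, (F (G s) (z s) - F (G' s) (z s))) +
      ∫ s in a..t, (F (G' s) (z s) - F (G' s) (z' s)) := by
    intro t ht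
    have ha : a ∈ Icc a b := ⟨le_rfl, ht.1.trans ht.2⟩
    have i1 := intervalIntegrable_field hF hG h.1 ha ht
    have i2 := intervalIntegrable_field hF hG' h.1 ha ht
    have i3 := intervalIntegrable_field hF hG' h'.1 ha ht
    rw [h.2 t ht, h'.2 t ht, intervalIntegral.integral_sub i1 i2,
      intervalIntegral.integral_sub i2 i3]
    abel
  have hsub : ∀ t ∈ Icc a b, ∀ s ∈ uIoc a t, s ∈ Icc a b := by
    intro t ht s hs
    rw [uIoc_of_le ht.1] at hs
    exact ⟨hs.1.le, hs.2.trans ht.2⟩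
  have e1 : ∀ t ∈ Icc a b, ‖∫ s in a..t, (F (G s) (z s) - F (G' s) (z s))‖ ≤ δ := by
    intro t ht
    refine (intervalIntegral.norm_integral_le_of_norm_le_const
      (fun s hs => hd s (hsub t ht s hs))).trans ?_
    rw [abs_of_nonneg (by linarith [ht.1])]
    nlinarith [ht.1, ht.2]
  have hJ : ∀ t ∈ Icc a b, ‖J (z t) - J (z' t)‖ ≤ 2 * (‖J‖ * (2 * δ)) := by
    refine le_two_mul_of_sup_bound (f := fun t => ‖J (z t) - J (z' t)‖) ?_ ?_
    · exact ((J.continuous.comp_continuousOn h.1).sub (J.continuous.comp_continuousOn h'.1)).norm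
    intro E hE t ht
    have ha : a ∈ Icc a b := ⟨le_rfl, ht.1.trans ht.2⟩
    have i2 := intervalIntegrable_field hF hG' h.1 ha ht
    have i3 := intervalIntegrable_field hF hG' h'.1 ha ht
    have hE0 : 0 ≤ E := (norm_nonneg _).trans (hE t ht)
    rw [← map_sub, key t ht, map_add, ← ContinuousLinearMap.intervalIntegral_comp_comm J (i2.sub i3)]
    refine (norm_add_le _ _).trans (add_le_add ?_ ?_)
    · refine (J.le_opNorm _).trans ?_
      gcongr
      exact (norm_add_le _ _).trans (by linarith [e1 t ht])
    · refine (intervalIntegral.norm_integral_le_of_norm_le_const (C := K * E)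
        (fun s hs => ?_)).trans ?_
      · have hs' := hsub t ht s hs
        rw [map_sub]
        refine (hK.weak _ _ _ (hM s hs') (hM' s hs')).trans ?_
        have := hK.pos
        gcongr
        exact hE s hs'
      · rw [abs_of_nonneg (by linarith [ht.1])]
        have : (t - a) * K ≤ 1 / 2 := by nlinarith [hK.pos, ht.2]
        nlinarith
  have hX : ∀ t ∈ Icc a b, ‖z t - z' t‖ ≤ 2 * (2 * δ + ρ) := by
    refine le_two_mul_of_sup_bound (f := fun t => ‖z t - z' t‖) (h.1.sub h'.1).norm ?_
    intro E hE t ht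
    have hE0 : 0 ≤ E := (norm_nonneg _).trans (hE t ht)
    rw [key t ht]
    have e2 : ‖∫ s in a..t, (F (G' s) (z s) - F (G' s) (z' s))‖ ≤ ρ + E / 2 := by
      refine (intervalIntegral.norm_integral_le_of_norm_le_const (C := K * E + ρ)
        (fun s hs => ?_)).trans ?_
      · have hs' := hsub t ht s hs
        refine (hσ _ _ _ (hM s hs') (hM' s hs') ((hJ s hs').trans ?_)).trans ?_
        · linarith
        · have := hK.pos
          gcongr
          exact hE s hs'
      · rw [abs_of_nonneg (by linarith [ht.1])]
        have : (t - a) * K ≤ 1 / 2 := by nlinarith [hK.pos, ht.2]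
        have h3 : t - a ≤ 1 := by linarith [ht.2]
        nlinarith
    refine (norm_add₃_le).trans ?_
    linarith [e1 t ht]
  intro t ht
  linarith [hX t ht]

/-- Induction along an interval in steps of a fixed length. -/
theorem interval_step_induction {P : ℝ → Prop} {a b τ : ℝ} (hτ : 0 < τ) (hab : a ≤ b) (h0 : P a)
    (hstep : ∀ t ∈ Icc a b, P t → P (min (t + τ) b)) : P b := by
  have h : ∀ n : ℕ, P (min (a + n * τ) b) := by
    intro n
    induction n with
    | zero => simpa [hab] using h0
    | succ k ih =>
      have := hstep _ ⟨le_min (by nlinarith [(Nat.cast_nonneg k : (0:ℝ) ≤ k)]) hab,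
        min_le_right _ _⟩ ih
      convert this using 1
      push_cast
      rcases le_total (a + k * τ) b with hk | hk
      · rw [min_eq_left hk]; ring_nf
      · rw [min_eq_right hk, min_eq_right (by nlinarith), min_eq_right (by linarith)]
  obtain ⟨n, hn⟩ := exists_nat_gt ((b - a) / τ)
  have h1 := h n
  rw [div_lt_iff₀ hτ] at hn
  rwa [min_eq_right (by linarith)] at h1

theorem exists_norm_bound {z : ℝ → X} {a b : ℝ} (hz : ContinuousOn z (Icc a b)) :
    ∃ M, 0 ≤ M ∧ ∀ t ∈ Icc a b, ‖z t‖ ≤ M := by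
  obtain ⟨C, hC⟩ := isCompact_Icc.exists_bound_of_continuousOn hz
  exact ⟨max C 0, le_max_right _ _, fun t ht => (hC t ht).trans (le_max_left _ _)⟩

theorem exists_step {K : ℝ} (hK : 0 < K) : ∃ τ : ℝ, 0 < τ ∧ τ ≤ 1 ∧ τ * K ≤ 1 / 2 := by
  refine ⟨min 1 (1 / (2 * K)), by positivity, min_le_left _ _, ?_⟩
  calc min 1 (1 / (2 * K)) * K ≤ 1 / (2 * K) * K := by gcongr; exact min_le_right _ _
    _ = 1 / 2 := by field_simp

theorem IsMild.unique (hF : QuasiLipschitzField J F) (hG : Continuous G) {a b : ℝ} {z₀ : X}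
    {z z' : ℝ → X} (h : IsMild F G a b z₀ z) (h' : IsMild F G a b z₀ z') :
    EqOn z z' (Icc a b) := by
  by_cases hab : a ≤ b
  swap
  · intro t ht; exact absurd (ht.1.trans ht.2) hab
  obtain ⟨M₁, -, hM₁⟩ := exists_norm_bound h.1
  obtain ⟨M₂, -, hM₂⟩ := exists_norm_bound h'.1
  obtain ⟨K, hK⟩ := hF.exists_bound (max M₁ M₂)
  obtain ⟨τ, hτ, hτ1, hτK⟩ := exists_step hK.pos
  refine interval_step_induction (P := fun c => EqOn z z' (Icc a c)) hτ hab ?_ ?_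
  · intro t ht
    rw [Icc_self, mem_singleton_iff] at ht
    rw [ht, h.left hab, h'.left hab]
  intro c hc ih t ht
  rcases le_total t c with htc | hct
  · exact ih ⟨ht.1, htc⟩
  set c' := min (c + τ) b
  have hcc : c ≤ c' := le_min (by linarith) hc.2
  have hcb : c' ≤ b := min_le_right _ _
  have hcτ : c' - c ≤ τ := by linarith [min_le_left (c + τ) b]
  have m := (h.mono hcb).restart hF.cont hG hc.1 hcc
  have m' := (h'.mono hcb).restart hF.cont hG hc.1 hcc
  rw [← sub_eq_zero, ← norm_eq_zero]
  refine le_antisymm (le_of_forall_pos_le_add fun ρ hρ => ?_) (norm_nonneg _)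
  -- Equal data and equal phases allow δ = 0 below, so the distance is at most 2(ρ/2) for every ρ >
  -- 0.
  obtain ⟨σ, hσ0, hσ⟩ := hK.strong (ρ / 2) (by positivity)
  have hI : ∀ s ∈ Icc c c', s ∈ Icc a b := fun s hs => ⟨hc.1.trans hs.1, hs.2.trans hcb⟩
  have := m.stability_step hF.cont hK hG hG (hcτ.trans hτ1)
    ((mul_le_mul_of_nonneg_right hcτ hK.pos.le).trans hτK) m'
    (fun s hs => (hM₁ s (hI s hs)).trans (le_max_left _ _))
    (fun s hs => (hM₂ s (hI s hs)).trans (le_max_right _ _)) (δ := 0)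
    (by rw [ih ⟨hc.1, le_rfl⟩]; simp) (by simp) hσ (by simpa using hσ0.le) (by positivity)
    t ⟨hct, ht.2⟩
  linarith

end AbstractODE

/-! ### Local existence, maximal solutions and dependence on the phase. -/

section AbstractODEExistence

set_option linter.unusedSectionVars false

variable {X : Type*} [NormedAddCommGroup X] [NormedSpace ℝ X] [CompleteSpace X]
  {F : ℝ → X → X} {J : X →L[ℝ] X} {G : ℝ → ℝ}

/-- One Picard iteration on `[a, a + τ]`, extended to a function on `ℝ`. -/
def picardStep (F : ℝ → X → X) (G : ℝ → ℝ) (a τ : ℝ) (z₀ : X) (z : ℝ → X) (t : ℝ) : X :=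
  z₀ + ∫ s in a..max a (min t (a + τ)), F (G s) (z s)

theorem continuous_picardStep (hF : Continuous fun q : ℝ × X => F q.1 q.2) (hG : Continuous G)
    (a τ : ℝ) (z₀ : X) {z : ℝ → X} (hz : Continuous z) :
    Continuous (picardStep F G a τ z₀ z) := by
  have h1 : Continuous fun s => F (G s) (z s) := hF.comp (hG.prodMk hz)
  have h2 := intervalIntegral.continuous_primitive (μ := volume)
    (fun b c => h1.intervalIntegrable b c) a
  exact continuous_const.add (h2.comp (by fun_prop))

theorem norm_integral_clamp_le {f : ℝ → X} {a τ A : ℝ} (hτ : 0 ≤ τ) (hA : 0 ≤ A)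
    (hf : ∀ s, ‖f s‖ ≤ A) (t : ℝ) :
    ‖∫ s in a..max a (min t (a + τ)), f s‖ ≤ τ * A := by
  refine (intervalIntegral.norm_integral_le_of_norm_le_const (C := A) (fun s _ => hf s)).trans ?_
  have h1 : a ≤ max a (min t (a + τ)) := le_max_left _ _
  have h2 : max a (min t (a + τ)) ≤ a + τ := max_le (by linarith) (min_le_right _ _)
  rw [abs_of_nonneg (by linarith), mul_comm]
  gcongr
  linarith

/-- The Picard map need not be a contraction in the strong norm. Its iterates converge geometrically
in the weak norm, and from some index on this makes them contract strongly up to an arbitrary ρ,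
which still yields a uniform Cauchy sequence. The length τ depends on M alone, as is needed for
continuation. -/
theorem QuasiLipschitzField.exists_local (hF : QuasiLipschitzField J F) {M : ℝ} (hM : 0 ≤ M) :
    ∃ τ > 0, ∀ G : ℝ → ℝ, Continuous G → ∀ a z₀, ‖z₀‖ ≤ M →
      ∃ z, IsMild F G a (a + τ) z₀ z ∧ ∀ t ∈ Icc a (a + τ), ‖z t‖ ≤ M + 1 := by
  obtain ⟨K, hK⟩ := hF.exists_bound (M + 1)
  obtain ⟨τ, hτ, hτ1, hτK⟩ := exists_step hK.pos
  refine ⟨τ, hτ, fun G hG a z₀ hz₀ => ?_⟩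
  let z : ℕ → ℝ → X := fun n => (picardStep F G a τ z₀)^[n] (fun _ => z₀)
  have zs : ∀ n, z (n + 1) = picardStep F G a τ z₀ (z n) := fun n =>
    Function.iterate_succ_apply' _ _ _
  have zc : ∀ n, Continuous (z n) := by
    intro n
    induction n with
    | zero => exact continuous_const
    | succ k ih => rw [zs]; exact continuous_picardStep hF.cont hG a τ z₀ ih
  have zb : ∀ n t, ‖z n t‖ ≤ M + 1 := by
    intro n
    induction n with
    | zero => intro t; exact hz₀.trans (by linarith)
    | succ k ih =>
      intro t
      rw [zs]
      refine (norm_add_le _ _).trans (add_le_add hz₀ ?_)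
      refine (norm_integral_clamp_le hτ.le hK.pos.le (fun s => hK.bdd _ _ (ih s)) t).trans ?_
      linarith
  have fc : ∀ n, Continuous fun s => F (G s) (z n s) := fun n => hF.cont.comp (hG.prodMk (zc n))
  have fcs : ∀ n m, Continuous fun s => F (G s) (z n s) - F (G s) (z m s) := fun n m =>
    (fc n).sub (fc m)
  have diff : ∀ n m t, z (n + 1) t - z (m + 1) t =
      ∫ s in a..max a (min t (a + τ)), (F (G s) (z n s) - F (G s) (z m s)) := by
    intro n m t
    rw [intervalIntegral.integral_sub ((fc n).intervalIntegrable _ _)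
      ((fc m).intervalIntegrable _ _), zs, zs]
    simp only [picardStep]
    abel
  set B := ‖J‖ * (2 * (M + 1)) with hB
  have hB0 : 0 ≤ B := by positivity
  have zd : ∀ n m t, ‖z n t - z m t‖ ≤ 2 * (M + 1) := fun n m t =>
    (norm_sub_le _ _).trans (by linarith [zb n t, zb m t])
  have hJ : ∀ n k t, ‖J (z n t) - J (z (n + k) t)‖ ≤ B * (1 / 2) ^ n := by
    intro n
    induction n with
    | zero =>
      intro k t
      rw [← map_sub]
      refine (J.le_opNorm _).trans ?_
      simp only [pow_zero, mul_one, hB]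
      gcongr
      exact zd _ _ _
    | succ n ih =>
      intro k t
      rw [← map_sub, add_right_comm, diff, ← ContinuousLinearMap.intervalIntegral_comp_comm J
        ((fcs _ _).intervalIntegrable _ _)]
      refine (norm_integral_clamp_le (A := K * (B * (1 / 2) ^ n)) hτ.le
        (by have := hK.pos; positivity) (fun s => ?_) t).trans ?_
      · rw [map_sub]
        refine (hK.weak _ _ _ (zb _ _) (zb _ _)).trans ?_
        have := hK.pos
        gcongr
        exact ih k s
      · rw [← mul_assoc, pow_succ]
        have : 0 ≤ B * (1 / 2) ^ n := by positivity
        nlinarith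
  -- After index N the weak distances are below σ. Each further iteration then halves the strong
  -- distance and adds ρ/2, so the error never exceeds ρ.
  have hX : ∀ ρ > 0, ∃ N, ∀ j k t, ‖z (N + j) t - z (N + j + k) t‖ ≤
      2 * (M + 1) * (1 / 2) ^ j + ρ := by
    intro ρ hρ
    obtain ⟨σ, hσ0, hσ⟩ := hK.strong (ρ / 2) (by positivity)
    obtain ⟨N, hN⟩ := exists_pow_lt_of_lt_one (show 0 < σ / (B + 1) by positivity)
      (show (1 / 2 : ℝ) < 1 by norm_num)
    rw [lt_div_iff₀ (by positivity)] at hN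
    refine ⟨N, fun j => ?_⟩
    induction j with
    | zero =>
      intro k t
      refine (zd _ _ _).trans ?_
      simp only [pow_zero, mul_one]
      linarith
    | succ j ih =>
      intro k t
      rw [show N + (j + 1) + k = (N + j + k) + 1 by ring, ← add_assoc, diff]
      refine (norm_integral_clamp_le (A := K * (2 * (M + 1) * (1 / 2) ^ j + ρ) + ρ / 2) hτ.le
        (by have := hK.pos; positivity) (fun s => ?_) t).trans ?_
      · refine (hσ _ _ _ (zb _ _) (zb _ _) ((hJ _ _ _).trans ?_)).trans ?_
        · have h1 : (1 / 2 : ℝ) ^ (N + j) ≤ (1 / 2) ^ N :=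
            pow_le_pow_of_le_one (by norm_num) (by norm_num) (by omega)
          have h2 : (0:ℝ) < (1 / 2) ^ N := by positivity
          nlinarith
        · have := hK.pos
          gcongr
          exact ih k s
      · have h1 : 0 ≤ 2 * (M + 1) * (1 / 2 : ℝ) ^ j + ρ := by positivity
        rw [pow_succ]
        nlinarith
  have hC : ∀ ε > 0, ∃ N, ∀ n ≥ N, ∀ k t, ‖z n t - z (n + k) t‖ ≤ ε := by
    intro ε hε
    obtain ⟨N, hN⟩ := hX (ε / 2) (by positivity)
    obtain ⟨j, hj⟩ := exists_pow_lt_of_lt_one (show 0 < ε / 2 / (2 * (M + 1)) by positivity)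
      (show (1 / 2 : ℝ) < 1 by norm_num)
    rw [lt_div_iff₀ (by positivity)] at hj
    refine ⟨N + j, fun n hn k t => ?_⟩
    obtain ⟨i, rfl⟩ := Nat.exists_eq_add_of_le hn
    rw [add_assoc N j i]
    refine (hN _ _ _).trans ?_
    have h1 : (1 / 2 : ℝ) ^ (j + i) ≤ (1 / 2) ^ j :=
      pow_le_pow_of_le_one (by norm_num) (by norm_num) (by omega)
    have h2 : 2 * (M + 1) * (1 / 2 : ℝ) ^ (j + i) ≤ 2 * (M + 1) * (1 / 2) ^ j := by gcongr
    linarith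
  have hlim : ∀ t, ∃ y, Tendsto (fun n => z n t) atTop (𝓝 y) := by
    intro t
    refine cauchySeq_tendsto_of_complete (Metric.cauchySeq_iff'.2 fun ε hε => ?_)
    obtain ⟨N, hN⟩ := hC (ε / 2) (by positivity)
    refine ⟨N, fun n hn => ?_⟩
    obtain ⟨k, rfl⟩ := Nat.exists_eq_add_of_le hn
    rw [dist_comm, dist_eq_norm]
    linarith [hN N le_rfl k t]
  choose y hy using hlim
  have hyu : TendstoUniformly z y atTop := by
    refine Metric.tendstoUniformly_iff.2 fun ε hε => ?_
    obtain ⟨N, hN⟩ := hC (ε / 2) (by positivity)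
    filter_upwards [eventually_ge_atTop N] with n hn t
    rw [dist_comm, dist_eq_norm]
    have h1 : Tendsto (fun k => ‖z n t - z (n + k) t‖) atTop (𝓝 ‖z n t - y t‖) :=
      (tendsto_const_nhds.sub ((hy t).comp (tendsto_add_atTop_nat n |>.congr
        fun k => by rw [add_comm]))).norm
    have := le_of_tendsto h1 (Eventually.of_forall fun k => hN n hn k t)
    linarith
  have yc : Continuous y := hyu.continuous (Eventually.of_forall zc).frequently
  have yb : ∀ t, ‖y t‖ ≤ M + 1 := fun t =>
    le_of_tendsto (hy t).norm (Eventually.of_forall fun n => zb n t)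
  refine ⟨y, ⟨yc.continuousOn, fun t ht => ?_⟩, fun t _ => yb t⟩
  refine tendsto_nhds_unique ((hy t).comp (tendsto_add_atTop_nat 1)) ?_
  have h1 : ∀ n, z (n + 1) t = z₀ + ∫ s in a..t, F (G s) (z n s) := by
    intro n
    rw [zs, picardStep, min_eq_left ht.2, max_eq_right ht.1]
  simp only [Function.comp_def, h1]
  refine tendsto_const_nhds.add ?_
  refine intervalIntegral.tendsto_integral_filter_of_dominated_convergence (fun _ => K)
    (Eventually.of_forall fun n => (fc n).aestronglyMeasurable)
    (Eventually.of_forall fun n => Eventually.of_forall fun s _ => hK.bdd _ _ (zb n s))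
    (by simp) (Eventually.of_forall fun s _ => ?_)
  exact (hF.cont.tendsto (G s, y s)).comp (tendsto_const_nhds.prodMk_nhds (hy s))

/-- The integral equation has a maximal solution, and it lives on a half-open interval. -/
theorem QuasiLipschitzField.exists_maximal (hF : QuasiLipschitzField J F) (hG : Continuous G)
    (a : ℝ) (z₀ : X) :
    ∃ (Tmax : EReal) (z : ℝ → X), (a : EReal) < Tmax ∧
      (∀ T : ℝ, (T : EReal) < Tmax → IsMild F G a T z₀ z) ∧
      ∀ (T : ℝ) (z' : ℝ → X), a ≤ T → IsMild F G a T z₀ z' → (T : EReal) < Tmax := by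
  classical
  -- S contains every T < a vacuously, hence the extra condition a ≤ T in what follows.
  set S : Set ℝ := {T | ∃ z, IsMild F G a T z₀ z} with hS
  have ext : ∀ T ∈ S, a ≤ T → ∃ T' ∈ S, T < T' := by
    rintro T ⟨z, hz⟩ haT
    obtain ⟨τ, hτ, h⟩ := hF.exists_local (norm_nonneg (z T))
    obtain ⟨z', hz', -⟩ := h G hG T (z T) le_rfl
    exact ⟨T + τ, ⟨_, hz.glue hF.cont hG haT (by linarith) hz'⟩, by linarith⟩
  have lt : ∀ T ∈ S, a ≤ T → (T : EReal) < sSup ((fun T : ℝ => (T : EReal)) '' S) := by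
    intro T hT haT
    obtain ⟨T', hT', h⟩ := ext T hT haT
    exact (EReal.coe_lt_coe_iff.2 h).trans_le (le_sSup ⟨T', hT', rfl⟩)
  have haS : a ∈ S := by
    refine ⟨fun _ => z₀, continuousOn_const, fun t ht => ?_⟩
    rw [Icc_self, mem_singleton_iff] at ht
    simp [ht]
  have mem : ∀ T : ℝ, (T : EReal) < sSup ((fun T : ℝ => (T : EReal)) '' S) → T ∈ S := by
    intro T hT
    obtain ⟨_, ⟨T', ⟨z, hz⟩, rfl⟩, h⟩ := lt_sSup_iff.1 hT
    exact ⟨z, hz.mono (EReal.coe_lt_coe_iff.1 h).le⟩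
  choose! y hy using (fun T (hT : T ∈ S) => hT)
  -- The maximal solution is taken on the diagonal: at time t, the chosen solution on [a, t] is
  -- evaluated at its endpoint. Uniqueness makes these values consistent.
  refine ⟨sSup ((fun T : ℝ => (T : EReal)) '' S), fun t => y t t, lt a haS le_rfl,
    fun T hT => ?_, fun T z' haT hz' => lt T ⟨z', hz'⟩ haT⟩
  refine (hy T (mem T hT)).congr fun t ht => ?_
  have h1 := (hy T (mem T hT)).mono ht.2
  have h2 := hy t ⟨_, h1⟩
  exact h2.unique hF hG h1 ⟨ht.1, le_rfl⟩

/-- The graph of (G, z) over [a, b] is compact, and a continuous map is uniformly continuous at the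
points of a compact set even when the second point ranges over the whole space. -/
theorem uniform_near_compact {Y : Type*} [NormedAddCommGroup Y] {Φ : ℝ → X → Y}
    (hΦ : Continuous fun q : ℝ × X => Φ q.1 q.2) (hG : Continuous G) {z : ℝ → X} {a b : ℝ}
    (hz : ContinuousOn z (Icc a b)) {δ : ℝ} (hδ : 0 < δ) :
    ∃ η > 0, ∀ t ∈ Icc a b, ∀ c, |c - G t| ≤ η → ‖Φ (G t) (z t) - Φ c (z t)‖ ≤ δ := by
  have hK : IsCompact ((fun t => (G t, z t)) '' Icc a b) :=
    isCompact_Icc.image_of_continuousOn (hG.continuousOn.prodMk hz)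
  have h := hK.uniformContinuousAt_of_continuousAt _ (fun q _ => hΦ.continuousAt)
    (Metric.dist_mem_uniformity hδ)
  obtain ⟨η, hη, h⟩ := Metric.mem_uniformity_dist.1 h
  refine ⟨η / 2, by positivity, fun t ht c hc => ?_⟩
  have h1 := h (a := (G t, z t)) (b := (c, z t)) (by
    rw [Prod.dist_eq]
    simp only [dist_self]
    rw [max_eq_left dist_nonneg, dist_comm, Real.dist_eq]
    linarith) ⟨t, ht, rfl⟩
  rw [mem_ofPred_eq, dist_eq_norm] at h1
  exact h1.le

/-- Solutions persist, and stay close, under uniformly small perturbations of the phase `G`. -/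
theorem QuasiLipschitzField.stability (hF : QuasiLipschitzField J F) (hG : Continuous G) {a b : ℝ}
    (hab : a ≤ b) {z₀ : X} {z : ℝ → X} (hz : IsMild F G a b z₀ z) {δ : ℝ} (hδ : 0 < δ) :
    ∃ η > 0, ∀ G' : ℝ → ℝ, Continuous G' → (∀ t ∈ Icc a b, |G' t - G t| ≤ η) →
      ∃ z', IsMild F G' a b z₀ z' ∧ ∀ t ∈ Icc a b, ‖z t - z' t‖ ≤ δ := by
  obtain ⟨M, hM0, hM⟩ := exists_norm_bound hz.1
  obtain ⟨τ₁, hτ₁, hloc⟩ := hF.exists_local (M := M + 1) (by positivity)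
  obtain ⟨K, hK⟩ := hF.exists_bound (M + 1 + 1)
  obtain ⟨τ₂, hτ₂, hτ1, hτK⟩ := exists_step hK.pos
  set τ := min τ₁ τ₂
  have hτ : 0 < τ := lt_min hτ₁ hτ₂
  suffices h : ∀ δ : ℝ, 0 < δ → ∃ η > 0, ∀ G' : ℝ → ℝ, Continuous G' →
      (∀ t ∈ Icc a b, |G' t - G t| ≤ η) →
      ∃ z', IsMild F G' a b z₀ z' ∧ ∀ t ∈ Icc a b, ‖z t - z' t‖ ≤ δ from h δ hδ
  -- The accuracy δ is quantified inside P, so that each step may ask the previous one for a much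
  -- smaller accuracy δ'. The step length τ is fixed by the bound M on z.
  refine interval_step_induction (P := fun c => ∀ δ : ℝ, 0 < δ → ∃ η > 0, ∀ G' : ℝ → ℝ,
    Continuous G' → (∀ t ∈ Icc a b, |G' t - G t| ≤ η) →
    ∃ z', IsMild F G' a c z₀ z' ∧ ∀ t ∈ Icc a c, ‖z t - z' t‖ ≤ δ) hτ hab ?_ ?_
  · intro δ hδ
    refine ⟨1, one_pos, fun G' _ _ => ⟨z, ⟨?_, ?_⟩, ?_⟩⟩
    · simp
    · intro t ht
      rw [Icc_self, mem_singleton_iff] at ht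
      simp [ht, hz.left hab]
    · intro t _
      simpa using hδ.le
  intro c hc ih δ hδ
  obtain ⟨σ, hσ0, hσ⟩ := hK.strong (δ / 4) (by positivity)
  -- The bound 1 keeps the perturbed solution in the ball of radius M + 1 at time c. The bound δ/8
  -- gives 4δ' + 2(δ/4) ≤ δ. The last one meets the weak closeness condition, with + 1 in case J =
  -- 0.
  set δ' := min (min 1 (δ / 8)) (σ / (4 * ‖J‖ + 1))
  have hδ' : 0 < δ' := by positivity
  have hδ1 : δ' ≤ 1 := (min_le_left _ _).trans (min_le_left _ _)
  have hδ2 : δ' ≤ δ / 8 := (min_le_left _ _).trans (min_le_right _ _)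
  have hδ3 : 4 * ‖J‖ * δ' ≤ σ := by
    have h1 : δ' ≤ σ / (4 * ‖J‖ + 1) := min_le_right _ _
    rw [le_div_iff₀ (by positivity)] at h1
    nlinarith
  obtain ⟨η₁, hη₁, h1⟩ := ih δ' hδ'
  obtain ⟨η₂, hη₂, h2⟩ := uniform_near_compact hF.cont hG hz.1 hδ'
  refine ⟨min η₁ η₂, lt_min hη₁ hη₂, fun G' hG' hGG => ?_⟩
  obtain ⟨z₁, hz₁, hd₁⟩ := h1 G' hG' fun t ht => (hGG t ht).trans (min_le_left _ _)
  have hc' : c ∈ Icc a c := ⟨hc.1, le_rfl⟩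
  have hn : ‖z₁ c‖ ≤ M + 1 := by
    have := norm_sub_norm_le (z₁ c) (z c)
    rw [norm_sub_rev] at this
    linarith [hd₁ c hc', hM c hc]
  obtain ⟨z₂, hz₂, hb₂⟩ := hloc G' hG' c (z₁ c) hn
  set c' := min (c + τ) b
  have hcc : c ≤ c' := le_min (by linarith) hc.2
  have hcb : c' ≤ b := min_le_right _ _
  have hcτ : c' ≤ c + τ := min_le_left _ _
  have hcτ₁ : c' ≤ c + τ₁ := hcτ.trans (by linarith [min_le_left τ₁ τ₂])
  have hcτ₂ : c' - c ≤ τ₂ := by linarith [min_le_right τ₁ τ₂]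
  have hz₂' := hz₂.mono hcτ₁
  refine ⟨_, hz₁.glue hF.cont hG' hc.1 hcc hz₂', fun t ht => ?_⟩
  have hI : ∀ s ∈ Icc c c', s ∈ Icc a b := fun s hs => ⟨hc.1.trans hs.1, hs.2.trans hcb⟩
  have m := (hz.mono hcb).restart hF.cont hG hc.1 hcc
  rcases le_or_gt t c with htc | hct
  · simp only [htc, if_true]
    exact (hd₁ t ⟨ht.1, htc⟩).trans (by linarith)
  · simp only [not_le.2 hct, if_false]
    have := m.stability_step hF.cont hK hG hG' (hcτ₂.trans hτ1)
      ((mul_le_mul_of_nonneg_right hcτ₂ hK.pos.le).trans hτK) hz₂'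
      (fun s hs => (hM s (hI s hs)).trans (by linarith))
      (fun s hs => hb₂ s ⟨hs.1, hs.2.trans hcτ₁⟩) (δ := δ') (hd₁ c hc')
      (fun s hs => h2 s (hI s hs) _ ((hGG s (hI s hs)).trans (min_le_right _ _)))
      hσ hδ3 (by positivity) t ⟨hct.le, ht.2⟩
    linarith

end AbstractODEExistence

/-! ### Pointwise calculus of z ↦ |z|^q z for q ≥ 1. -/

section PowerMap

/-- The map `z ↦ |z|^q z` on `ℂ`. -/
def powerMap (q : ℝ) (z : ℂ) : ℂ := ((‖z‖ ^ q : ℝ) : ℂ) * z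

/-- The real derivative of `powerMap`. -/
def powerMapDeriv (q : ℝ) (z : ℂ) : ℂ →L[ℝ] ℂ :=
  (‖z‖ ^ q) • ContinuousLinearMap.id ℝ ℂ + (q * ‖z‖ ^ (q - 2)) • (innerSL ℝ z).smulRight z

theorem powerMapDeriv_apply (q : ℝ) (z k : ℂ) :
    powerMapDeriv q z k = (‖z‖ ^ q) • k + (q * ‖z‖ ^ (q - 2) * inner ℝ z k) • z := by
  simp [powerMapDeriv, mul_assoc]

theorem powerMap_zero (q : ℝ) : powerMap q 0 = 0 := by simp [powerMap]

theorem powerMap_eq_smul (q : ℝ) : powerMap q = fun z => (‖z‖ ^ q) • z := by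
  ext z; simp [powerMap]

theorem powerMapDeriv_zero {q : ℝ} (hq : 1 ≤ q) : powerMapDeriv q 0 = 0 := by
  ext; simp [powerMapDeriv, Real.zero_rpow (by linarith : q ≠ 0)]

theorem norm_powerMap (q : ℝ) (z : ℂ) : ‖powerMap q z‖ = ‖z‖ ^ q * ‖z‖ := by
  rw [powerMap, norm_mul, Complex.norm_real, Real.norm_of_nonneg (by positivity)]

theorem hasFDerivAt_powerMap {q : ℝ} (hq : 1 ≤ q) (z : ℂ) :
    HasFDerivAt (powerMap q) (powerMapDeriv q z) z := by
  by_cases hz : z = 0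
  · subst hz
    rw [powerMapDeriv_zero hq]
    refine HasFDerivAt.of_isLittleO ?_
    simp only [powerMap_zero, sub_zero, _root_.zero_apply]
    rw [Asymptotics.isLittleO_iff]
    intro c hc
    have h1 : Tendsto (fun x : ℂ => ‖x‖ ^ q) (𝓝 0) (𝓝 0) := by
      have : ContinuousAt (fun x : ℂ => ‖x‖ ^ q) 0 :=
        (continuous_norm.continuousAt).rpow_const (Or.inr (by linarith))
      simpa [ContinuousAt, Real.zero_rpow (by linarith : q ≠ 0)] using this
    filter_upwards [h1.eventually_le_const hc] with x hx
    rw [norm_powerMap]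
    gcongr
  · have h0 : 0 < ‖z‖ := norm_pos_iff.2 hz
    -- The squared norm is smooth, so |x|^q is differentiated as (|x|²)^{q/2}.
    have h1 : HasFDerivAt (fun x : ℂ => (‖x‖ ^ 2) ^ (q / 2))
        ((q / 2 * (‖z‖ ^ 2) ^ (q / 2 - 1)) • (2 • innerSL ℝ z)) z :=
      (hasStrictFDerivAt_norm_sq z).hasFDerivAt.rpow_const (Or.inl (by positivity))
    have h2 : (fun x : ℂ => (‖x‖ ^ 2) ^ (q / 2)) = fun x => ‖x‖ ^ q := by
      ext x
      rw [← Real.rpow_natCast_mul (norm_nonneg _)]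
      congr 1; push_cast; ring
    rw [h2] at h1
    have h3 := h1.smul (hasFDerivAt_id z)
    rw [powerMap_eq_smul]
    refine h3.congr_fderiv ?_
    have h4 : (‖z‖ ^ 2) ^ (q / 2 - 1) = ‖z‖ ^ (q - 2) := by
      rw [← Real.rpow_natCast_mul (norm_nonneg _)]
      congr 1; push_cast; ring
    ext1 k
    · rw [h4, powerMapDeriv_apply]
      simp
      left
      ring

theorem rpow_sub_rpow_le {q a b M : ℝ} (hq : 1 ≤ q) (ha : 0 ≤ a) (hb : 0 ≤ b) (haM : a ≤ M)
    (hbM : b ≤ M) : |a ^ q - b ^ q| ≤ q * M ^ (q - 1) * |a - b| := by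
  have h := (convex_Icc 0 M).norm_image_sub_le_of_norm_hasDerivWithin_le
    (f := fun x : ℝ => x ^ q) (f' := fun x => q * x ^ (q - 1)) (C := q * M ^ (q - 1))
    (fun x _ => (Real.hasDerivAt_rpow_const (Or.inr hq)).hasDerivWithinAt)
    (fun x hx => ?_) ⟨hb, hbM⟩ ⟨ha, haM⟩
  · simpa only [Real.norm_eq_abs] using h
  · rw [Real.norm_of_nonneg (by have := hx.1; positivity)]
    have := hx.1
    gcongr
    exact hx.2

/-- The direction a/|a| is singular at 0, but it becomes Lipschitz after weighting by the smaller
modulus. -/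
theorem norm_inv_smul_sub_le {a b : ℂ} (hb : b ≠ 0) (hba : ‖b‖ ≤ ‖a‖) :
    ‖(‖a‖⁻¹ • a) - (‖b‖⁻¹ • b)‖ * ‖b‖ ≤ 2 * ‖a - b‖ := by
  have hb' : 0 < ‖b‖ := norm_pos_iff.2 hb
  have ha' : 0 < ‖a‖ := hb'.trans_le hba
  have h1 : ‖b‖ • ((‖a‖⁻¹ • a) - (‖b‖⁻¹ • b)) = (‖b‖ * ‖a‖⁻¹ - 1) • a + (a - b) := by
    rw [smul_sub, smul_smul, smul_smul, mul_inv_cancel₀ hb'.ne', one_smul, sub_smul, one_smul]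
    abel
  have h2 : ‖(‖b‖ * ‖a‖⁻¹ - 1) • a‖ ≤ ‖a - b‖ := by
    rw [norm_smul, Real.norm_eq_abs, ← abs_of_pos ha', ← abs_mul, sub_mul, one_mul, mul_assoc,
      abs_of_pos ha', inv_mul_cancel₀ ha'.ne', mul_one, abs_sub_comm]
    exact abs_norm_sub_norm_le a b
  calc ‖(‖a‖⁻¹ • a) - (‖b‖⁻¹ • b)‖ * ‖b‖ = ‖‖b‖ • ((‖a‖⁻¹ • a) - (‖b‖⁻¹ • b))‖ := by
        rw [norm_smul, norm_norm, mul_comm]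
    _ ≤ 2 * ‖a - b‖ := by
        rw [h1]; exact (norm_add_le _ _).trans (by linarith)

theorem norm_powerMapDeriv_sub_le {q M : ℝ} (hq : 1 ≤ q) {a b : ℂ} (ha : ‖a‖ ≤ M)
    (hb : ‖b‖ ≤ M) :
    ‖powerMapDeriv q a - powerMapDeriv q b‖ ≤ (q + q * (q + 4)) * M ^ (q - 1) * ‖a - b‖ := by
  wlog hba : ‖b‖ ≤ ‖a‖ generalizing a b
  · rw [norm_sub_rev, norm_sub_rev a b]
    exact this hb ha (le_of_not_ge hba)
  have hM : 0 ≤ M := (norm_nonneg _).trans ha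
  have hMq : 0 ≤ M ^ (q - 1) := by positivity
  have hAB : |‖a‖ ^ q - ‖b‖ ^ q| ≤ q * M ^ (q - 1) * ‖a - b‖ :=
    (rpow_sub_rpow_le hq (norm_nonneg _) (norm_nonneg _) ha hb).trans (by
      gcongr; exact abs_norm_sub_norm_le a b)
  -- In polar form the derivative is |z|^q times a bounded function of the direction. Its Lipschitz
  -- bound then follows from those for |z|^q and for the weighted direction.
  have form : ∀ z k : ℂ, powerMapDeriv q z k = (‖z‖ ^ q) • k +
      (q * ‖z‖ ^ q) • ((inner ℝ (‖z‖⁻¹ • z) k) • (‖z‖⁻¹ • z)) := by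
    intro z k
    rw [powerMapDeriv_apply]
    by_cases hz : z = 0
    · simp [hz]
    have hz' : 0 < ‖z‖ := norm_pos_iff.2 hz
    congr 1
    rw [real_inner_smul_left, smul_smul, smul_smul, Real.rpow_sub hz', Real.rpow_two]
    congr 1
    field_simp
  have hn : ∀ z : ℂ, ‖‖z‖⁻¹ • z‖ ≤ 1 := by
    intro z
    rw [norm_smul, norm_inv, norm_norm]
    exact inv_mul_le_one
  refine ContinuousLinearMap.opNorm_le_bound _ (by positivity) fun k => ?_
  rw [_root_.sub_apply, form, form]
  set n := ‖a‖⁻¹ • a with hna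
  set m := ‖b‖⁻¹ • b with hmb
  have hB : ‖b‖ ^ q * ‖n - m‖ ≤ 2 * M ^ (q - 1) * ‖a - b‖ := by
    by_cases hb0 : b = 0
    · simp only [hb0, norm_zero, Real.zero_rpow (by linarith : q ≠ 0), zero_mul]
      positivity
    have hb' : 0 < ‖b‖ := norm_pos_iff.2 hb0
    have h1 : ‖b‖ ^ q = ‖b‖ ^ (q - 1) * ‖b‖ := by
      rw [Real.rpow_sub_one hb'.ne']; field_simp
    have h2 := norm_inv_smul_sub_le hb0 hba
    rw [← hna, ← hmb] at h2
    have h3 : ‖b‖ ^ (q - 1) ≤ M ^ (q - 1) :=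
      Real.rpow_le_rpow hb'.le hb (by linarith)
    rw [h1]
    calc ‖b‖ ^ (q - 1) * ‖b‖ * ‖n - m‖ = ‖b‖ ^ (q - 1) * (‖n - m‖ * ‖b‖) := by ring
      _ ≤ M ^ (q - 1) * (2 * ‖a - b‖) := by gcongr
      _ = _ := by ring
  have e : (‖a‖ ^ q) • k + (q * ‖a‖ ^ q) • ((inner ℝ n k) • n) -
      ((‖b‖ ^ q) • k + (q * ‖b‖ ^ q) • ((inner ℝ m k) • m)) =
      (‖a‖ ^ q - ‖b‖ ^ q) • k + (q * (‖a‖ ^ q - ‖b‖ ^ q)) • ((inner ℝ n k) • n) +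
      (q * ‖b‖ ^ q) • ((inner ℝ (n - m) k) • n + (inner ℝ m k) • (n - m)) := by
    rw [inner_sub_left]
    module
  rw [e]
  have i1 : |inner ℝ n k| ≤ ‖k‖ := (abs_real_inner_le_norm n k).trans
    (mul_le_of_le_one_left (norm_nonneg _) (hn a))
  have i2 : |inner ℝ m k| ≤ ‖k‖ := (abs_real_inner_le_norm m k).trans
    (mul_le_of_le_one_left (norm_nonneg _) (hn b))
  have t1 : ‖(‖a‖ ^ q - ‖b‖ ^ q) • k‖ ≤ q * M ^ (q - 1) * ‖a - b‖ * ‖k‖ := by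
    rw [norm_smul, Real.norm_eq_abs]; gcongr
  have t2 : ‖(q * (‖a‖ ^ q - ‖b‖ ^ q)) • ((inner ℝ n k) • n)‖ ≤
      q * (q * M ^ (q - 1) * ‖a - b‖) * (‖k‖ * 1) := by
    rw [norm_smul, norm_smul, Real.norm_eq_abs, Real.norm_eq_abs, abs_mul,
      abs_of_nonneg (by linarith : 0 ≤ q)]
    gcongr
    exact hn a
  have t3 : ‖(q * ‖b‖ ^ q) • ((inner ℝ (n - m) k) • n + (inner ℝ m k) • (n - m))‖ ≤
      q * (4 * M ^ (q - 1) * ‖a - b‖) * ‖k‖ := by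
    have h1 : ‖(inner ℝ (n - m) k) • n + (inner ℝ m k) • (n - m)‖ ≤ 2 * ‖n - m‖ * ‖k‖ := by
      refine (norm_add_le _ _).trans ?_
      rw [norm_smul (inner ℝ (n - m) k) n, norm_smul (inner ℝ m k) (n - m), Real.norm_eq_abs,
        Real.norm_eq_abs]
      have h2 := abs_real_inner_le_norm (n - m) k
      have h3 : |inner ℝ (n - m) k| * ‖n‖ ≤ ‖n - m‖ * ‖k‖ * 1 := by
        gcongr; exact hn a
      have h4 : |inner ℝ m k| * ‖n - m‖ ≤ ‖k‖ * ‖n - m‖ := by gcongr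
      linarith
    rw [norm_smul, Real.norm_of_nonneg (by positivity)]
    calc q * ‖b‖ ^ q * ‖(inner ℝ (n - m) k) • n + (inner ℝ m k) • (n - m)‖
        ≤ q * ‖b‖ ^ q * (2 * ‖n - m‖ * ‖k‖) := by gcongr
      _ = q * 2 * ‖k‖ * (‖b‖ ^ q * ‖n - m‖) := by ring
      _ ≤ q * 2 * ‖k‖ * (2 * M ^ (q - 1) * ‖a - b‖) := by gcongr
      _ = _ := by ring
  refine (norm_add₃_le).trans ?_
  calc _ ≤ _ := add_le_add (add_le_add t1 t2) t3
    _ = _ := by ring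

theorem contDiffAt_powerMap (q : ℝ) {z : ℂ} (hz : z ≠ 0) : ContDiffAt ℝ 2 (powerMap q) z := by
  rw [powerMap_eq_smul]
  exact ((contDiffAt_id.norm ℝ hz).rpow_const_of_ne (norm_ne_zero_iff.2 hz)).smul contDiffAt_id

theorem fderiv_powerMap {q : ℝ} (hq : 1 ≤ q) : fderiv ℝ (powerMap q) = powerMapDeriv q :=
  funext fun z => (hasFDerivAt_powerMap hq z).fderiv

theorem contDiffAt_powerMapDeriv {q : ℝ} (hq : 1 ≤ q) {z : ℂ} (hz : z ≠ 0) :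
    ContDiffAt ℝ 1 (powerMapDeriv q) z := by
  rw [← fderiv_powerMap hq]
  exact (contDiffAt_powerMap q hz).fderiv_right (by norm_num)

theorem continuousOn_fderiv_powerMapDeriv {q : ℝ} (hq : 1 ≤ q) :
    ContinuousOn (fderiv ℝ (powerMapDeriv q)) {0}ᶜ := fun _ hz =>
  ((contDiffAt_powerMapDeriv hq hz).fderiv_right (m := 0) (by norm_num)).continuousAt
    |>.continuousWithinAt

/-- Bounds for the derivative of `powerMap` on the ball of radius `R`. -/
theorem exists_powerMap_bound {q : ℝ} (hq : 1 ≤ q) (R : ℝ) (hR : 0 ≤ R) : ∃ L > 0,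
    (∀ a b : ℂ, ‖a‖ ≤ R → ‖b‖ ≤ R → ‖powerMapDeriv q a - powerMapDeriv q b‖ ≤ L * ‖a - b‖) ∧
    ∀ a : ℂ, ‖a‖ ≤ R → ‖powerMapDeriv q a‖ ≤ L := by
  set L₀ := (q + q * (q + 4)) * R ^ (q - 1)
  have hL₀ : 0 ≤ L₀ := by positivity
  refine ⟨L₀ + L₀ * R + 1, by positivity, fun a b ha hb =>
    (norm_powerMapDeriv_sub_le hq ha hb).trans ?_, fun a ha => ?_⟩
  · gcongr
    have : 0 ≤ L₀ * R := by positivity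
    linarith
  · have h := norm_powerMapDeriv_sub_le hq ha (b := 0) (by simpa using hR)
    rw [powerMapDeriv_zero hq, sub_zero, sub_zero] at h
    have h2 : L₀ * ‖a‖ ≤ L₀ * R := by gcongr
    linarith

theorem norm_powerMap_sub_le {q R L : ℝ} (hq : 1 ≤ q)
    (hL : ∀ a : ℂ, ‖a‖ ≤ R → ‖powerMapDeriv q a‖ ≤ L) {a b : ℂ} (ha : ‖a‖ ≤ R) (hb : ‖b‖ ≤ R) :
    ‖powerMap q a - powerMap q b‖ ≤ L * ‖a - b‖ :=
  (convex_closedBall (0 : ℂ) R).norm_image_sub_le_of_norm_hasFDerivWithin_le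
    (fun x _ => (hasFDerivAt_powerMap hq x).hasFDerivWithinAt)
    (fun x hx => hL x (by simpa using hx)) (by simpa using hb) (by simpa using ha)

/-- The first order Taylor remainder of `powerMap`. -/
def powerRem (q : ℝ) (b k : ℂ) : ℂ := powerMap q (b + k) - powerMap q b - powerMapDeriv q b k

theorem powerRem_zero (q : ℝ) (b : ℂ) : powerRem q b 0 = 0 := by simp [powerRem]

theorem hasFDerivAt_powerRem {q : ℝ} (hq : 1 ≤ q) (b k : ℂ) :
    HasFDerivAt (powerRem q b) (powerMapDeriv q (b + k) - powerMapDeriv q b) k := by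
  have h := ((hasFDerivAt_comp_add_left b).2 (hasFDerivAt_powerMap hq (b + k))).sub_const (powerMap q b)
  exact h.sub (powerMapDeriv q b).hasFDerivAt

/-- The derivative of the remainder in k is Df(b + k) - Df(b), of size at most L‖k‖. Only the
Lipschitz property of Df is used, so the case q = 1 is included. -/
theorem norm_powerRem_sub_le {q R L : ℝ} (hq : 1 ≤ q)
    (hL : ∀ a b : ℂ, ‖a‖ ≤ R → ‖b‖ ≤ R → ‖powerMapDeriv q a - powerMapDeriv q b‖ ≤ L * ‖a - b‖)
    (hL0 : 0 ≤ L) {b k k' : ℂ} {r : ℝ} (hk : ‖k‖ ≤ r) (hk' : ‖k'‖ ≤ r) (hR : ‖b‖ + r ≤ R) :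
    ‖powerRem q b k' - powerRem q b k‖ ≤ L * r * ‖k' - k‖ := by
  have hr : 0 ≤ r := (norm_nonneg _).trans hk
  refine (convex_closedBall (0 : ℂ) r).norm_image_sub_le_of_norm_hasFDerivWithin_le
    (fun x _ => (hasFDerivAt_powerRem hq b x).hasFDerivWithinAt)
    (fun x hx => ?_) (by simpa using hk) (by simpa using hk')
  have hx' : ‖x‖ ≤ r := by simpa using hx
  refine (hL _ _ ((norm_add_le _ _).trans (by linarith)) (by linarith)).trans ?_
  rw [add_sub_cancel_left]
  gcongr

theorem norm_powerRem_le {q R L : ℝ} (hq : 1 ≤ q)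
    (hL : ∀ a b : ℂ, ‖a‖ ≤ R → ‖b‖ ≤ R → ‖powerMapDeriv q a - powerMapDeriv q b‖ ≤ L * ‖a - b‖)
    (hL0 : 0 ≤ L) {b k : ℂ} (hR : ‖b‖ + ‖k‖ ≤ R) : ‖powerRem q b k‖ ≤ L * ‖k‖ ^ 2 := by
  have := norm_powerRem_sub_le hq hL hL0 (k := 0) (k' := k) (by simp) le_rfl hR
  rw [powerRem_zero, sub_zero, sub_zero] at this
  linarith

/-- Away from the origin the remainder depends continuously on the base point. -/
theorem exists_powerRem_compare {q : ℝ} (hq : 1 ≤ q) (M : ℝ) {η ρ : ℝ} (hη : 0 < η) (hρ : 0 < ρ) :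
    ∃ κ > 0, ∀ b b' k : ℂ, ‖b‖ ≤ M → η ≤ ‖b‖ → ‖b' - b‖ ≤ κ → ‖k‖ ≤ κ →
      ‖powerRem q b' k - powerRem q b k‖ ≤ ρ * ‖k‖ ^ 2 := by
  set A : Set ℂ := Metric.closedBall 0 (M + 1) ∩ {z | η / 2 ≤ ‖z‖} with hA
  have hAc : IsCompact A := (isCompact_closedBall _ _).inter_right
    (isClosed_le continuous_const continuous_norm)
  have hA0 : A ⊆ {0}ᶜ := by
    rintro z ⟨-, hz⟩ rfl
    have : η / 2 ≤ ‖(0 : ℂ)‖ := hz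
    rw [norm_zero] at this
    linarith
  have hu : UniformContinuousOn (fderiv ℝ (powerMapDeriv q)) A :=
    hAc.uniformContinuousOn_of_continuous ((continuousOn_fderiv_powerMapDeriv hq).mono hA0)
  obtain ⟨κ, hκ, h⟩ := (Metric.uniformContinuousOn_iff_le
    (f := fderiv ℝ (powerMapDeriv q)) (s := A)).1 hu ρ hρ
  -- With κ' ≤ η/4 the points b + y and b' + y stay outside the disc of radius η/2, and κ' ≤ 1/2
  -- keeps them in the ball of radius M + 1.
  set κ' := min κ (min (1 / 2) (η / 4))
  have k1 : κ' ≤ κ := min_le_left _ _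
  have k2 : κ' ≤ 1 / 2 := (min_le_right _ _).trans (min_le_left _ _)
  have k3 : κ' ≤ η / 4 := (min_le_right _ _).trans (min_le_right _ _)
  refine ⟨κ', by positivity, fun b b' k hbM hbη hbb hk => ?_⟩
  have hmem : ∀ y : ℂ, ‖y‖ ≤ ‖k‖ → b + y ∈ A ∧ b' + y ∈ A := by
    intro y hy
    have e : b' + y = b + (b' - b) + y := by ring
    refine ⟨⟨?_, ?_⟩, ⟨?_, ?_⟩⟩
    · rw [mem_closedBall_zero_iff]
      exact (norm_add_le _ _).trans (by linarith)
    · have := norm_sub_le_norm_add b y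
      change η / 2 ≤ ‖b + y‖
      linarith
    · rw [mem_closedBall_zero_iff, e]
      exact (norm_add₃_le).trans (by linarith)
    · have h1 := norm_sub_le_norm_add b ((b' - b) + y)
      have h2 := norm_add_le (b' - b) y
      change η / 2 ≤ ‖b' + y‖
      rw [e, add_assoc]
      linarith
  have hA' : ∀ z ∈ A, HasFDerivAt (powerMapDeriv q) (fderiv ℝ (powerMapDeriv q) z) z := fun z hz =>
    ((contDiffAt_powerMapDeriv hq (hA0 hz)).differentiableAt (by norm_num)).hasFDerivAt
  -- The mean value inequality is used twice: closeness of D²f makes the increments of Df close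
  -- here, and these in turn make the remainders close to within ρ‖k‖².
  have hd : ∀ y : ℂ, ‖y‖ ≤ ‖k‖ → ‖(powerMapDeriv q (b' + y) - powerMapDeriv q (b + y)) -
      (powerMapDeriv q (b' + 0) - powerMapDeriv q (b + 0))‖ ≤ ρ * ‖y - 0‖ := by
    intro y hy
    refine (convex_closedBall (0 : ℂ) ‖k‖).norm_image_sub_le_of_norm_hasFDerivWithin_le
      (f := fun y => powerMapDeriv q (b' + y) - powerMapDeriv q (b + y))
      (fun x hx => ?_) (fun x hx => ?_) (by simp) (by simpa using hy)
      (f' := fun y => fderiv ℝ (powerMapDeriv q) (b' + y) - fderiv ℝ (powerMapDeriv q) (b + y))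
    · have hx' := hmem x (by simpa using hx)
      exact (((hasFDerivAt_comp_add_left b').2 (hA' _ hx'.2)).sub
        ((hasFDerivAt_comp_add_left b).2 (hA' _ hx'.1))).hasFDerivWithinAt
    · have hx' := hmem x (by simpa using hx)
      have := h _ hx'.2 _ hx'.1 (by rw [dist_eq_norm]; simpa using hbb.trans k1)
      exact (dist_eq_norm _ _).symm.trans_le this
  have h2 := (convex_closedBall (0 : ℂ) ‖k‖).norm_image_sub_le_of_norm_hasFDerivWithin_le
    (f := fun y => powerRem q b' y - powerRem q b y) (C := ρ * ‖k‖) (x := 0) (y := k)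
    (fun x _ => ((hasFDerivAt_powerRem hq b' x).sub
      (hasFDerivAt_powerRem hq b x)).hasFDerivWithinAt) (fun x hx => ?_) (by simp) (by simp)
  · simp only [powerRem_zero, sub_zero] at h2
    calc _ ≤ _ := h2
      _ = _ := by ring
  · have hx' : ‖x‖ ≤ ‖k‖ := by simpa using hx
    have h3 := hd x hx'
    rw [add_zero, add_zero, sub_zero] at h3
    calc _ = ‖powerMapDeriv q (b' + x) - powerMapDeriv q (b + x) -
        (powerMapDeriv q b' - powerMapDeriv q b)‖ := by congr 1; abel
      _ ≤ _ := h3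
      _ ≤ _ := by gcongr

/-- Comparison of the second differences of `powerMap` along two nearby triples of points. -/
theorem exists_secondDiff_compare {q : ℝ} (hq : 1 ≤ q) {M : ℝ} (hM : 0 ≤ M) :
    ∃ L > 0, ∀ η > 0, ∀ ρ > 0, ∃ κ > 0, ∃ C > 0, ∀ b b' k l k' l' : ℂ, ‖b‖ ≤ M → ‖b'‖ ≤ M →
      ‖b' - b‖ ≤ κ → ‖k‖ ≤ κ → ‖l‖ ≤ κ → ‖k'‖ ≤ κ → ‖l'‖ ≤ κ →
      ‖(powerMap q (b' + k') - 2 * powerMap q b' + powerMap q (b' + l')) -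
        (powerMap q (b + k) - 2 * powerMap q b + powerMap q (b + l))‖ ≤
      L * ‖(k' + l') - (k + l)‖ + ρ * ‖k + l‖ + C * (‖k' - k‖ ^ 2 + ‖l' - l‖ ^ 2) +
        (ρ + if ‖b‖ ≤ η then L else 0) * (‖k‖ ^ 2 + ‖l‖ ^ 2) := by
  obtain ⟨L, hL, hL1, hL2⟩ := exists_powerMap_bound hq (M + 1) (by positivity)
  refine ⟨2 * L, by positivity, fun η hη ρ hρ => ?_⟩
  obtain ⟨κ₁, hκ₁, hcmp⟩ := exists_powerRem_compare hq M hη (show 0 < ρ / 2 by positivity)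
  set κ := min κ₁ (min 1 (ρ / L))
  have k1 : κ ≤ κ₁ := min_le_left _ _
  have k2 : κ ≤ 1 := (min_le_right _ _).trans (min_le_left _ _)
  have k3 : L * κ ≤ ρ := by
    have : κ ≤ ρ / L := (min_le_right _ _).trans (min_le_right _ _)
    rw [le_div_iff₀ hL] at this
    linarith
  -- The large factor 2/ρ comes from the Young inequality `s3`. It only multiplies increments of the
  -- difference, which are later controlled by its sup norm, while the leading constant L does not
  -- depend on η or ρ.
  refine ⟨κ, by positivity, L + L ^ 2 * (2 / ρ), by positivity,
    fun b b' k l k' l' hb hb' hbb hk hl hk' hl' => ?_⟩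
  have rem : ∀ k k' : ℂ, ‖k‖ ≤ κ → ‖k'‖ ≤ κ → ‖powerRem q b' k' - powerRem q b k‖ ≤
      (L + L ^ 2 * (2 / ρ)) * ‖k' - k‖ ^ 2 +
        (ρ + if ‖b‖ ≤ η then 2 * L else 0) * ‖k‖ ^ 2 := by
    intro k k' hk hk'
    have hkk : ‖k'‖ ≤ ‖k‖ + ‖k' - k‖ := by
      have := norm_add_le k (k' - k); rwa [add_sub_cancel] at this
    have s1 : ‖powerRem q b' k' - powerRem q b' k‖ ≤
        L * (‖k‖ + ‖k' - k‖) * ‖k' - k‖ := by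
      have hm : ‖b'‖ + max ‖k‖ ‖k'‖ ≤ M + 1 := by
        have : max ‖k‖ ‖k'‖ ≤ 1 := max_le (hk.trans k2) (hk'.trans k2)
        linarith
      refine (norm_powerRem_sub_le hq hL1 hL.le (le_max_left _ _) (le_max_right _ _) hm).trans ?_
      gcongr
      exact max_le (by linarith [norm_nonneg (k' - k)]) hkk
    have s2 : ‖powerRem q b' k - powerRem q b k‖ ≤
        (ρ / 2 + if ‖b‖ ≤ η then 2 * L else 0) * ‖k‖ ^ 2 := by
      split_ifs with hη'
      · have r1 := norm_powerRem_le hq hL1 hL.le (b := b') (k := k) (by linarith)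
        have r2 := norm_powerRem_le hq hL1 hL.le (b := b) (k := k) (by linarith)
        refine (norm_sub_le _ _).trans ?_
        have : 0 ≤ ρ / 2 * ‖k‖ ^ 2 := by positivity
        linarith
      · rw [add_zero]
        exact hcmp b b' k hb (not_le.1 hη').le (hbb.trans k1) (hk.trans k1)
    have s3 : L * ‖k‖ * ‖k' - k‖ ≤ ρ / 2 * ‖k‖ ^ 2 + L ^ 2 * (2 / ρ) * ‖k' - k‖ ^ 2 := by
      have h1 := sq_nonneg (ρ / 2 * ‖k‖ - L * ‖k' - k‖)
      have h2 : 0 ≤ ρ / 2 * (L * ‖k‖ * ‖k' - k‖) := by positivity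
      have h3 : ρ / 2 * (ρ / 2 * ‖k‖ ^ 2 + L ^ 2 * (2 / ρ) * ‖k' - k‖ ^ 2) =
          (ρ / 2 * ‖k‖) ^ 2 + (L * ‖k' - k‖) ^ 2 := by field_simp
      have h4 : ρ / 2 * (L * ‖k‖ * ‖k' - k‖) ≤
          ρ / 2 * (ρ / 2 * ‖k‖ ^ 2 + L ^ 2 * (2 / ρ) * ‖k' - k‖ ^ 2) := by
        rw [h3]; nlinarith
      exact le_of_mul_le_mul_left h4 (by positivity)
    have := norm_sub_le_norm_sub_add_norm_sub (powerRem q b' k') (powerRem q b' k) (powerRem q b k)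
    nlinarith
  -- Taylor expansion at the center points: Df(b') acts on the second difference of v - u, Df(b') -
  -- Df(b) on that of u, and the quadratic remainders are compared in pairs.
  have key : (powerMap q (b' + k') - 2 * powerMap q b' + powerMap q (b' + l')) -
      (powerMap q (b + k) - 2 * powerMap q b + powerMap q (b + l)) =
      (powerMapDeriv q b' ((k' + l') - (k + l)) +
        (powerMapDeriv q b' - powerMapDeriv q b) (k + l)) +
      ((powerRem q b' k' - powerRem q b k) + (powerRem q b' l' - powerRem q b l)) := by
    simp only [powerRem, map_sub, map_add, _root_.sub_apply]
    ring
  rw [key]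
  have e1 : ‖powerMapDeriv q b' ((k' + l') - (k + l))‖ ≤ 2 * L * ‖(k' + l') - (k + l)‖ := by
    refine (ContinuousLinearMap.le_opNorm _ _).trans ?_
    gcongr
    linarith [hL2 b' (by linarith)]
  have e2 : ‖(powerMapDeriv q b' - powerMapDeriv q b) (k + l)‖ ≤ ρ * ‖k + l‖ := by
    refine (ContinuousLinearMap.le_opNorm _ _).trans ?_
    gcongr
    refine (hL1 _ _ (by linarith) (by linarith)).trans (le_trans ?_ k3)
    gcongr
  have e3 := rem k k' hk hk'
  have e4 := rem l l' hl hl'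
  have n1 := norm_add_le (powerMapDeriv q b' ((k' + l') - (k + l)) +
        (powerMapDeriv q b' - powerMapDeriv q b) (k + l))
      ((powerRem q b' k' - powerRem q b k) + (powerRem q b' l' - powerRem q b l))
  have n2 := norm_add_le (powerMapDeriv q b' ((k' + l') - (k + l)))
    ((powerMapDeriv q b' - powerMapDeriv q b) (k + l))
  have n3 := norm_add_le (powerRem q b' k' - powerRem q b k) (powerRem q b' l' - powerRem q b l)
  linarith

end PowerMap

/-! ### Discrete Gagliardo–Nirenberg inequalities, also localized to small values of the function.
-/

section DiscreteGagliardoNirenberg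

set_option linter.unusedSectionVars false

variable {E : Type*} [NormedAddCommGroup E] [MeasurableSpace E] [BorelSpace E]
  {μ : Measure E} [μ.IsAddRightInvariant]

/-- The centered second difference `g(x+h) - 2 g(x) + g(x-h)`. -/
def secondDiff {R : Type*} [Ring R] (h : E) (g : E → R) (x : E) : R :=
  g (x + h) - 2 * g x + g (x - h)

theorem integrable_sq_diff {r : E → ℝ} (hr : Continuous r) (hi : Integrable (fun x => r x ^ 2) μ)
    (h : E) : Integrable (fun x => (r (x + h) - r x) ^ 2) μ := by
  refine (((hi.comp_add_right h).const_mul 2).add (hi.const_mul 2)).mono'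
    (Continuous.aestronglyMeasurable (by fun_prop)) (Eventually.of_forall fun x => ?_)
  rw [Real.norm_of_nonneg (sq_nonneg _)]
  simp only [Pi.add_apply]
  nlinarith [sq_nonneg (r (x + h) + r x)]

theorem integrable_sq_secondDiff {r : E → ℝ} (hr : Continuous r)
    (hi : Integrable (fun x => r x ^ 2) μ) (h : E) :
    Integrable (fun x => secondDiff h r x ^ 2) μ := by
  have h1 := integrable_sq_diff hr hi h
  have h2 := h1.comp_sub_right h
  refine ((h1.const_mul 2).add (h2.const_mul 2)).mono'
    (Continuous.aestronglyMeasurable (by unfold secondDiff; fun_prop))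
    (Eventually.of_forall fun x => ?_)
  rw [Real.norm_of_nonneg (sq_nonneg _)]
  simp only [Pi.add_apply, secondDiff, sub_add_cancel]
  nlinarith [sq_nonneg ((r (x + h) - r x) + (r x - r (x - h)))]

theorem integrable_diff_pow {r : E → ℝ} (hr : Continuous r) (hi : Integrable (fun x => r x ^ 2) μ)
    {M : ℝ} (hM : ∀ x, |r x| ≤ M) (h : E) (n : ℕ) :
    Integrable (fun x => (r (x + h) - r x) ^ (n + 2)) μ := by
  refine ((integrable_sq_diff hr hi h).const_mul ((2 * M) ^ n)).mono'
    (Continuous.aestronglyMeasurable (by fun_prop)) (Eventually.of_forall fun x => ?_)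
  rw [pow_add, norm_mul, Real.norm_of_nonneg (sq_nonneg _), norm_pow]
  gcongr
  exact (norm_sub_le _ _).trans (by
    rw [Real.norm_eq_abs, Real.norm_eq_abs]; linarith [hM (x + h), hM x])

/-- Truncation of a real number to `[-B, B]`. -/
def clamp (B y : ℝ) : ℝ := max (-B) (min y B)

theorem abs_clamp_le {B : ℝ} (hB : 0 ≤ B) (y : ℝ) : |clamp B y| ≤ B :=
  abs_le.2 ⟨le_max_left _ _, max_le (by linarith) (min_le_right _ _)⟩

theorem clamp_of_abs_le {B y : ℝ} (h : |y| ≤ B) : clamp B y = y := by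
  rw [abs_le] at h
  rw [clamp, min_eq_left h.2, max_eq_right h.1]

theorem clamp_mono (B : ℝ) : Monotone (clamp B) := fun _ _ h =>
  max_le_max le_rfl (min_le_min h le_rfl)

theorem continuous_clamp (B : ℝ) : Continuous (clamp B) := by unfold clamp; fun_prop

theorem clamp_sub_mul_cube_nonneg (B y y' : ℝ) :
    0 ≤ (clamp B y' - clamp B y) * (y' - y) ^ 3 := by
  rcases le_total y y' with h | h
  · exact mul_nonneg (sub_nonneg.2 (clamp_mono B h)) (pow_nonneg (sub_nonneg.2 h) 3)
  · have h1 := clamp_mono B h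
    have h2 : 0 ≤ (y - y') ^ 3 := pow_nonneg (sub_nonneg.2 h) 3
    nlinarith

/-- This is the discrete form of ∫ ∇χ(r)·(∇r)³ = -∫ χ(r)∇((∇r)³) with χ a truncation at height B.
Translation invariance moves the difference onto the cube, where it produces a second difference,
and Young's inequality with weight l separates the factors. The truncation puts the small height B
in front in place of the sup norm of r. -/
theorem integral_clamp_diff_mul_cube_le {r : E → ℝ} (hr : Continuous r)
    (hi : Integrable (fun x => r x ^ 2) μ) {M : ℝ} (hM : ∀ x, |r x| ≤ M) (h : E) {B l : ℝ}
    (hB : 0 ≤ B) (hl : 0 < l) :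
    ∫ x, (clamp B (r (x + h)) - clamp B (r x)) * (r (x + h) - r x) ^ 3 ∂μ ≤
      3 / 2 * B * ((∫ x, (r (x + h) - r x) ^ 4 ∂μ) / l + l * ∫ x, secondDiff h r x ^ 2 ∂μ) := by
  have i3 := integrable_diff_pow hr hi hM h 1
  have i4 := integrable_diff_pow hr hi hM h 2
  have i4' := i4.comp_sub_right h
  have i44 : Integrable (fun x => (r (x - h + h) - r (x - h)) ^ 4 + (r (x + h) - r x) ^ 4) μ :=
    i4'.add i4
  have i2 := integrable_sq_secondDiff hr hi h
  have i3' := i3.comp_sub_right h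
  have bc : ∀ f : E → ℝ, Continuous f → ∀ᵐ x ∂μ, ‖clamp B (f x)‖ ≤ B := fun f _ =>
    Eventually.of_forall fun x => abs_clamp_le hB _
  have cc : ∀ f : E → ℝ, Continuous f → AEStronglyMeasurable (fun x => clamp B (f x)) μ :=
    fun f hf => ((continuous_clamp B).comp hf).aestronglyMeasurable
  have j1 : Integrable (fun x => clamp B (r (x + h)) * (r (x + h) - r x) ^ 3) μ :=
    i3.bdd_mul (cc _ (by fun_prop)) (bc _ (by fun_prop))
  have j2 : Integrable (fun x => clamp B (r x) * (r (x + h) - r x) ^ 3) μ :=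
    i3.bdd_mul (cc _ hr) (bc _ hr)
  have j3 : Integrable (fun x => clamp B (r x) * (r (x - h + h) - r (x - h)) ^ 3) μ :=
    i3'.bdd_mul (cc _ hr) (bc _ hr)
  have e1 : ∫ x, clamp B (r (x + h)) * (r (x + h) - r x) ^ 3 ∂μ =
      ∫ x, clamp B (r x) * (r (x - h + h) - r (x - h)) ^ 3 ∂μ := by
    rw [← integral_sub_right_eq_self _ h]
    simp only [sub_add_cancel]
  have e2 : ∫ x, (r (x - h + h) - r (x - h)) ^ 4 ∂μ = ∫ x, (r (x + h) - r x) ^ 4 ∂μ :=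
    integral_sub_right_eq_self (fun x => (r (x + h) - r x) ^ 4) h
  calc ∫ x, (clamp B (r (x + h)) - clamp B (r x)) * (r (x + h) - r x) ^ 3 ∂μ
      = ∫ x, clamp B (r x) * ((r (x - h + h) - r (x - h)) ^ 3 - (r (x + h) - r x) ^ 3) ∂μ := by
        simp only [sub_mul, mul_sub]
        rw [integral_sub j1 j2, integral_sub j3 j2, e1]
    _ ≤ ∫ x, (3 / 4 * B / l * ((r (x - h + h) - r (x - h)) ^ 4 + (r (x + h) - r x) ^ 4) +
          3 / 2 * B * l * secondDiff h r x ^ 2) ∂μ := by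
        refine integral_mono ?_ ((i44.const_mul _).add (i2.const_mul _)) fun x => ?_
        · exact (j3.sub j2).congr (Eventually.of_forall fun x => (mul_sub _ _ _).symm)
        simp only [secondDiff, sub_add_cancel]
        set a := r x - r (x - h)
        set b := r (x + h) - r x
        have hab : r (x + h) - 2 * r x + r (x - h) = b - a := by simp only [a, b]; ring
        rw [hab]
        have q1 : |a ^ 3 - b ^ 3| ≤ 3 / 2 * (a ^ 2 + b ^ 2) * |b - a| := by
          rw [show a ^ 3 - b ^ 3 = -((a ^ 2 + a * b + b ^ 2) * (b - a)) by ring, abs_neg, abs_mul,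
            abs_of_nonneg (by nlinarith [sq_nonneg (a + b)])]
          gcongr
          nlinarith [sq_nonneg (a - b)]
        have q2 : clamp B (r x) * (a ^ 3 - b ^ 3) ≤ B * |a ^ 3 - b ^ 3| := by
          refine (le_abs_self _).trans ?_
          rw [abs_mul]
          gcongr
          exact abs_clamp_le hB _
        have q3 : ∀ s : ℝ, s * |b - a| ≤ s ^ 2 / (2 * l) + l / 2 * (b - a) ^ 2 := by
          intro s
          rw [← sq_abs (b - a)]
          have : s ^ 2 / (2 * l) + l / 2 * |b - a| ^ 2 - s * |b - a| =
              (s - l * |b - a|) ^ 2 / (2 * l) := by field_simp; ring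
          have h2 : 0 ≤ (s - l * |b - a|) ^ 2 / (2 * l) := by positivity
          linarith
        have q4 : B * |a ^ 3 - b ^ 3| ≤ B * (3 / 2 * (a ^ 2 + b ^ 2) * |b - a|) := by gcongr
        have q5 : B * (3 / 2 * (a ^ 2 + b ^ 2) * |b - a|) ≤
            B * (3 / 2 * (((a ^ 2) ^ 2 / (2 * l) + l / 2 * (b - a) ^ 2) +
              ((b ^ 2) ^ 2 / (2 * l) + l / 2 * (b - a) ^ 2))) := by
          gcongr B * ?_
          linarith [q3 (a ^ 2), q3 (b ^ 2)]
        refine (q2.trans (q4.trans q5)).trans (le_of_eq ?_)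
        field_simp
        ring
    _ = _ := by
        rw [integral_add (i44.const_mul _) (i2.const_mul _), integral_const_mul,
          integral_const_mul, integral_add i4' i4, e2]
        field_simp
        ring

/-- Discrete Gagliardo–Nirenberg inequality `‖Dr‖₄² ≲ ‖r‖_∞ ‖D²r‖₂`. -/
theorem integral_diff_pow_four_le_real {r : E → ℝ} (hr : Continuous r)
    (hi : Integrable (fun x => r x ^ 2) μ) {M : ℝ} (hM0 : 0 < M) (hM : ∀ x, |r x| ≤ M) (h : E) :
    ∫ x, (r (x + h) - r x) ^ 4 ∂μ ≤ 9 * M ^ 2 * ∫ x, secondDiff h r x ^ 2 ∂μ := by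
  -- The weight l = 3M makes the coefficient of the quartic integral equal to 1/2, so it can be
  -- absorbed.
  have key := integral_clamp_diff_mul_cube_le hr hi hM h hM0.le (show 0 < 3 * M by positivity)
  have e : ∀ x, (clamp M (r (x + h)) - clamp M (r x)) * (r (x + h) - r x) ^ 3 =
      (r (x + h) - r x) ^ 4 := by
    intro x
    rw [clamp_of_abs_le (hM _), clamp_of_abs_le (hM _)]
    ring
  simp only [e] at key
  set I := ∫ x, (r (x + h) - r x) ^ 4 ∂μ
  set I2 := ∫ x, secondDiff h r x ^ 2 ∂μ
  have : 3 / 2 * M * (I / (3 * M) + 3 * M * I2) = I / 2 + 9 / 2 * M ^ 2 * I2 := by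
    field_simp
    ring
  linarith

/-- On the set where `r` is small, the discrete gradient is small in `L⁴`. -/
theorem integral_diff_pow_four_small_le_real {r : E → ℝ} (hr : Continuous r)
    (hi : Integrable (fun x => r x ^ 2) μ) {M η : ℝ} (hM0 : 0 < M) (hM : ∀ x, |r x| ≤ M)
    (hη : 0 < η) {h : E} (hh : ∀ x, |r (x + h) - r x| ≤ η) :
    ∫ x, {x | |r x| ≤ η}.indicator (fun x => (r (x + h) - r x) ^ 4) x ∂μ ≤
      18 * η * M * ∫ x, secondDiff h r x ^ 2 ∂μ := by
  -- Where |r(x)| ≤ η, also |r(x + h)| ≤ 2η, so truncation at 2η is invisible and the integrand is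
  -- the full fourth power. Elsewhere it is nonnegative by monotonicity of the truncation and may be
  -- discarded.
  have key := integral_clamp_diff_mul_cube_le hr hi hM h (B := 2 * η) (by positivity)
    (show 0 < 3 * M by positivity)
  have gn := integral_diff_pow_four_le_real hr hi hM0 hM h
  have i3 := integrable_diff_pow hr hi hM h 1
  have i4 := integrable_diff_pow hr hi hM h 2
  have j1 : Integrable (fun x => (clamp (2 * η) (r (x + h)) - clamp (2 * η) (r x)) *
      (r (x + h) - r x) ^ 3) μ := by
    refine i3.bdd_mul (c := 2 * η + 2 * η) (Continuous.aestronglyMeasurable ?_)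
      (Eventually.of_forall fun x => ?_)
    · have := continuous_clamp (2 * η)
      fun_prop
    · exact (norm_sub_le _ _).trans (add_le_add (abs_clamp_le (by positivity) _)
        (abs_clamp_le (by positivity) _))
  have hmeas : MeasurableSet {x | |r x| ≤ η} :=
    (isClosed_le (continuous_abs.comp hr) continuous_const).measurableSet
  have le : ∫ x, {x | |r x| ≤ η}.indicator (fun x => (r (x + h) - r x) ^ 4) x ∂μ ≤
      ∫ x, (clamp (2 * η) (r (x + h)) - clamp (2 * η) (r x)) * (r (x + h) - r x) ^ 3 ∂μ := by
    refine integral_mono (i4.indicator hmeas) j1 fun x => ?_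
    by_cases hx : |r x| ≤ η
    · rw [indicator_of_mem (by exact hx)]
      have h1 : |r (x + h)| ≤ 2 * η := by
        have := abs_add_le (r x) (r (x + h) - r x)
        rw [add_sub_cancel] at this
        linarith [hh x]
      simp only
      rw [clamp_of_abs_le h1, clamp_of_abs_le (by linarith)]
      exact le_of_eq (by ring)
    · rw [indicator_of_notMem (by exact hx)]
      exact clamp_sub_mul_cube_nonneg _ _ _
  refine le.trans (key.trans ?_)
  set I := ∫ x, (r (x + h) - r x) ^ 4 ∂μ
  set I2 := ∫ x, secondDiff h r x ^ 2 ∂μ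
  have e1 : 3 / 2 * (2 * η) * (I / (3 * M) + 3 * M * I2) = η / M * I + 9 * η * M * I2 := by
    field_simp; ring
  have e2 : η / M * I ≤ η / M * (9 * M ^ 2 * I2) := by gcongr
  have e3 : η / M * (9 * M ^ 2 * I2) = 9 * η * M * I2 := by field_simp
  linarith

theorem secondDiff_re (h : E) (g : E → ℂ) (x : E) :
    (secondDiff h g x).re = secondDiff h (fun x => (g x).re) x := by
  simp [secondDiff]

theorem secondDiff_im (h : E) (g : E → ℂ) (x : E) :
    (secondDiff h g x).im = secondDiff h (fun x => (g x).im) x := by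
  simp [secondDiff]

theorem norm_sq_eq_re_im (z : ℂ) : ‖z‖ ^ 2 = z.re ^ 2 + z.im ^ 2 := by
  rw [Complex.sq_norm, Complex.normSq_apply]; ring

theorem norm_pow_four_le (z : ℂ) : ‖z‖ ^ 4 ≤ 2 * (z.re ^ 4 + z.im ^ 4) := by
  rw [show ‖z‖ ^ 4 = (‖z‖ ^ 2) ^ 2 by ring, norm_sq_eq_re_im]
  nlinarith [sq_nonneg (z.re ^ 2 - z.im ^ 2)]

theorem integrable_re_im_sq {g : E → ℂ} (hg : Continuous g)
    (hi : Integrable (fun x => ‖g x‖ ^ 2) μ) :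
    Integrable (fun x => (g x).re ^ 2) μ ∧ Integrable (fun x => (g x).im ^ 2) μ := by
  constructor <;>
  refine hi.mono' (Continuous.aestronglyMeasurable (by fun_prop))
    (Eventually.of_forall fun x => ?_) <;>
  rw [Real.norm_of_nonneg (sq_nonneg _), norm_sq_eq_re_im] <;>
  nlinarith [sq_nonneg (g x).re, sq_nonneg (g x).im]

theorem integrable_norm_sq_secondDiff {g : E → ℂ} (hg : Continuous g)
    (hi : Integrable (fun x => ‖g x‖ ^ 2) μ) (h : E) :
    Integrable (fun x => ‖secondDiff h g x‖ ^ 2) μ := by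
  obtain ⟨i1, i2⟩ := integrable_re_im_sq hg hi
  simp only [norm_sq_eq_re_im, secondDiff_re, secondDiff_im]
  exact (integrable_sq_secondDiff (by fun_prop) i1 h).add
    (integrable_sq_secondDiff (by fun_prop) i2 h)

theorem integral_norm_sq_secondDiff {g : E → ℂ} (hg : Continuous g)
    (hi : Integrable (fun x => ‖g x‖ ^ 2) μ) (h : E) :
    ∫ x, ‖secondDiff h g x‖ ^ 2 ∂μ = ∫ x, secondDiff h (fun x => (g x).re) x ^ 2 ∂μ +
      ∫ x, secondDiff h (fun x => (g x).im) x ^ 2 ∂μ := by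
  obtain ⟨i1, i2⟩ := integrable_re_im_sq hg hi
  simp only [norm_sq_eq_re_im, secondDiff_re, secondDiff_im]
  exact integral_add (integrable_sq_secondDiff (by fun_prop) i1 h)
    (integrable_sq_secondDiff (by fun_prop) i2 h)

theorem integrable_norm_diff_pow_four {g : E → ℂ} (hg : Continuous g)
    (hi : Integrable (fun x => ‖g x‖ ^ 2) μ) {M : ℝ} (hM : ∀ x, ‖g x‖ ≤ M) (h : E) :
    Integrable (fun x => ‖g (x + h) - g x‖ ^ 4) μ := by
  obtain ⟨i1, i2⟩ := integrable_re_im_sq hg hi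
  have j1 := integrable_diff_pow (r := fun x => (g x).re) (by fun_prop) i1
    (fun x => (Complex.abs_re_le_norm _).trans (hM x)) h 2
  have j2 := integrable_diff_pow (r := fun x => (g x).im) (by fun_prop) i2
    (fun x => (Complex.abs_im_le_norm _).trans (hM x)) h 2
  refine ((j1.add j2).const_mul 2).mono' (Continuous.aestronglyMeasurable (by fun_prop))
    (Eventually.of_forall fun x => ?_)
  rw [Real.norm_of_nonneg (by positivity)]
  have := norm_pow_four_le (g (x + h) - g x)
  simpa using this

theorem integral_norm_diff_pow_four_le {g : E → ℂ} (hg : Continuous g)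
    (hi : Integrable (fun x => ‖g x‖ ^ 2) μ) {M : ℝ} (hM0 : 0 < M) (hM : ∀ x, ‖g x‖ ≤ M) (h : E) :
    ∫ x, ‖g (x + h) - g x‖ ^ 4 ∂μ ≤ 18 * M ^ 2 * ∫ x, ‖secondDiff h g x‖ ^ 2 ∂μ := by
  obtain ⟨i1, i2⟩ := integrable_re_im_sq hg hi
  have b1 : ∀ x, |(g x).re| ≤ M := fun x => (Complex.abs_re_le_norm _).trans (hM x)
  have b2 : ∀ x, |(g x).im| ≤ M := fun x => (Complex.abs_im_le_norm _).trans (hM x)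
  have j1 := integrable_diff_pow (r := fun x => (g x).re) (by fun_prop) i1 b1 h 2
  have j2 := integrable_diff_pow (r := fun x => (g x).im) (by fun_prop) i2 b2 h 2
  have k1 := integral_diff_pow_four_le_real (r := fun x => (g x).re) (by fun_prop) i1 hM0 b1 h
  have k2 := integral_diff_pow_four_le_real (r := fun x => (g x).im) (by fun_prop) i2 hM0 b2 h
  rw [integral_norm_sq_secondDiff hg hi]
  calc ∫ x, ‖g (x + h) - g x‖ ^ 4 ∂μ
      ≤ ∫ x, 2 * (((g (x + h)).re - (g x).re) ^ 4 + ((g (x + h)).im - (g x).im) ^ 4) ∂μ :=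
        integral_mono (integrable_norm_diff_pow_four hg hi hM h) ((j1.add j2).const_mul 2)
          fun x => by simpa using norm_pow_four_le (g (x + h) - g x)
    _ = 2 * (∫ x, ((g (x + h)).re - (g x).re) ^ 4 ∂μ +
          ∫ x, ((g (x + h)).im - (g x).im) ^ 4 ∂μ) := by
        rw [integral_const_mul, integral_add j1 j2]
    _ ≤ _ := by linarith

theorem integral_norm_diff_pow_four_small_le {g : E → ℂ} (hg : Continuous g)
    (hi : Integrable (fun x => ‖g x‖ ^ 2) μ) {M η : ℝ} (hM0 : 0 < M) (hM : ∀ x, ‖g x‖ ≤ M)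
    (hη : 0 < η) {h : E} (hh : ∀ x, ‖g (x + h) - g x‖ ≤ η) :
    ∫ x, {x | ‖g x‖ ≤ η}.indicator (fun x => ‖g (x + h) - g x‖ ^ 4) x ∂μ ≤
      36 * η * M * ∫ x, ‖secondDiff h g x‖ ^ 2 ∂μ := by
  obtain ⟨i1, i2⟩ := integrable_re_im_sq hg hi
  have b1 : ∀ x, |(g x).re| ≤ M := fun x => (Complex.abs_re_le_norm _).trans (hM x)
  have b2 : ∀ x, |(g x).im| ≤ M := fun x => (Complex.abs_im_le_norm _).trans (hM x)
  have j1 := integrable_diff_pow (r := fun x => (g x).re) (by fun_prop) i1 b1 h 2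
  have j2 := integrable_diff_pow (r := fun x => (g x).im) (by fun_prop) i2 b2 h 2
  have k1 := integral_diff_pow_four_small_le_real (r := fun x => (g x).re) (by fun_prop) i1 hM0 b1
    hη (h := h) (fun x => by
      have := (Complex.abs_re_le_norm (g (x + h) - g x)).trans (hh x); simpa using this)
  have k2 := integral_diff_pow_four_small_le_real (r := fun x => (g x).im) (by fun_prop) i2 hM0 b2
    hη (h := h) (fun x => by
      have := (Complex.abs_im_le_norm (g (x + h) - g x)).trans (hh x); simpa using this)
  have m0 : MeasurableSet {x | ‖g x‖ ≤ η} :=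
    (isClosed_le (by fun_prop) continuous_const).measurableSet
  have m1 : MeasurableSet {x | |(g x).re| ≤ η} :=
    (isClosed_le (by fun_prop) continuous_const).measurableSet
  have m2 : MeasurableSet {x | |(g x).im| ≤ η} :=
    (isClosed_le (by fun_prop) continuous_const).measurableSet
  have j1' := j1.indicator m1
  have j2' := j2.indicator m2
  rw [integral_norm_sq_secondDiff hg hi]
  calc ∫ x, {x | ‖g x‖ ≤ η}.indicator (fun x => ‖g (x + h) - g x‖ ^ 4) x ∂μ
      ≤ ∫ x, 2 * ({x | |(g x).re| ≤ η}.indicator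
          (fun x => ((g (x + h)).re - (g x).re) ^ 4) x +
          {x | |(g x).im| ≤ η}.indicator (fun x => ((g (x + h)).im - (g x).im) ^ 4) x) ∂μ := by
        refine integral_mono ((integrable_norm_diff_pow_four hg hi hM h).indicator m0)
          ((j1'.add j2').const_mul 2) fun x => ?_
        by_cases hx : ‖g x‖ ≤ η
        · simp only
          rw [indicator_of_mem (by exact hx),
            indicator_of_mem (by exact (Complex.abs_re_le_norm _).trans hx),
            indicator_of_mem (by exact (Complex.abs_im_le_norm _).trans hx)]
          simpa using norm_pow_four_le (g (x + h) - g x)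
        · simp only
          rw [indicator_of_notMem (by exact hx)]
          have p1 : 0 ≤ {x | |(g x).re| ≤ η}.indicator
              (fun x => ((g (x + h)).re - (g x).re) ^ 4) x :=
            indicator_nonneg (fun x _ => by positivity) x
          have p2 : 0 ≤ {x | |(g x).im| ≤ η}.indicator
              (fun x => ((g (x + h)).im - (g x).im) ^ 4) x :=
            indicator_nonneg (fun x _ => by positivity) x
          linarith
    _ = 2 * (∫ x, {x | |(g x).re| ≤ η}.indicator
          (fun x => ((g (x + h)).re - (g x).re) ^ 4) x ∂μ + ∫ x, {x | |(g x).im| ≤ η}.indicator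
          (fun x => ((g (x + h)).im - (g x).im) ^ 4) x ∂μ) := by
        rw [integral_const_mul, integral_add j1' j2']
    _ ≤ _ := by linarith

end DiscreteGagliardoNirenberg

/-! ### Multipliers on L² and the Fourier integral on L¹ ∩ L². -/

section FourierMultipliers

variable {d : ℕ}

/-- The domain `ℝ^d`. -/
abbrev Dom (d : ℕ) : Type := EuclideanSpace ℝ (Fin d)

theorem memLp_bounded_mul {a : Dom d → ℂ} (ha : Continuous a) {C : ℝ} (hC : ∀ ξ, ‖a ξ‖ ≤ C)
    (g : L2 d) : MemLp (fun ξ => a ξ * g ξ) 2 volume :=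
  (Lp.memLp g).of_le_mul (c := C) (ha.aestronglyMeasurable.mul (Lp.aestronglyMeasurable g))
    (Eventually.of_forall fun ξ => by rw [norm_mul]; gcongr; exact hC ξ)

/-- Multiplication by a bounded continuous function on `L²`. -/
def mulOp (a : Dom d → ℂ) (ha : Continuous a) (C : ℝ) (hC : ∀ ξ, ‖a ξ‖ ≤ C) :
    L2 d →L[ℂ] L2 d :=
  LinearMap.mkContinuous
    { toFun := fun g => (memLp_bounded_mul ha hC g).toLp _
      map_add' := fun f g => by
        rw [← MemLp.toLp_add]
        refine MemLp.toLp_congr _ _ ?_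
        filter_upwards [Lp.coeFn_add f g] with ξ h
        change a ξ * (f + g : L2 d) ξ = a ξ * f ξ + a ξ * g ξ
        rw [h, Pi.add_apply, mul_add]
      map_smul' := fun c g => by
        rw [RingHom.id_apply, ← MemLp.toLp_const_smul]
        refine MemLp.toLp_congr _ _ ?_
        filter_upwards [Lp.coeFn_smul c g] with ξ h
        simp only [h, Pi.smul_apply, smul_eq_mul]
        ring } C fun g => by
    have hC0 : 0 ≤ C := (norm_nonneg _).trans (hC 0)
    refine Lp.norm_le_mul_norm_of_ae_le_mul ?_
    filter_upwards [(memLp_bounded_mul ha hC g).coeFn_toLp] with ξ h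
    simp only [LinearMap.coe_mk, AddHom.coe_mk]
    rw [h, norm_mul]
    gcongr
    exact hC ξ

variable {a b : Dom d → ℂ} {ha : Continuous a} {hb : Continuous b} {C C' : ℝ}
  {hC : ∀ ξ, ‖a ξ‖ ≤ C} {hC' : ∀ ξ, ‖b ξ‖ ≤ C'}

theorem mulOp_coeFn (g : L2 d) : mulOp a ha C hC g =ᵐ[volume] fun ξ => a ξ * g ξ :=
  (memLp_bounded_mul ha hC g).coeFn_toLp

theorem mulOp_comm (g : L2 d) :
    mulOp a ha C hC (mulOp b hb C' hC' g) = mulOp b hb C' hC' (mulOp a ha C hC g) := by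
  refine Lp.ext ?_
  filter_upwards [mulOp_coeFn (ha := ha) (hC := hC) (mulOp b hb C' hC' g),
    mulOp_coeFn (ha := hb) (hC := hC') (mulOp a ha C hC g),
    mulOp_coeFn (ha := ha) (hC := hC) g, mulOp_coeFn (ha := hb) (hC := hC') g] with ξ h1 h2 h3 h4
  rw [h1, h2, h3, h4]
  ring

theorem mulOp_isometry (h : ∀ ξ, ‖a ξ‖ = 1) (g : L2 d) : ‖mulOp a ha C hC g‖ = ‖g‖ := by
  have h1 : ∀ᵐ ξ, ‖mulOp a ha C hC g ξ‖ = ‖g ξ‖ := by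
    filter_upwards [mulOp_coeFn (ha := ha) (hC := hC) g] with ξ h1
    rw [h1, norm_mul, h, one_mul]
  exact le_antisymm (Lp.norm_le_norm_of_ae_le (h1.mono fun _ h => h.le))
    (Lp.norm_le_norm_of_ae_le (h1.mono fun _ h => h.ge))

theorem L2_norm_sq (f : L2 d) : ‖f‖ ^ 2 = ∫ x, ‖f x‖ ^ 2 := by
  have h := L2.inner_def (𝕜 := ℂ) f f
  rw [inner_self_eq_norm_sq_to_K] at h
  have h2 : ∫ x, inner ℂ (f x) (f x) = ((∫ x, ‖f x‖ ^ 2 : ℝ) : ℂ) := by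
    rw [← integral_complex_ofReal]
    refine integral_congr_ae (Eventually.of_forall fun x => ?_)
    simp only [inner_self_eq_norm_sq_to_K]
    push_cast
    rfl
  rw [h2] at h
  have h3 : ((‖f‖ ^ 2 : ℝ) : ℂ) = ((∫ x, ‖f x‖ ^ 2 : ℝ) : ℂ) := by
    rw [Complex.ofReal_pow]; exact h
  exact Complex.ofReal_injective h3

theorem integrable_norm_sq {f : Dom d → ℂ} (hf : MemLp f 2 volume) :
    Integrable (fun x => ‖f x‖ ^ 2) := hf.integrable_norm_pow (by norm_num)

theorem norm_toLp_sq {f : Dom d → ℂ} (hf : MemLp f 2 volume) :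
    ‖hf.toLp f‖ ^ 2 = ∫ x, ‖f x‖ ^ 2 := by
  rw [L2_norm_sq]
  refine integral_congr_ae ?_
  filter_upwards [hf.coeFn_toLp] with x hx
  rw [hx]

theorem memLp_two_of_continuous {f : Dom d → ℂ} (hf : Continuous f)
    (hi : Integrable (fun x => ‖f x‖ ^ 2)) : MemLp f 2 volume :=
  (memLp_two_iff_integrable_sq_norm hf.aestronglyMeasurable).2 hi

/-- On `L¹ ∩ L²` the `L²` Fourier transform is given by the Fourier integral. -/
theorem fourier_coeFn_of_integrable (f : L2 d) (hf : Integrable f) :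
    (𝓕 f : L2 d) =ᵐ[volume] 𝓕 (f : Dom d → ℂ) := by
  refine ae_eq_of_integral_contDiff_smul_eq ((Lp.memLp _).locallyIntegrable (by norm_num)) ?_ ?_
  · exact (VectorFourier.fourierIntegral_continuous Real.continuous_fourierChar
      (innerSL ℝ).continuous₂ hf).locallyIntegrable
  intro g hg hgc
  have hg₁ : HasCompactSupport (Complex.ofRealCLM ∘ g) := hgc.comp_left rfl
  have hg₂ : ContDiff ℝ _ (Complex.ofRealCLM ∘ g) := Complex.ofRealCLM.contDiff.comp hg
  set G : 𝓢(Dom d, ℂ) := hg₁.toSchwartzMap hg₂ with hG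
  -- Both transforms of f obey the same duality with test functions: the L² one through tempered
  -- distributions, the Fourier integral through Fubini.
  have h1 : ∫ x, G x • (𝓕 f : L2 d) x = ∫ x, (𝓕 G) x • f x := by
    rw [← Lp.toTemperedDistribution_apply, ← Lp.fourier_toTemperedDistribution_eq,
      TemperedDistribution.fourier_apply, Lp.toTemperedDistribution_apply]
  have h2 : ∫ x, (𝓕 G) x • f x = ∫ x, G x • 𝓕 (f : Dom d → ℂ) x := by
    have := VectorFourier.integral_fourierIntegral_smul_eq_flip (μ := (volume : Measure (Dom d)))
      (ν := (volume : Measure (Dom d))) (L := innerₗ (Dom d)) (f := G) (g := (f : Dom d → ℂ))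
      Real.continuous_fourierChar (innerSL ℝ).continuous₂ G.integrable hf
    rw [flip_innerₗ] at this
    rw [SchwartzMap.fourier_coe]
    exact this
  exact h1.trans h2

theorem fourierInv_coeFn_of_integrable (f : L2 d) (hf : Integrable f) :
    (𝓕⁻ f : L2 d) =ᵐ[volume] 𝓕⁻ (f : Dom d → ℂ) := by
  refine ae_eq_of_integral_contDiff_smul_eq ((Lp.memLp _).locallyIntegrable (by norm_num)) ?_ ?_
  · exact (VectorFourier.fourierIntegral_continuous Real.continuous_fourierChar
      (innerSL ℝ).continuous₂.neg hf).locallyIntegrable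
  intro g hg hgc
  have hg₁ : HasCompactSupport (Complex.ofRealCLM ∘ g) := hgc.comp_left rfl
  have hg₂ : ContDiff ℝ _ (Complex.ofRealCLM ∘ g) := Complex.ofRealCLM.contDiff.comp hg
  set G : 𝓢(Dom d, ℂ) := hg₁.toSchwartzMap hg₂ with hG
  have h1 : ∫ x, G x • (𝓕⁻ f : L2 d) x = ∫ x, (𝓕⁻ G) x • f x := by
    rw [← Lp.toTemperedDistribution_apply, ← Lp.fourierInv_toTemperedDistribution_eq,
      TemperedDistribution.fourierInv_apply, Lp.toTemperedDistribution_apply]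
  have h2 : ∫ x, (𝓕⁻ G) x • f x = ∫ x, G x • 𝓕⁻ (f : Dom d → ℂ) x := by
    have := VectorFourier.integral_fourierIntegral_smul_eq_flip (μ := (volume : Measure (Dom d)))
      (ν := (volume : Measure (Dom d))) (L := -innerₗ (Dom d)) (f := G) (g := (f : Dom d → ℂ))
      Real.continuous_fourierChar (innerSL ℝ).continuous₂.neg G.integrable hf
    have hflip : (-innerₗ (Dom d)).flip = -innerₗ (Dom d) := by
      ext x y; simp [real_inner_comm]
    rw [hflip] at this
    rw [SchwartzMap.fourierInv_coe]
    exact this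
  exact h1.trans h2

theorem norm_fourierInv_le (f : Dom d → ℂ) (x : Dom d) : ‖𝓕⁻ f x‖ ≤ ∫ ξ, ‖f ξ‖ :=
  VectorFourier.norm_fourierIntegral_le_integral_norm _ _ _ _ _

end FourierMultipliers

/-! ### H² as the isometric image of L² under (1 - Δ)⁻¹, and the Schrödinger group. -/

section SobolevSpace

variable {d : ℕ}

/-- The Fourier symbol of `1 - Δ`. -/
def symb (ξ : Dom d) : ℝ := 1 + (2 * Real.pi * ‖ξ‖) ^ 2

theorem one_le_symb (ξ : Dom d) : 1 ≤ symb ξ := by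
  unfold symb; nlinarith [sq_nonneg (2 * Real.pi * ‖ξ‖)]

theorem symb_pos (ξ : Dom d) : 0 < symb ξ := one_pos.trans_le (one_le_symb ξ)

theorem continuous_symb : Continuous (symb (d := d)) := by unfold symb; fun_prop

/-- The Fourier symbol of `(1 - Δ)⁻¹`. -/
def invSymb (ξ : Dom d) : ℂ := ((symb ξ)⁻¹ : ℝ)

theorem continuous_invSymb : Continuous (invSymb (d := d)) :=
  Complex.continuous_ofReal.comp (continuous_symb.inv₀ fun ξ => (symb_pos ξ).ne')

theorem norm_invSymb_le (ξ : Dom d) : ‖invSymb ξ‖ ≤ 1 := by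
  rw [invSymb, Complex.norm_real, norm_inv, Real.norm_of_nonneg (symb_pos ξ).le]
  exact inv_le_one_of_one_le₀ (one_le_symb ξ)

theorem symb_mul_invSymb (ξ : Dom d) : (symb ξ : ℂ) * invSymb ξ = 1 := by
  rw [invSymb, ← Complex.ofReal_mul, mul_inv_cancel₀ (symb_pos ξ).ne', Complex.ofReal_one]

/-- The operator `(1 - Δ)⁻¹` on `L²`, whose range is `H²`. -/
def resolvent : L2 d →L[ℂ] L2 d :=
  FourierTransform.fourierInvCLM ℂ (L2 d) ∘L mulOp invSymb continuous_invSymb 1 norm_invSymb_le ∘L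
    FourierTransform.fourierCLM ℂ (L2 d)

theorem resolvent_apply (w : L2 d) : resolvent w =
    𝓕⁻ (mulOp invSymb continuous_invSymb 1 norm_invSymb_le (𝓕 w : L2 d)) := rfl

theorem fourier_resolvent (w : L2 d) : (𝓕 (resolvent w) : L2 d) =
    mulOp invSymb continuous_invSymb 1 norm_invSymb_le (𝓕 w : L2 d) := by
  rw [resolvent_apply, FourierTransform.fourier_fourierInv_eq]

theorem symb_mul_fourier_resolvent (w : L2 d) :
    (fun ξ => (symb ξ : ℂ) * (𝓕 (resolvent w) : L2 d) ξ) =ᵐ[volume] (𝓕 w : L2 d) := by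
  rw [fourier_resolvent]
  filter_upwards [mulOp_coeFn (ha := continuous_invSymb) (hC := norm_invSymb_le)
    (𝓕 w : L2 d)] with ξ h
  rw [h, ← mul_assoc, symb_mul_invSymb, one_mul]

theorem h2Norm_resolvent (w : L2 d) : h2Norm (resolvent w) = ENNReal.ofReal ‖w‖ := by
  have h : h2Norm (resolvent w) =
      eLpNorm (fun ξ => (symb ξ : ℂ) * (𝓕 (resolvent w) : L2 d) ξ) 2 volume := rfl
  rw [h, eLpNorm_congr_ae (symb_mul_fourier_resolvent w), ← Lp.norm_fourier_eq w, Lp.norm_def,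
    ENNReal.ofReal_toReal (Lp.eLpNorm_ne_top _)]

theorem exists_resolvent_eq {f : L2 d} (hf : h2Norm f < ∞) : ∃ w, resolvent w = f := by
  have hm : MemLp (fun ξ => (symb ξ : ℂ) * (𝓕 f : L2 d) ξ) 2 volume :=
    ⟨(Complex.continuous_ofReal.comp continuous_symb).aestronglyMeasurable.mul
      (Lp.aestronglyMeasurable _), hf⟩
  refine ⟨𝓕⁻ (hm.toLp _ : L2 d), ?_⟩
  rw [resolvent_apply, FourierTransform.fourier_fourierInv_eq]
  have hf' : (𝓕⁻ (𝓕 f : L2 d) : L2 d) = f := FourierTransform.fourierInv_fourier_eq f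
  conv_rhs => rw [← hf']
  congr 1
  refine Lp.ext ?_
  filter_upwards [mulOp_coeFn (ha := continuous_invSymb) (hC := norm_invSymb_le)
    (hm.toLp _ : L2 d), hm.coeFn_toLp] with ξ h1 h2
  rw [h1, h2, ← mul_assoc, mul_comm (invSymb ξ), symb_mul_invSymb, one_mul]

theorem resolvent_injective : Function.Injective (resolvent (d := d)) := by
  refine (injective_iff_map_eq_zero _).2 fun w hw => ?_
  have h := h2Norm_resolvent w
  rw [hw, ← map_zero (resolvent (d := d)), h2Norm_resolvent, norm_zero, ENNReal.ofReal_zero,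
    eq_comm, ENNReal.ofReal_eq_zero] at h
  exact norm_le_zero_iff.1 h

/-- Mathlib's symbol of the second order Bessel potential. -/
def besselSymb (ξ : Dom d) : ℝ := 1 + ‖ξ‖ ^ 2

theorem besselSymb_pos (ξ : Dom d) : 0 < besselSymb ξ := by unfold besselSymb; positivity

theorem symb_le_besselSymb (ξ : Dom d) : symb ξ ≤ (1 + (2 * Real.pi) ^ 2) * besselSymb ξ := by
  unfold symb besselSymb
  nlinarith [sq_nonneg (2 * Real.pi), sq_nonneg ‖ξ‖]

theorem besselSymb_le_symb (ξ : Dom d) : besselSymb ξ ≤ symb ξ := by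
  unfold symb besselSymb
  have : (1 : ℝ) ≤ (2 * Real.pi) ^ 2 := by nlinarith [Real.pi_gt_three]
  rw [mul_pow]
  nlinarith [sq_nonneg ‖ξ‖]

/-- The inverse Bessel symbol is bounded, so multiplication by it preserves L² and agrees there with
multiplication of distributions. The symbol and its inverse have temperate growth and cancel on
tempered distributions, which transfers the distributional definition to a pointwise one. -/
theorem memH2_iff_fourier {f : L2 d} :
    MemH2 f ↔ MemLp (fun ξ => (besselSymb ξ : ℂ) * (𝓕 f : L2 d) ξ) 2 volume := by
  have hs : (fun x : Dom d => (((1 + ‖x‖ ^ 2) ^ ((2 : ℝ) / 2) : ℝ) : ℂ)) =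
      fun x => (besselSymb x : ℂ) := by
    ext x; simp [besselSymb]
  have cont : Continuous fun ξ : Dom d => ((besselSymb ξ : ℝ) : ℂ) := by
    unfold besselSymb; fun_prop
  have hinvc : Continuous fun ξ : Dom d => (((besselSymb ξ)⁻¹ : ℝ) : ℂ) :=
    Complex.continuous_ofReal.comp (Continuous.inv₀ (by unfold besselSymb; fun_prop)
      fun ξ => (besselSymb_pos ξ).ne')
  have hinvb : ∀ ξ : Dom d, ‖(((besselSymb ξ)⁻¹ : ℝ) : ℂ)‖ ≤ 1 := by
    intro ξ
    rw [Complex.norm_real, norm_inv, Real.norm_of_nonneg (besselSymb_pos ξ).le]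
    refine inv_le_one_of_one_le₀ ?_
    unfold besselSymb
    nlinarith [sq_nonneg ‖ξ‖]
  have hg : (fun x : Dom d => (besselSymb x : ℂ)).HasTemperateGrowth := by
    rw [← hs]; fun_prop
  have hgi : (fun x : Dom d => (((besselSymb x)⁻¹ : ℝ) : ℂ)).HasTemperateGrowth := by
    have : (fun x : Dom d => (((besselSymb x)⁻¹ : ℝ) : ℂ)) =
        fun x : Dom d => (((1 + ‖x‖ ^ 2) ^ (-1 : ℝ) : ℝ) : ℂ) := by
      ext x; rw [Real.rpow_neg_one]; rfl
    rw [this]; fun_prop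
  have inj : ∀ u v : L2 d, (u : 𝓢'(Dom d, ℂ)) = (v : 𝓢'(Dom d, ℂ)) → u = v := by
    intro u v h
    have hk := Lp.ker_toTemperedDistributionCLM_eq_bot (F := ℂ) (p := 2)
      (μ := (volume : Measure (Dom d)))
    rw [LinearMap.ker_eq_bot] at hk
    exact hk h
  have hmul : ∀ u : L2 d, ∃ v : L2 d, v =ᵐ[volume] (fun ξ => (((besselSymb ξ)⁻¹ : ℝ) : ℂ) * u ξ) ∧
      (v : 𝓢'(Dom d, ℂ)) = TemperedDistribution.smulLeftCLM ℂ
        (fun x : Dom d => (((besselSymb x)⁻¹ : ℝ) : ℂ)) (u : 𝓢'(Dom d, ℂ)) := by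
    intro u
    refine ⟨mulOp _ hinvc 1 hinvb u, mulOp_coeFn u, ?_⟩
    ext g
    rw [Lp.toTemperedDistribution_apply, TemperedDistribution.smulLeftCLM_apply_apply,
      Lp.toTemperedDistribution_apply]
    refine integral_congr_ae ?_
    filter_upwards [mulOp_coeFn (ha := hinvc) (hC := hinvb) u] with ξ h
    rw [h, SchwartzMap.smulLeftCLM_apply_apply hgi]
    simp only [smul_eq_mul]
    ring
  have hone : ∀ T : 𝓢'(Dom d, ℂ), TemperedDistribution.smulLeftCLM ℂ
      (fun x : Dom d => (((besselSymb x)⁻¹ : ℝ) : ℂ))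
      (TemperedDistribution.smulLeftCLM ℂ (fun x : Dom d => (besselSymb x : ℂ)) T) = T := by
    intro T
    rw [TemperedDistribution.smulLeftCLM_smulLeftCLM_apply hg hgi]
    have : ((fun x : Dom d => (besselSymb x : ℂ)) *
        fun x : Dom d => (((besselSymb x)⁻¹ : ℝ) : ℂ)) = fun _ => (1 : ℂ) := by
      ext x
      simp only [Pi.mul_apply]
      rw [← Complex.ofReal_mul, mul_inv_cancel₀ (besselSymb_pos x).ne', Complex.ofReal_one]
    rw [this, TemperedDistribution.smulLeftCLM_const, one_smul]
  have hone' : ∀ T : 𝓢'(Dom d, ℂ), TemperedDistribution.smulLeftCLM ℂ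
      (fun x : Dom d => (besselSymb x : ℂ)) (TemperedDistribution.smulLeftCLM ℂ
      (fun x : Dom d => (((besselSymb x)⁻¹ : ℝ) : ℂ)) T) = T := by
    intro T
    rw [TemperedDistribution.smulLeftCLM_smulLeftCLM_apply hgi hg]
    have : ((fun x : Dom d => (((besselSymb x)⁻¹ : ℝ) : ℂ)) * fun x : Dom d => (besselSymb x : ℂ)) =
        fun _ => (1 : ℂ) := by
      ext x
      simp only [Pi.mul_apply]
      rw [← Complex.ofReal_mul, inv_mul_cancel₀ (besselSymb_pos x).ne', Complex.ofReal_one]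
    rw [this, TemperedDistribution.smulLeftCLM_const, one_smul]
  rw [MemH2, TemperedDistribution.memSobolev_iff_exists_smulLeftCLM_fourier, hs,
    Lp.fourier_toTemperedDistribution_eq]
  constructor
  · rintro ⟨u, hu⟩
    obtain ⟨v, hv1, hv2⟩ := hmul u
    rw [← hu, hone] at hv2
    have := inj _ _ hv2
    subst this
    refine (Lp.memLp u).ae_eq ?_
    filter_upwards [hv1] with ξ h
    rw [h, ← mul_assoc, ← Complex.ofReal_mul, mul_inv_cancel₀ (besselSymb_pos ξ).ne',
      Complex.ofReal_one, one_mul]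
  · intro hm
    obtain ⟨v, hv1, hv2⟩ := hmul (hm.toLp _)
    refine ⟨hm.toLp _, ?_⟩
    have : v = (𝓕 f : L2 d) := by
      refine Lp.ext ?_
      filter_upwards [hv1, hm.coeFn_toLp] with ξ h1 h2
      rw [h1, h2, ← mul_assoc, ← Complex.ofReal_mul, inv_mul_cancel₀ (besselSymb_pos ξ).ne',
        Complex.ofReal_one, one_mul]
    rw [this] at hv2
    rw [hv2, hone']

theorem memH2_iff {f : L2 d} : MemH2 f ↔ h2Norm f < ∞ := by
  rw [memH2_iff_fourier]
  have hs : AEStronglyMeasurable (fun ξ => (symb ξ : ℂ) * (𝓕 f : L2 d) ξ) volume :=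
    (Complex.continuous_ofReal.comp continuous_symb).aestronglyMeasurable.mul
      (Lp.aestronglyMeasurable _)
  have hb : AEStronglyMeasurable (fun ξ => (besselSymb ξ : ℂ) * (𝓕 f : L2 d) ξ) volume :=
    (Continuous.aestronglyMeasurable (by unfold besselSymb; fun_prop)).mul
      (Lp.aestronglyMeasurable _)
  constructor
  · intro h
    refine (h.of_le_mul (c := 1 + (2 * Real.pi) ^ 2) hs (Eventually.of_forall fun ξ => ?_)).2
    rw [norm_mul, norm_mul, Complex.norm_real, Complex.norm_real,
      Real.norm_of_nonneg (symb_pos ξ).le, Real.norm_of_nonneg (besselSymb_pos ξ).le, ← mul_assoc]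
    gcongr
    exact symb_le_besselSymb ξ
  · intro h
    refine MemLp.of_le_mul (c := 1) (⟨hs, h⟩ : MemLp _ 2 volume) hb
      (Eventually.of_forall fun ξ => ?_)
    rw [norm_mul, norm_mul, Complex.norm_real, Complex.norm_real, one_mul,
      Real.norm_of_nonneg (symb_pos ξ).le, Real.norm_of_nonneg (besselSymb_pos ξ).le]
    gcongr
    exact besselSymb_le_symb ξ

theorem memH2_iff_exists_resolvent {f : L2 d} : MemH2 f ↔ ∃ w, resolvent w = f := by
  rw [memH2_iff]
  refine ⟨exists_resolvent_eq, ?_⟩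
  rintro ⟨w, rfl⟩
  rw [h2Norm_resolvent]
  exact ENNReal.ofReal_lt_top

/-- The Fourier symbol of `e^{iaΔ}`. -/
def schrodingerSymb (a : ℝ) (ξ : Dom d) : ℂ :=
  Complex.exp (-(Complex.I * ((a * (2 * Real.pi * ‖ξ‖) ^ 2 : ℝ) : ℂ)))

theorem norm_schrodingerSymb (a : ℝ) (ξ : Dom d) : ‖schrodingerSymb a ξ‖ = 1 := by
  rw [schrodingerSymb, mul_comm Complex.I, ← neg_mul, ← Complex.ofReal_neg,
      Complex.norm_exp_ofReal_mul_I]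

theorem continuous_schrodingerSymb (a : ℝ) : Continuous (schrodingerSymb (d := d) a) := by
  unfold schrodingerSymb; fun_prop

/-- `e^{iaΔ}` as a bounded operator. -/
def schrodinger (a : ℝ) : L2 d →L[ℂ] L2 d :=
  FourierTransform.fourierInvCLM ℂ (L2 d) ∘L
    mulOp (schrodingerSymb a) (continuous_schrodingerSymb a) 1
      (fun ξ => (norm_schrodingerSymb a ξ).le) ∘L FourierTransform.fourierCLM ℂ (L2 d)

theorem schrodinger_eq (a : ℝ) (f : L2 d) : schrodinger a f = schrodingerOp a f := rfl

theorem schrodinger_apply (a : ℝ) (f : L2 d) : schrodinger a f =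
    𝓕⁻ (mulOp (schrodingerSymb a) (continuous_schrodingerSymb a) 1
      (fun ξ => (norm_schrodingerSymb a ξ).le) (𝓕 f : L2 d)) := rfl

theorem norm_fourierInv_eq (f : L2 d) : ‖(𝓕⁻ f : L2 d)‖ = ‖f‖ := by
  rw [← Lp.norm_fourier_eq (𝓕⁻ f : L2 d), FourierTransform.fourier_fourierInv_eq]

theorem norm_schrodinger (a : ℝ) (f : L2 d) : ‖schrodinger a f‖ = ‖f‖ := by
  rw [schrodinger_apply, norm_fourierInv_eq, mulOp_isometry (norm_schrodingerSymb a),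
    Lp.norm_fourier_eq]

theorem schrodinger_add (a b : ℝ) (f : L2 d) :
    schrodinger (a + b) f = schrodinger a (schrodinger b f) := by
  rw [schrodinger_apply, schrodinger_apply, schrodinger_apply,
    FourierTransform.fourier_fourierInv_eq]
  congr 1
  refine Lp.ext ?_
  have h1 := mulOp_coeFn (ha := continuous_schrodingerSymb (d := d) (a + b))
    (hC := fun ξ => (norm_schrodingerSymb (a + b) ξ).le) (𝓕 f : L2 d)
  have h2 := mulOp_coeFn (ha := continuous_schrodingerSymb (d := d) b)
    (hC := fun ξ => (norm_schrodingerSymb b ξ).le) (𝓕 f : L2 d)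
  have h3 := mulOp_coeFn (ha := continuous_schrodingerSymb (d := d) a)
    (hC := fun ξ => (norm_schrodingerSymb a ξ).le)
    (mulOp (schrodingerSymb b) (continuous_schrodingerSymb b) 1
      (fun ξ => (norm_schrodingerSymb b ξ).le) (𝓕 f : L2 d))
  filter_upwards [h1, h2, h3] with ξ e1 e2 e3
  rw [e1, e3, e2, ← mul_assoc, schrodingerSymb, schrodingerSymb, schrodingerSymb, ← Complex.exp_add]
  congr 2
  push_cast
  ring

theorem schrodinger_zero (f : L2 d) : schrodinger 0 f = f := by
  rw [schrodinger_apply]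
  have hf : (𝓕⁻ (𝓕 f : L2 d) : L2 d) = f := FourierTransform.fourierInv_fourier_eq f
  conv_rhs => rw [← hf]
  congr 1
  refine Lp.ext ?_
  filter_upwards [mulOp_coeFn (ha := continuous_schrodingerSymb (d := d) 0)
    (hC := fun ξ => (norm_schrodingerSymb 0 ξ).le) (𝓕 f : L2 d)] with ξ e1
  rw [e1, schrodingerSymb]
  simp

theorem schrodinger_neg_apply (a : ℝ) (f : L2 d) : schrodinger (-a) (schrodinger a f) = f := by
  rw [← schrodinger_add, neg_add_cancel, schrodinger_zero]

theorem schrodinger_apply_neg (a : ℝ) (f : L2 d) : schrodinger a (schrodinger (-a) f) = f := by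
  rw [← schrodinger_add, add_neg_cancel, schrodinger_zero]

theorem resolvent_schrodinger (a : ℝ) (f : L2 d) :
    resolvent (schrodinger a f) = schrodinger a (resolvent f) := by
  rw [schrodinger_apply, schrodinger_apply, resolvent_apply, resolvent_apply,
    FourierTransform.fourier_fourierInv_eq, FourierTransform.fourier_fourierInv_eq, mulOp_comm]

theorem fourier_sub_L2 (f g : L2 d) : (𝓕 (f - g) : L2 d) = 𝓕 f - 𝓕 g :=
  (Lp.fourierTransformₗᵢ (Dom d) ℂ).map_sub f g

/-- Dominated convergence on the Fourier side, with majorant 4|f̂|². The group is not norm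
continuous, which is why compactness of orbits is used later. -/
theorem continuous_schrodinger_left (f : L2 d) : Continuous fun a => schrodinger a f := by
  have key : ∀ a b : ℝ, ‖schrodinger a f - schrodinger b f‖ ^ 2 =
      ∫ ξ, ‖(schrodingerSymb a ξ - schrodingerSymb b ξ) * (𝓕 f : L2 d) ξ‖ ^ 2 := by
    intro a b
    rw [← Lp.norm_fourier_eq, fourier_sub_L2, schrodinger_apply, schrodinger_apply,
      FourierTransform.fourier_fourierInv_eq, FourierTransform.fourier_fourierInv_eq, L2_norm_sq]
    refine integral_congr_ae ?_
    have h2 := mulOp_coeFn (ha := continuous_schrodingerSymb (d := d) b)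
      (hC := fun ξ => (norm_schrodingerSymb b ξ).le) (𝓕 f : L2 d)
    have h3 := mulOp_coeFn (ha := continuous_schrodingerSymb (d := d) a)
      (hC := fun ξ => (norm_schrodingerSymb a ξ).le) (𝓕 f : L2 d)
    filter_upwards [h2, h3, Lp.coeFn_sub (mulOp (schrodingerSymb a) (continuous_schrodingerSymb a) 1
      (fun ξ => (norm_schrodingerSymb a ξ).le) (𝓕 f : L2 d)) (mulOp (schrodingerSymb b)
      (continuous_schrodingerSymb b) 1 (fun ξ => (norm_schrodingerSymb b ξ).le) (𝓕 f : L2 d))]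
      with ξ e2 e3 e4
    rw [e4, Pi.sub_apply, e2, e3, sub_mul]
  rw [continuous_iff_continuousAt]
  intro b
  rw [ContinuousAt, tendsto_iff_norm_sub_tendsto_zero]
  have hc : Continuous fun a : ℝ =>
      ∫ ξ, ‖(schrodingerSymb a ξ - schrodingerSymb b ξ) * (𝓕 f : L2 d) ξ‖ ^ 2 := by
    refine continuous_of_dominated (bound := fun ξ => 4 * ‖(𝓕 f : L2 d) ξ‖ ^ 2) (fun a => ?_)
      (fun a => Eventually.of_forall fun ξ => ?_)
      ((integrable_norm_sq (Lp.memLp (𝓕 f : L2 d))).const_mul 4)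
      (Eventually.of_forall fun ξ => ?_)
    · exact ((((continuous_schrodingerSymb a).sub
        (continuous_schrodingerSymb b)).aestronglyMeasurable.mul
        (Lp.aestronglyMeasurable _)).norm.pow 2)
    · rw [Real.norm_of_nonneg (sq_nonneg _), norm_mul, mul_pow]
      gcongr
      have h1 : ‖schrodingerSymb a ξ - schrodingerSymb b ξ‖ ≤ 2 := by
        refine (norm_sub_le _ _).trans ?_
        rw [norm_schrodingerSymb, norm_schrodingerSymb]
        norm_num
      nlinarith [norm_nonneg (schrodingerSymb a ξ - schrodingerSymb b ξ)]
    · unfold schrodingerSymb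
      fun_prop
  have h1 := hc.tendsto b
  simp only [sub_self, zero_mul, norm_zero, ne_eq, OfNat.ofNat_ne_zero, not_false_eq_true,
    zero_pow, integral_zero] at h1
  have h2 := (Real.continuous_sqrt.tendsto 0).comp h1
  rw [Real.sqrt_zero] at h2
  refine h2.congr fun a => ?_
  rw [Function.comp_apply, ← key, Real.sqrt_sq (norm_nonneg _)]

theorem continuous_schrodinger : Continuous fun q : ℝ × L2 d => schrodinger q.1 q.2 := by
  rw [continuous_iff_continuousAt]
  rintro ⟨a, f⟩
  rw [ContinuousAt, tendsto_iff_norm_sub_tendsto_zero]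
  have h1 : Tendsto (fun q : ℝ × L2 d => ‖q.2 - f‖ + ‖schrodinger q.1 f - schrodinger a f‖)
      (𝓝 (a, f)) (𝓝 0) := by
    have : Continuous fun q : ℝ × L2 d => ‖q.2 - f‖ + ‖schrodinger q.1 f - schrodinger a f‖ := by
      have := (continuous_schrodinger_left f).comp (continuous_fst (X := ℝ) (Y := L2 d))
      exact (continuous_snd.sub continuous_const).norm.add (this.sub continuous_const).norm
    have := this.tendsto (a, f)
    simpa using this
  refine squeeze_zero (fun _ => norm_nonneg _) (fun q => ?_) h1
  rw [← norm_schrodinger q.1 (q.2 - f), map_sub]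
  exact norm_sub_le_norm_sub_add_norm_sub _ _ _

end SobolevSpace

/-! ### Continuous representatives of H² functions, Sobolev embedding and second differences. -/

section Representative

variable {d : ℕ}

/-- A square integrable weight dominating powers of the resolvent symbol for `d ≤ 3`. -/
def embWeight (ξ : Dom d) : ℝ := (1 + ‖ξ‖ ^ 2) ^ (-(7 / 8) : ℝ)

theorem embWeight_nonneg (ξ : Dom d) : 0 ≤ embWeight ξ := by unfold embWeight; positivity

theorem memLp_embWeight (hd : d ≤ 3) : MemLp (embWeight (d := d)) 2 volume := by
  have hc : Continuous (embWeight (d := d)) := by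
    unfold embWeight
    refine Continuous.rpow_const (by fun_prop) fun x => Or.inl ?_
    positivity
  rw [memLp_two_iff_integrable_sq hc.aestronglyMeasurable]
  have hr : (Module.finrank ℝ (Dom d) : ℝ) < 7 / 2 := by
    rw [finrank_euclideanSpace_fin]
    have : (d : ℝ) ≤ 3 := by exact_mod_cast hd
    linarith
  refine (integrable_rpow_neg_one_add_norm_sq (E := Dom d) (μ := volume) hr).congr
    (Eventually.of_forall fun x => ?_)
  simp only [embWeight]
  rw [← Real.rpow_mul_natCast (by positivity)]
  congr 1
  norm_num

/-- The exponent is split as 1 = 1/8 + 7/8. The power 7/8 of the symbol is enough for square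
integrability because 7/2 > 3, and the remaining 1/8 gives decay in A. -/
theorem inv_add_symb_le {A : ℝ} (hA : 0 < A) (ξ : Dom d) :
    (A + symb ξ)⁻¹ ≤ A ^ (-(1 / 8) : ℝ) * embWeight ξ := by
  have hs := symb_pos ξ
  have h1 : 0 < A + symb ξ := by linarith
  have h2 : (A + symb ξ)⁻¹ = (A + symb ξ) ^ (-(1 / 8) : ℝ) * (A + symb ξ) ^ (-(7 / 8) : ℝ) := by
    rw [← Real.rpow_add h1, ← Real.rpow_neg_one]
    norm_num
  rw [h2, embWeight]
  have h3 : 1 + ‖ξ‖ ^ 2 ≤ A + symb ξ := (besselSymb_le_symb ξ).trans (by linarith)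
  gcongr ?_ * ?_
  · exact Real.rpow_le_rpow_of_nonpos hA (by linarith) (by norm_num)
  · exact Real.rpow_le_rpow_of_nonpos (by positivity) h3 (by norm_num)

/-- The Fourier transform of `resolvent w`. -/
def hatRes (w : L2 d) : L2 d := mulOp invSymb continuous_invSymb 1 norm_invSymb_le (𝓕 w : L2 d)

theorem hatRes_coeFn (w : L2 d) : hatRes w =ᵐ[volume] fun ξ => invSymb ξ * (𝓕 w : L2 d) ξ :=
  mulOp_coeFn _

theorem norm_hatRes (w : L2 d) : ‖hatRes w‖ = ‖resolvent w‖ := by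
  rw [resolvent_apply, norm_fourierInv_eq]; rfl

/-- Cauchy–Schwarz applied to (A + symbol)⁻¹ times (A + symbol)·`hatRes w`, the latter being
A·`hatRes w` + ŵ. The free parameter A interpolates between L² and H²: a large A is affordable when
the L² norm of `resolvent w` is small. -/
theorem eLpNorm_hatRes_le {A : ℝ} (hA : 0 < A) (w : L2 d) :
    eLpNorm (hatRes w) 1 volume ≤ ENNReal.ofReal (A ^ (-(1 / 8) : ℝ)) *
      eLpNorm (embWeight (d := d)) 2 volume * ENNReal.ofReal (A * ‖resolvent w‖ + ‖w‖) := by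
  set g : L2 d := (A : ℂ) • hatRes w + 𝓕 w with hg
  have hgn : ‖g‖ ≤ A * ‖resolvent w‖ + ‖w‖ := by
    refine (norm_add_le _ _).trans (le_of_eq ?_)
    rw [norm_smul, Complex.norm_real, Real.norm_of_nonneg hA.le, norm_hatRes, Lp.norm_fourier_eq]
  have hle : ∀ᵐ ξ, ‖hatRes w ξ‖ ≤ A ^ (-(1 / 8) : ℝ) * ‖embWeight ξ * ‖g ξ‖‖ := by
    filter_upwards [hatRes_coeFn w, Lp.coeFn_add ((A : ℂ) • hatRes w) (𝓕 w : L2 d),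
      Lp.coeFn_smul (A : ℂ) (hatRes w)] with ξ h1 h2 h3
    have hs := symb_pos ξ
    have e : (𝓕 w : L2 d) ξ = (symb ξ : ℂ) * hatRes w ξ := by
      rw [h1, ← mul_assoc, symb_mul_invSymb, one_mul]
    have e2 : g ξ = ((A + symb ξ : ℝ) : ℂ) * hatRes w ξ := by
      rw [hg, h2, Pi.add_apply, h3, Pi.smul_apply, e, smul_eq_mul]
      push_cast
      ring
    rw [e2, norm_mul (((A + symb ξ : ℝ) : ℂ)), Complex.norm_real,
      Real.norm_of_nonneg (by positivity : 0 ≤ A + symb ξ),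
      Real.norm_of_nonneg (mul_nonneg (embWeight_nonneg ξ) (by positivity)), ← mul_assoc,
      ← mul_assoc]
    have h5 := inv_add_symb_le hA ξ
    have h6 : 1 ≤ A ^ (-(1 / 8) : ℝ) * embWeight ξ * (A + symb ξ) := by
      rw [inv_le_iff_one_le_mul₀ (by positivity)] at h5
      exact h5
    nlinarith [norm_nonneg (hatRes w ξ)]
  refine (eLpNorm_le_mul_eLpNorm_of_ae_le_mul hle 1).trans ?_
  rw [mul_assoc]
  gcongr
  have hg' : AEStronglyMeasurable (fun ξ => ‖g ξ‖) volume := (Lp.aestronglyMeasurable g).norm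
  have hw : AEStronglyMeasurable (embWeight (d := d)) volume := by
    refine Continuous.aestronglyMeasurable ?_
    unfold embWeight
    refine Continuous.rpow_const (by fun_prop) fun x => Or.inl ?_
    positivity
  have := eLpNorm_smul_le_mul_eLpNorm (p := 2) (q := 2) (r := 1) hg' hw
  refine this.trans ?_
  gcongr
  rw [eLpNorm_norm]
  have h7 : eLpNorm g 2 volume = ENNReal.ofReal ‖g‖ := by
    rw [Lp.norm_def, ENNReal.ofReal_toReal (Lp.eLpNorm_ne_top g)]
  rw [h7]
  exact ENNReal.ofReal_le_ofReal hgn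

theorem integrable_hatRes (hd : d ≤ 3) (w : L2 d) : Integrable (hatRes w) volume := by
  rw [← memLp_one_iff_integrable]
  refine ⟨Lp.aestronglyMeasurable _, (eLpNorm_hatRes_le one_pos w).trans_lt ?_⟩
  exact ENNReal.mul_lt_top (ENNReal.mul_lt_top ENNReal.ofReal_lt_top (memLp_embWeight hd).2)
    ENNReal.ofReal_lt_top

/-- The continuous representative of the `H²` function `resolvent w`. -/
def rep (w : L2 d) : Dom d → ℂ := 𝓕⁻ (hatRes w : Dom d → ℂ)

theorem rep_ae_eq (hd : d ≤ 3) (w : L2 d) : rep w =ᵐ[volume] resolvent w :=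
  (fourierInv_coeFn_of_integrable (hatRes w) (integrable_hatRes hd w)).symm

theorem continuous_rep (hd : d ≤ 3) (w : L2 d) : Continuous (rep w) :=
  VectorFourier.fourierIntegral_continuous Real.continuous_fourierChar
      (innerSL ℝ).continuous₂.neg (integrable_hatRes hd w)

theorem eq_of_continuous_of_ae_eq {f g : Dom d → ℂ} (hf : Continuous f) (hg : Continuous g)
    (h : f =ᵐ[volume] g) : f = g := (hf.ae_eq_iff_eq volume hg).1 h

theorem rep_sub (hd : d ≤ 3) (w w' : L2 d) (x : Dom d) : rep (w - w') x = rep w x - rep w' x := by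
  have : rep (w - w') = fun x => rep w x - rep w' x := by
    refine eq_of_continuous_of_ae_eq (continuous_rep hd _)
      ((continuous_rep hd _).sub (continuous_rep hd _)) ?_
    filter_upwards [rep_ae_eq hd (w - w'), rep_ae_eq hd w, rep_ae_eq hd w',
      Lp.coeFn_sub (resolvent w) (resolvent w')] with x h1 h2 h3 h4
    rw [h1, h2, h3, map_sub, h4, Pi.sub_apply]
  exact congrFun this x

theorem exists_norm_rep_le (hd : d ≤ 3) : ∃ c : ℝ, 0 < c ∧ ∀ A > 0, ∀ (w : L2 d) (x : Dom d),
    ‖rep w x‖ ≤ A ^ (-(1 / 8) : ℝ) * c * (A * ‖resolvent w‖ + ‖w‖) := by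
  refine ⟨(eLpNorm (embWeight (d := d)) 2 volume).toReal + 1, by positivity, fun A hA w x => ?_⟩
  have h1 := norm_fourierInv_le (hatRes w : Dom d → ℂ) x
  have h2 : ∫ ξ, ‖hatRes w ξ‖ = (eLpNorm (hatRes w) 1 volume).toReal := by
    rw [integral_norm_eq_lintegral_enorm (Lp.aestronglyMeasurable _), eLpNorm_one_eq_lintegral_enorm]
  have h3 := ENNReal.toReal_mono (ENNReal.mul_lt_top (ENNReal.mul_lt_top ENNReal.ofReal_lt_top
    (memLp_embWeight hd).2) ENNReal.ofReal_lt_top).ne (eLpNorm_hatRes_le hA w)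
  rw [ENNReal.toReal_mul, ENNReal.toReal_mul, ENNReal.toReal_ofReal (by positivity),
    ENNReal.toReal_ofReal (by positivity)] at h3
  refine (h1.trans_eq h2).trans (h3.trans ?_)
  gcongr
  linarith

/-- The Sobolev embedding `H² ⊆ L^∞`. -/
theorem exists_norm_rep_le_norm (hd : d ≤ 3) : ∃ c : ℝ, 0 < c ∧ ∀ (w : L2 d) (x : Dom d),
    ‖rep w x‖ ≤ c * ‖w‖ := by
  obtain ⟨c, hc, h⟩ := exists_norm_rep_le hd
  refine ⟨c * 2, by positivity, fun w x => (h 1 one_pos w x).trans ?_⟩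
  have h1 : ‖resolvent w‖ ≤ ‖w‖ := by
    rw [← norm_hatRes, ← Lp.norm_fourier_eq w]
    refine Lp.norm_le_norm_of_ae_le ?_
    filter_upwards [hatRes_coeFn w] with ξ h
    rw [h, norm_mul]
    exact mul_le_of_le_one_left (norm_nonneg _) (norm_invSymb_le ξ)
  rw [Real.one_rpow]
  nlinarith

/-- `H²` functions which are bounded in `H²` and small in `L²` are small in `L^∞`. -/
theorem exists_norm_rep_le_small (hd : d ≤ 3) (M : ℝ) {s : ℝ} (hs : 0 < s) :
    ∃ σ > 0, ∀ w : L2 d, ‖w‖ ≤ M → ‖resolvent w‖ ≤ σ → ∀ x, ‖rep w x‖ ≤ s := by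
  obtain ⟨c, hc, h⟩ := exists_norm_rep_le hd
  have h1 : Tendsto (fun A : ℝ => A ^ (-(1 / 8) : ℝ) * c * (1 + |M|)) atTop (𝓝 0) := by
    have := ((tendsto_rpow_neg_atTop (show (0 : ℝ) < 1 / 8 by norm_num)).mul_const c).mul_const
      (1 + |M|)
    simpa using this
  obtain ⟨A, hA, hA0⟩ := ((h1.eventually_le_const hs).and (eventually_gt_atTop 0)).exists
  refine ⟨1 / A, by positivity, fun w hw hr x => (h A hA0 w x).trans (le_trans ?_ hA)⟩
  gcongr
  · calc A * ‖resolvent w‖ ≤ A * (1 / A) := by gcongr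
      _ = 1 := by field_simp
  · exact hw.trans (le_abs_self M)

theorem tendsto_fourierInv_cocompact (f : Dom d → ℂ) :
    Tendsto (𝓕⁻ f) (cocompact (Dom d)) (𝓝 0) := by
  have h := tendsto_integral_exp_inner_smul_cocompact f
  have h3 : Tendsto (fun x : Dom d => -x) (cocompact (Dom d)) (cocompact (Dom d)) :=
    (Homeomorph.neg (Dom d)).isClosedEmbedding.tendsto_cocompact
  refine (h.comp h3).congr fun x => ?_
  rw [Real.fourierInv_eq]
  simp only [Function.comp_apply, inner_neg_right, neg_neg]

/-- By Riemann–Lebesgue the representative vanishes at infinity. Uniform continuity makes all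
increments small for short steps h, as the pointwise comparison requires. -/
theorem uniformContinuous_rep (hd : d ≤ 3) (w : L2 d) : UniformContinuous (rep w) :=
  (continuous_rep hd w).uniformContinuous_of_tendsto_cocompact (tendsto_fourierInv_cocompact _)

theorem integrable_rep_sq (hd : d ≤ 3) (w : L2 d) : Integrable (fun x => ‖rep w x‖ ^ 2) := by
  refine (integrable_norm_sq (Lp.memLp (resolvent w))).congr ?_
  filter_upwards [rep_ae_eq hd w] with x hx
  rw [hx]

theorem memLp_rep (hd : d ≤ 3) (w : L2 d) : MemLp (rep w) 2 volume :=
  (Lp.memLp _).ae_eq (rep_ae_eq hd w).symm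

/-- The Fourier symbol of the second difference operator. -/
def diffSymb (h ξ : Dom d) : ℂ :=
  (Real.fourierChar (inner ℝ h ξ) : ℂ) - 2 + (Real.fourierChar (-inner ℝ h ξ) : ℂ)

theorem continuous_diffSymb (h : Dom d) : Continuous (diffSymb h) := by
  unfold diffSymb
  have := Real.continuous_fourierChar
  fun_prop

theorem diffSymb_eq (h ξ : Dom d) :
    diffSymb h ξ = ((-(2 * Real.sin (Real.pi * inner ℝ h ξ)) ^ 2 : ℝ) : ℂ) := by
  have h1 : (2 * Real.sin (Real.pi * inner ℝ h ξ)) ^ 2 =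
      2 - 2 * Real.cos (2 * Real.pi * inner ℝ h ξ) := by
    rw [mul_pow, Real.sin_sq_eq_half_sub]
    ring_nf
  rw [diffSymb, Real.fourierChar_apply, Real.fourierChar_apply, h1]
  have h2 := Complex.two_cos (x := ((2 * Real.pi * inner ℝ h ξ : ℝ) : ℂ))
  push_cast at h2 ⊢
  rw [show 2 * (Real.pi : ℂ) * -(inner ℝ h ξ : ℝ) * Complex.I =
    -(2 * (Real.pi : ℂ) * (inner ℝ h ξ : ℝ)) * Complex.I by ring]
  linear_combination -h2

theorem norm_diffSymb (h ξ : Dom d) :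
    ‖diffSymb h ξ‖ = (2 * Real.sin (Real.pi * inner ℝ h ξ)) ^ 2 := by
  rw [diffSymb_eq, Complex.norm_real, norm_neg, Real.norm_of_nonneg (sq_nonneg _)]

theorem norm_diffSymb_le_four (h ξ : Dom d) : ‖diffSymb h ξ‖ ≤ 4 := by
  rw [norm_diffSymb]
  nlinarith [Real.sin_sq_le_one (Real.pi * inner ℝ h ξ)]

theorem norm_diffSymb_le (h ξ : Dom d) : ‖diffSymb h ξ‖ ≤ ‖h‖ ^ 2 * symb ξ := by
  rw [norm_diffSymb]
  have h1 : |2 * Real.sin (Real.pi * inner ℝ h ξ)| ≤ |2 * (Real.pi * (‖h‖ * ‖ξ‖))| := by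
    rw [abs_mul, abs_mul]
    refine mul_le_mul_of_nonneg_left (Real.abs_sin_le_abs.trans ?_) (abs_nonneg _)
    rw [abs_mul, abs_mul]
    refine mul_le_mul_of_nonneg_left ?_ (abs_nonneg _)
    exact (abs_real_inner_le_norm h ξ).trans (le_abs_self _)
  have h2 := sq_le_sq.2 h1
  unfold symb
  nlinarith [sq_nonneg ‖h‖]

theorem integrable_bounded_mul {a : Dom d → ℂ} (ha : Continuous a) {C : ℝ} (hC : ∀ ξ, ‖a ξ‖ ≤ C)
    {f : Dom d → ℂ} (hf : Integrable f) : Integrable (fun ξ => a ξ * f ξ) :=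
  hf.bdd_mul ha.aestronglyMeasurable (Eventually.of_forall hC)

theorem secondDiff_fourierInv {f : Dom d → ℂ} (hf : Integrable f) (h x : Dom d) :
    secondDiff h (𝓕⁻ f) x = 𝓕⁻ (fun ξ => diffSymb h ξ * f ξ) x := by
  have hi : ∀ y : Dom d, Integrable (fun ξ => Real.fourierChar (inner ℝ ξ y) • f ξ) := by
    intro y
    have := (Real.fourierIntegral_convergent_iff (μ := volume) (f := f) (-y)).2 hf
    simpa using this
  simp only [secondDiff, Real.fourierInv_eq]
  rw [← integral_const_mul, ← integral_sub (hi _) ((hi _).const_mul 2), ← integral_add _ (hi _)]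
  swap
  · exact (hi _).sub ((hi _).const_mul 2)
  refine integral_congr_ae (Eventually.of_forall fun ξ => ?_)
  simp only [Circle.smul_def, smul_eq_mul, diffSymb, inner_add_right, inner_neg_right,
    sub_eq_add_neg, AddChar.map_add_eq_mul, Circle.coe_mul, real_inner_comm ξ h]
  ring

theorem secondDiff_fourier {f : Dom d → ℂ} (hf : Integrable f) (h ξ : Dom d) :
    𝓕 (secondDiff h f) ξ = diffSymb h ξ * 𝓕 f ξ := by
  have tr : ∀ v : Dom d, 𝓕 (f ∘ fun x => x + v) ξ = Real.fourierChar (inner ℝ v ξ) • 𝓕 f ξ :=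
    fun v => congrFun (VectorFourier.fourierIntegral_comp_add_right Real.fourierChar volume
      (innerₗ (Dom d)) f v) ξ
  have i1 := hf.comp_add_right h
  have i2 := hf.comp_sub_right h
  have hc : ∀ {g : Dom d → ℂ}, Integrable g →
      Integrable (fun v => Real.fourierChar (-inner ℝ v ξ) • g v) := fun hg =>
    (Real.fourierIntegral_convergent_iff ξ).2 hg
  have e : 𝓕 (secondDiff h f) ξ = 𝓕 (f ∘ fun x => x + h) ξ - 2 * 𝓕 f ξ +
      𝓕 (f ∘ fun x => x + -h) ξ := by
    simp only [Real.fourier_eq, Function.comp_def, ← sub_eq_add_neg]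
    rw [← integral_const_mul, ← integral_sub (hc i1) ((hc hf).const_mul 2), ← integral_add _ (hc i2)]
    · refine integral_congr_ae (Eventually.of_forall fun x => ?_)
      simp only [secondDiff, Circle.smul_def, smul_eq_mul]
      ring
    · exact (hc i1).sub ((hc hf).const_mul 2)
  rw [e, tr, tr, diffSymb, inner_neg_left]
  simp only [Circle.smul_def, smul_eq_mul]
  ring

/-- The `L²` norm of second differences of an `H²` function is controlled by its `H²` norm. -/
theorem integral_secondDiff_rep_le (hd : d ≤ 3) (w : L2 d) (h : Dom d) :
    ∫ x, ‖secondDiff h (rep w) x‖ ^ 2 ≤ ‖h‖ ^ 4 * ‖w‖ ^ 2 := by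
  set W : L2 d := mulOp (diffSymb h) (continuous_diffSymb h) 4 (norm_diffSymb_le_four h) (hatRes w)
  have hW := mulOp_coeFn (ha := continuous_diffSymb h) (hC := norm_diffSymb_le_four h) (hatRes w)
  have hWi : Integrable W := (integrable_bounded_mul (continuous_diffSymb h)
    (norm_diffSymb_le_four h) (integrable_hatRes hd w)).congr hW.symm
  have h1 : secondDiff h (rep w) =ᵐ[volume] (𝓕⁻ W : L2 d) := by
    filter_upwards [fourierInv_coeFn_of_integrable W hWi] with x hx
    rw [hx, rep, secondDiff_fourierInv (integrable_hatRes hd w)]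
    exact (Real.fourierInv_congr_ae hW x).symm
  have h2 : ∫ x, ‖secondDiff h (rep w) x‖ ^ 2 = ‖W‖ ^ 2 := by
    rw [← norm_fourierInv_eq W, L2_norm_sq]
    refine integral_congr_ae ?_
    filter_upwards [h1] with x hx
    rw [hx]
  have h3 : ‖W‖ ≤ ‖h‖ ^ 2 * ‖w‖ := by
    rw [← Lp.norm_fourier_eq w]
    refine Lp.norm_le_mul_norm_of_ae_le_mul ?_
    filter_upwards [hW, hatRes_coeFn w] with ξ e1 e2
    rw [e1, e2, norm_mul, norm_mul, invSymb, Complex.norm_real, norm_inv,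
      Real.norm_of_nonneg (symb_pos ξ).le, ← mul_assoc]
    gcongr
    rw [← div_eq_mul_inv, div_le_iff₀ (symb_pos ξ)]
    exact norm_diffSymb_le h ξ
  rw [h2]
  calc ‖W‖ ^ 2 ≤ (‖h‖ ^ 2 * ‖w‖) ^ 2 := by gcongr
    _ = _ := by ring

/-- The `L²` norm of the second difference of an `L¹ ∩ L²` function, on the Fourier side. -/
theorem lintegral_diffSymb_mul_fourier (g : L2 d) {f : Dom d → ℂ} (hfc : Continuous f)
    (hfg : f =ᵐ[volume] g) (hi : Integrable f) (h : Dom d) :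
    ∫⁻ ξ, ‖diffSymb h ξ * (𝓕 g : L2 d) ξ‖ₑ ^ 2 =
      ENNReal.ofReal (∫ x, ‖secondDiff h f x‖ ^ 2) := by
  have hgi : Integrable g := hi.congr hfg
  have hsq : Integrable (fun x => ‖f x‖ ^ 2) := by
    refine (integrable_norm_sq (Lp.memLp g)).congr ?_
    filter_upwards [hfg] with x hx
    rw [hx]
  have hDc : Continuous (secondDiff h f) := by unfold secondDiff; fun_prop
  have hDi : Integrable (secondDiff h f) :=
    ((hi.comp_add_right h).sub (hi.const_mul 2)).add (hi.comp_sub_right h)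
  have hD2 : MemLp (secondDiff h f) 2 volume :=
    memLp_two_of_continuous hDc (integrable_norm_sq_secondDiff hfc hsq h)
  set D : L2 d := hD2.toLp _ with hD
  have e1 : (𝓕 D : L2 d) =ᵐ[volume] fun ξ => diffSymb h ξ * (𝓕 g : L2 d) ξ := by
    filter_upwards [fourier_coeFn_of_integrable D (hDi.congr hD2.coeFn_toLp.symm),
      fourier_coeFn_of_integrable g hgi] with ξ h1 h2
    rw [h1, h2, Real.fourier_congr_ae hD2.coeFn_toLp, secondDiff_fourier hi,
      Real.fourier_congr_ae hfg]
  rw [← norm_toLp_sq hD2, ← hD, ← Lp.norm_fourier_eq, L2_norm_sq,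
    ofReal_integral_eq_lintegral_ofReal (integrable_norm_sq (Lp.memLp _))
      (Eventually.of_forall fun _ => sq_nonneg _)]
  refine lintegral_congr_ae ?_
  filter_upwards [e1] with ξ h1
  rw [h1, ENNReal.ofReal_pow (norm_nonneg _), ofReal_norm]

end Representative

/-! ### Membership in H² from L² bounds on second differences. -/

section SecondDifferenceCriterion

variable {d : ℕ}

theorem eLpNorm_two_le_of_lintegral_sq_le {f : Dom d → ℂ} {B : ℝ} (hB : 0 ≤ B)
    (h : ∫⁻ ξ, ‖f ξ‖ₑ ^ 2 ≤ ENNReal.ofReal (B ^ 2)) : eLpNorm f 2 volume ≤ ENNReal.ofReal B := by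
  rw [eLpNorm_eq_lintegral_rpow_enorm_toReal (by norm_num) (by norm_num)]
  simp only [ENNReal.toReal_ofNat, ENNReal.rpow_ofNat]
  calc (∫⁻ ξ, ‖f ξ‖ₑ ^ 2) ^ (1 / 2 : ℝ) ≤ (ENNReal.ofReal (B ^ 2)) ^ (1 / 2 : ℝ) := by gcongr
    _ = ENNReal.ofReal B := by
        rw [ENNReal.ofReal_rpow_of_nonneg (by positivity) (by norm_num), ← Real.sqrt_eq_rpow,
          Real.sqrt_sq hB]

theorem tendsto_diffSymb_div (j : Fin d) (ξ : Dom d) :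
    Tendsto (fun t : ℝ => t⁻¹ ^ 2 * ‖diffSymb (t • EuclideanSpace.single j (1 : ℝ)) ξ‖) (𝓝[>] 0)
      (𝓝 ((2 * Real.pi * ξ j) ^ 2)) := by
  have h1 : HasDerivAt (fun t : ℝ => 2 * Real.sin (Real.pi * (t * ξ j)))
      (2 * (Real.cos (Real.pi * (0 * ξ j)) * (Real.pi * (1 * ξ j)))) 0 :=
    ((((hasDerivAt_id (0 : ℝ)).mul_const (ξ j)).const_mul Real.pi).sin).const_mul 2
  have h2 := h1.tendsto_slope_zero_right
  simp only [zero_mul, mul_zero, Real.sin_zero, Real.cos_zero, zero_add, sub_zero, one_mul,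
    smul_eq_mul] at h2
  refine ((h2.pow 2).congr fun t => ?_).trans_eq (by ring_nf)
  rw [norm_diffSymb, real_inner_smul_left, EuclideanSpace.inner_single_left]
  simp only [map_one, one_mul]
  ring

/-- By Plancherel the hypothesis bounds the L² norm of t⁻² times the difference symbol times ĝ. The
modulus of this rescaled symbol tends to (2πξ_j)², and Fatou's lemma along a sequence t → 0 passes
the bound to the limit. -/
theorem eLpNorm_coord_sq_mul_fourier_le (g : L2 d) {f : Dom d → ℂ} (hfc : Continuous f)
    (hfg : f =ᵐ[volume] g) (hi : Integrable f) {B : ℝ} (hB : 0 ≤ B) (j : Fin d)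
    (H : ∀ᶠ t in 𝓝[>] (0 : ℝ),
      ∫ x, ‖secondDiff (t • EuclideanSpace.single j (1 : ℝ)) f x‖ ^ 2 ≤ t ^ 4 * B ^ 2) :
    eLpNorm (fun ξ : Dom d => (((2 * Real.pi * ξ j) ^ 2 : ℝ) : ℂ) * (𝓕 g : L2 d) ξ) 2 volume ≤
      ENNReal.ofReal B := by
  refine eLpNorm_two_le_of_lintegral_sq_le hB ?_
  obtain ⟨s, hs⟩ := exists_seq_tendsto (𝓝[>] (0 : ℝ))
  set e : Dom d := EuclideanSpace.single j (1 : ℝ)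
  set Fn : ℕ → Dom d → ℝ≥0∞ := fun n ξ =>
    ENNReal.ofReal ((s n)⁻¹ ^ 4) * ‖diffSymb (s n • e) ξ * (𝓕 g : L2 d) ξ‖ₑ ^ 2
  have hlim : ∀ ξ, Tendsto (fun n => Fn n ξ) atTop
      (𝓝 (‖(((2 * Real.pi * ξ j) ^ 2 : ℝ) : ℂ) * (𝓕 g : L2 d) ξ‖ₑ ^ 2)) := by
    intro ξ
    have h1 := (((tendsto_diffSymb_div j ξ).comp hs).pow 2).mul_const (‖(𝓕 g : L2 d) ξ‖ ^ 2)
    have h2 := (ENNReal.continuous_ofReal.tendsto _).comp h1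
    refine (h2.congr fun n => ?_).trans_eq ?_
    · simp only [Function.comp_apply, Fn]
      rw [← ofReal_norm, ← ENNReal.ofReal_pow (norm_nonneg _), norm_mul,
        ← ENNReal.ofReal_mul (by positivity)]
      congr 1
      ring
    · rw [← ofReal_norm, ← ENNReal.ofReal_pow (norm_nonneg _), norm_mul, Complex.norm_real,
        Real.norm_of_nonneg (sq_nonneg _)]
      congr 2
      ring
  have hbd : ∀ᶠ n in atTop, ∫⁻ ξ, Fn n ξ ≤ ENNReal.ofReal (B ^ 2) := by
    filter_upwards [hs.eventually H, hs.eventually self_mem_nhdsWithin] with n hn hpos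
    have hpos' : 0 < s n := hpos
    simp only [Fn]
    rw [lintegral_const_mul' _ _ ENNReal.ofReal_ne_top,
      lintegral_diffSymb_mul_fourier g hfc hfg hi, ← ENNReal.ofReal_mul (by positivity)]
    refine ENNReal.ofReal_le_ofReal ?_
    calc (s n)⁻¹ ^ 4 * ∫ x, ‖secondDiff (s n • e) f x‖ ^ 2
        ≤ (s n)⁻¹ ^ 4 * (s n ^ 4 * B ^ 2) := by gcongr
      _ = B ^ 2 := by field_simp
  calc ∫⁻ ξ, ‖(((2 * Real.pi * ξ j) ^ 2 : ℝ) : ℂ) * (𝓕 g : L2 d) ξ‖ₑ ^ 2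
      = ∫⁻ ξ, liminf (fun n => Fn n ξ) atTop :=
        lintegral_congr fun ξ => (hlim ξ).liminf_eq.symm
    _ ≤ liminf (fun n => ∫⁻ ξ, Fn n ξ) atTop := by
        refine lintegral_liminf_le' fun n => ?_
        refine (AEMeasurable.pow_const ?_ 2).const_mul _
        exact ((continuous_diffSymb _).aestronglyMeasurable.mul
          (Lp.aestronglyMeasurable _)).enorm
    _ ≤ ENNReal.ofReal (B ^ 2) := liminf_le_of_le (by isBoundedDefault) fun b hb => by
        obtain ⟨n, h1, h2⟩ := (hb.and hbd).exists
        exact h1.trans h2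

/-- A function in `L¹ ∩ L²` whose second differences in the coordinate directions are `O(t²)` in
`L²` belongs to `H²`, with a quantitative bound. -/
theorem h2Norm_le_of_secondDiff (g : L2 d) {f : Dom d → ℂ} (hfc : Continuous f)
    (hfg : f =ᵐ[volume] g) (hi : Integrable f) {B : ℝ} (hB : 0 ≤ B)
    (H : ∀ j : Fin d, ∀ᶠ t in 𝓝[>] (0 : ℝ),
      ∫ x, ‖secondDiff (t • EuclideanSpace.single j (1 : ℝ)) f x‖ ^ 2 ≤ t ^ 4 * B ^ 2) :
    h2Norm g ≤ ENNReal.ofReal (‖g‖ + d * B) := by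
  have e : (fun ξ : Dom d => ((1 + (2 * Real.pi * ‖ξ‖) ^ 2 : ℝ) : ℂ) * (𝓕 g : L2 d) ξ) =
      (𝓕 g : L2 d) + ∑ j : Fin d, fun ξ : Dom d =>
        (((2 * Real.pi * ξ j) ^ 2 : ℝ) : ℂ) * (𝓕 g : L2 d) ξ := by
    ext ξ
    rw [Pi.add_apply, Finset.sum_apply, ← Finset.sum_mul, ← Complex.ofReal_sum,
      Complex.ofReal_add, Complex.ofReal_one, add_mul, one_mul]
    congr 4
    rw [mul_pow, EuclideanSpace.real_norm_sq_eq, Finset.mul_sum]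
    simp only [mul_pow]
  have m : ∀ j : Fin d, AEStronglyMeasurable (fun ξ : Dom d =>
      (((2 * Real.pi * ξ j) ^ 2 : ℝ) : ℂ) * (𝓕 g : L2 d) ξ) volume := fun j =>
    (Continuous.aestronglyMeasurable (by fun_prop)).mul (Lp.aestronglyMeasurable _)
  rw [h2Norm, e]
  refine (eLpNorm_add_le (Lp.aestronglyMeasurable _)
    (Finset.aestronglyMeasurable_sum _ fun j _ => m j) (by norm_num)).trans ?_
  rw [ENNReal.ofReal_add (norm_nonneg _) (by positivity)]
  refine add_le_add (le_of_eq ?_) ((eLpNorm_sum_le (fun j _ => m j) (by norm_num)).trans ?_)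
  · rw [← Lp.norm_fourier_eq g, Lp.norm_def, ENNReal.ofReal_toReal (Lp.eLpNorm_ne_top _)]
  · refine (Finset.sum_le_sum fun j _ =>
      eLpNorm_coord_sq_mul_fourier_le g hfc hfg hi hB j (H j)).trans (le_of_eq ?_)
    rw [Finset.sum_const, Finset.card_univ, Fintype.card_fin, nsmul_eq_mul,
      ENNReal.ofReal_mul (by positivity), ENNReal.ofReal_natCast]

end SecondDifferenceCriterion

/-! ### Estimates for the nonlinearity in L² and H². -/

section NonlinearEstimates

variable {d : ℕ}

theorem exists_pos_mul_le (K : ℝ) {ρ : ℝ} (hρ : 0 < ρ) :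
    ∃ x : ℝ, 0 < x ∧ x ≤ 1 ∧ |K| * x ≤ ρ := by
  refine ⟨min 1 (ρ / (|K| + 1)), by positivity, min_le_left _ _, ?_⟩
  calc |K| * min 1 (ρ / (|K| + 1)) ≤ (|K| + 1) * (ρ / (|K| + 1)) := by
        gcongr
        · linarith
        · exact min_le_right _ _
    _ = ρ := by field_simp

theorem sq_sum_five_le (a b c e f : ℝ) :
    (a + b + c + e + f) ^ 2 ≤ 5 * (a ^ 2 + b ^ 2 + c ^ 2 + e ^ 2 + f ^ 2) := by
  nlinarith [sq_nonneg (a - b), sq_nonneg (a - c), sq_nonneg (a - e), sq_nonneg (a - f),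
    sq_nonneg (b - c), sq_nonneg (b - e), sq_nonneg (b - f), sq_nonneg (c - e), sq_nonneg (c - f),
    sq_nonneg (e - f)]

theorem sq_mul_sq_add_sq_le (c x y : ℝ) :
    (c * (x ^ 2 + y ^ 2)) ^ 2 ≤ 2 * c ^ 2 * (x ^ 4 + y ^ 4) := by
  have h : 2 * c ^ 2 * (x ^ 4 + y ^ 4) - (c * (x ^ 2 + y ^ 2)) ^ 2 = (c * (x ^ 2 - y ^ 2)) ^ 2 := by
    ring
  exact sub_nonneg.1 (h ▸ sq_nonneg _)

theorem sq_le_of_le_sum {X L a ρ b C x x' i k k' : ℝ} (hX : 0 ≤ X)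
    (h : X ≤ L * a + ρ * b + C * (x ^ 2 + x' ^ 2) + (ρ + i) * (k ^ 2 + k' ^ 2)) :
    X ^ 2 ≤ 5 * L ^ 2 * a ^ 2 + 5 * ρ ^ 2 * b ^ 2 + 10 * C ^ 2 * (x ^ 4 + x' ^ 4) +
      10 * ρ ^ 2 * (k ^ 4 + k' ^ 4) + 10 * (i ^ 2 * k ^ 4 + i ^ 2 * k' ^ 4) := by
  have h' : X ≤ L * a + ρ * b + C * (x ^ 2 + x' ^ 2) + ρ * (k ^ 2 + k' ^ 2) +
      i * (k ^ 2 + k' ^ 2) := h.trans_eq (by ring)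
  refine (pow_le_pow_left₀ hX h' 2).trans ((sq_sum_five_le _ _ _ _ _).trans ?_)
  have t1 := sq_mul_sq_add_sq_le C x x'
  have t2 := sq_mul_sq_add_sq_le ρ k k'
  have t3 := sq_mul_sq_add_sq_le i k k'
  rw [mul_pow, mul_pow]
  linarith

theorem mul_sq_le_of_abs_mul_le {A r s B : ℝ} (hA : 0 ≤ A) (hr : 0 ≤ r) (hrs : r ≤ s) (hs : s ≤ 1)
    (h : |A| * s ≤ B) : A * r ^ 2 ≤ B := by
  rw [abs_of_nonneg hA] at h
  have h1 : r ^ 2 ≤ s := by nlinarith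
  exact (mul_le_mul_of_nonneg_left h1 hA).trans h

theorem five_sq_add_le {Y ρ a b c : ℝ} (hY : 0 ≤ Y) (hρ : 0 ≤ ρ) (ha : a ≤ ρ ^ 2 / 3)
    (hb : b ≤ ρ ^ 2 / 3) (hc : c ≤ ρ ^ 2 / 3) : 5 * Y ^ 2 + a + b + c ≤ (3 * Y + ρ) ^ 2 := by
  have h : 0 ≤ Y * ρ := mul_nonneg hY hρ
  nlinarith [sq_nonneg Y]

/-- The integrated form of `exists_secondDiff_compare`: second differences of `|v|^q v - |u|^q u` in
terms of those of `v - u`, with small error. Here `N` bounds the `H²` norms of `u` and `v - u`, `D`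
that of `v - u`, and `S` the sup norm of `v - u`. -/
theorem integral_secondDiff_powerMap_sub_le {q : ℝ} {M L η ρ κ C : ℝ} (hM : 0 < M)
    (hL : 0 < L) (hη : 0 < η) (hρ : 0 < ρ) (hC : 0 < C)
    (hcmp : ∀ b b' k l k' l' : ℂ, ‖b‖ ≤ M → ‖b'‖ ≤ M →
      ‖b' - b‖ ≤ κ → ‖k‖ ≤ κ → ‖l‖ ≤ κ → ‖k'‖ ≤ κ → ‖l'‖ ≤ κ →
      ‖(powerMap q (b' + k') - 2 * powerMap q b' + powerMap q (b' + l')) -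
        (powerMap q (b + k) - 2 * powerMap q b + powerMap q (b + l))‖ ≤
      L * ‖(k' + l') - (k + l)‖ + ρ * ‖k + l‖ + C * (‖k' - k‖ ^ 2 + ‖l' - l‖ ^ 2) +
        (ρ + if ‖b‖ ≤ η then L else 0) * (‖k‖ ^ 2 + ‖l‖ ^ 2))
    {u v : Dom d → ℂ} (hu : Continuous u) (hv : Continuous v)
    (hui : Integrable fun x => ‖u x‖ ^ 2) (hei : Integrable fun x => ‖v x - u x‖ ^ 2)
    (huM : ∀ x, ‖u x‖ ≤ M) (hvM : ∀ x, ‖v x‖ ≤ M) {S : ℝ} (hS0 : 0 < S)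
    (hS : ∀ x, ‖v x - u x‖ ≤ S) (hSκ : S ≤ κ) {h : Dom d}
    (hκu : ∀ x, ‖u (x + h) - u x‖ ≤ min κ η) (hκu' : ∀ x, ‖u (x + -h) - u x‖ ≤ min κ η)
    (hκv : ∀ x, ‖v (x + h) - v x‖ ≤ κ) (hκv' : ∀ x, ‖v (x + -h) - v x‖ ≤ κ) {T D N : ℝ}
    (heD : ∫ x, ‖secondDiff h (fun x => v x - u x) x‖ ^ 2 ≤ T * D ^ 2)
    (heN : ∫ x, ‖secondDiff h (fun x => v x - u x) x‖ ^ 2 ≤ T * N ^ 2)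
    (huN : ∫ x, ‖secondDiff h u x‖ ^ 2 ≤ T * N ^ 2) :
    ∫ x, ‖secondDiff h (fun x => powerMap q (v x) - powerMap q (u x)) x‖ ^ 2 ≤
      T * (5 * L ^ 2 * D ^ 2 + 5 * ρ ^ 2 * (1 + 72 * M ^ 2) * N ^ 2 +
        360 * C ^ 2 * S ^ 2 * N ^ 2 + 720 * L ^ 2 * η * M * N ^ 2) := by
  set e : Dom d → ℂ := fun x => v x - u x with he
  have hec : Continuous e := hv.sub hu
  set A : Set (Dom d) := {x | ‖u x‖ ≤ η}
  have hA : MeasurableSet A := (isClosed_le (by fun_prop) continuous_const).measurableSet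
  have sd : ∀ (g : Dom d → ℂ), secondDiff (-h) g = secondDiff h g := by
    intro g; ext x; simp only [secondDiff, sub_neg_eq_add, ← sub_eq_add_neg]; ring
  have i2e := integrable_norm_sq_secondDiff hec hei h
  have i2u := integrable_norm_sq_secondDiff hu hui h
  have p1 := integrable_norm_diff_pow_four hec hei hS h
  have p2 := integrable_norm_diff_pow_four hec hei hS (-h)
  have k1 := integrable_norm_diff_pow_four hu hui huM h
  have k2 := integrable_norm_diff_pow_four hu hui huM (-h)
  have k1' := k1.indicator hA
  have k2' := k2.indicator hA
  have P1 := integral_norm_diff_pow_four_le hec hei hS0 hS h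
  have P2 := integral_norm_diff_pow_four_le hec hei hS0 hS (-h)
  have K1 := integral_norm_diff_pow_four_le hu hui hM huM h
  have K2 := integral_norm_diff_pow_four_le hu hui hM huM (-h)
  have K1' := integral_norm_diff_pow_four_small_le hu hui hM huM hη
    (fun x => (hκu x).trans (min_le_right _ _))
  have K2' := integral_norm_diff_pow_four_small_le hu hui hM huM hη
    (fun x => (hκu' x).trans (min_le_right _ _))
  rw [sd] at P2 K2 K2'
  -- The square of the pointwise comparison. After integration the quartic terms are bounded by
  -- Gagliardo–Nirenberg: those in v - u gain S², and those restricted to |u| ≤ η gain η.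
  have pt : ∀ x, ‖secondDiff h (fun x => powerMap q (v x) - powerMap q (u x)) x‖ ^ 2 ≤
      5 * L ^ 2 * ‖secondDiff h e x‖ ^ 2 + 5 * ρ ^ 2 * ‖secondDiff h u x‖ ^ 2 +
      10 * C ^ 2 * (‖e (x + h) - e x‖ ^ 4 + ‖e (x + -h) - e x‖ ^ 4) +
      10 * ρ ^ 2 * (‖u (x + h) - u x‖ ^ 4 + ‖u (x + -h) - u x‖ ^ 4) +
      10 * L ^ 2 * (A.indicator (fun x => ‖u (x + h) - u x‖ ^ 4) x +
        A.indicator (fun x => ‖u (x + -h) - u x‖ ^ 4) x) := by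
    intro x
    have key := hcmp (u x) (v x) (u (x + h) - u x) (u (x + -h) - u x) (v (x + h) - v x)
      (v (x + -h) - v x) (huM x) (hvM x) ((hS x).trans hSκ) ((hκu x).trans (min_le_left _ _))
      ((hκu' x).trans (min_le_left _ _)) (hκv x) (hκv' x)
    simp only [add_sub_cancel] at key
    have e1 : secondDiff h (fun x => powerMap q (v x) - powerMap q (u x)) x =
        (powerMap q (v (x + h)) - 2 * powerMap q (v x) + powerMap q (v (x + -h))) -
        (powerMap q (u (x + h)) - 2 * powerMap q (u x) + powerMap q (u (x + -h))) := by
      simp only [secondDiff, ← sub_eq_add_neg]; ring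
    have e2 : (v (x + h) - v x + (v (x + -h) - v x)) - (u (x + h) - u x + (u (x + -h) - u x)) =
        secondDiff h e x := by
      simp only [secondDiff, he, ← sub_eq_add_neg]; ring
    have e3 : u (x + h) - u x + (u (x + -h) - u x) = secondDiff h u x := by
      simp only [secondDiff, ← sub_eq_add_neg]; ring
    have e4 : v (x + h) - v x - (u (x + h) - u x) = e (x + h) - e x := by
      simp only [he]; ring
    have e5 : v (x + -h) - v x - (u (x + -h) - u x) = e (x + -h) - e x := by
      simp only [he]; ring
    rw [← e1, e2, e3, e4, e5] at key
    have sq := sq_le_of_le_sum (norm_nonneg _) key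
    have hi2 : ∀ k : Dom d → ℝ, (if ‖u x‖ ≤ η then L else 0) ^ 2 * k x =
        L ^ 2 * A.indicator k x := by
      intro k
      by_cases hx : ‖u x‖ ≤ η
      · rw [if_pos hx, indicator_of_mem (by exact hx)]
      · rw [if_neg hx, indicator_of_notMem (by exact hx)]
        simp
    rw [hi2 (fun x => ‖u (x + h) - u x‖ ^ 4), hi2 (fun x => ‖u (x + -h) - u x‖ ^ 4),
      ← mul_add, ← mul_assoc] at sq
    exact sq
  have j1 : Integrable (fun x => 5 * L ^ 2 * ‖secondDiff h e x‖ ^ 2) := i2e.const_mul _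
  have j2 : Integrable (fun x => 5 * ρ ^ 2 * ‖secondDiff h u x‖ ^ 2) := i2u.const_mul _
  have j3 : Integrable (fun x => 10 * C ^ 2 *
      (‖e (x + h) - e x‖ ^ 4 + ‖e (x + -h) - e x‖ ^ 4)) := (p1.add p2).const_mul _
  have j4 : Integrable (fun x => 10 * ρ ^ 2 *
      (‖u (x + h) - u x‖ ^ 4 + ‖u (x + -h) - u x‖ ^ 4)) := (k1.add k2).const_mul _
  have j5 : Integrable (fun x => 10 * L ^ 2 * (A.indicator (fun x => ‖u (x + h) - u x‖ ^ 4) x +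
      A.indicator (fun x => ‖u (x + -h) - u x‖ ^ 4) x)) := (k1'.add k2').const_mul _
  have j12 := j1.add j2
  have j123 := j12.add j3
  have j1234 := j123.add j4
  refine (integral_mono_of_nonneg (Eventually.of_forall fun x => sq_nonneg _)
    (j1234.add j5) (Eventually.of_forall pt)).trans ?_
  have hsum := integral_add j1234 j5
  have h1234 := integral_add j123 j4
  have h123 := integral_add j12 j3
  have h12 := integral_add j1 j2
  simp only [Pi.add_apply] at hsum h1234 h123 h12 ⊢
  rw [hsum, h1234, h123, h12, integral_const_mul, integral_const_mul, integral_const_mul,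
    integral_const_mul, integral_const_mul, integral_add p1 p2, integral_add k1 k2,
    integral_add k1' k2']
  have b1 : 5 * L ^ 2 * ∫ x, ‖secondDiff h e x‖ ^ 2 ≤ 5 * L ^ 2 * (T * D ^ 2) := by gcongr
  have b2 : 5 * ρ ^ 2 * ∫ x, ‖secondDiff h u x‖ ^ 2 ≤ 5 * ρ ^ 2 * (T * N ^ 2) := by gcongr
  have b3 : 10 * C ^ 2 * ((∫ x, ‖e (x + h) - e x‖ ^ 4) + ∫ x, ‖e (x + -h) - e x‖ ^ 4) ≤
      10 * C ^ 2 * (18 * S ^ 2 * (T * N ^ 2) + 18 * S ^ 2 * (T * N ^ 2)) := by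
    gcongr
    · exact P1.trans (by gcongr)
    · exact P2.trans (by gcongr)
  have b4 : 10 * ρ ^ 2 * ((∫ x, ‖u (x + h) - u x‖ ^ 4) + ∫ x, ‖u (x + -h) - u x‖ ^ 4) ≤
      10 * ρ ^ 2 * (18 * M ^ 2 * (T * N ^ 2) + 18 * M ^ 2 * (T * N ^ 2)) := by
    gcongr
    · exact K1.trans (by gcongr)
    · exact K2.trans (by gcongr)
  have b5 : 10 * L ^ 2 * ((∫ x, A.indicator (fun x => ‖u (x + h) - u x‖ ^ 4) x) +
      ∫ x, A.indicator (fun x => ‖u (x + -h) - u x‖ ^ 4) x) ≤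
      10 * L ^ 2 * (36 * η * M * (T * N ^ 2) + 36 * η * M * (T * N ^ 2)) := by
    gcongr
    · exact K1'.trans (by gcongr)
    · exact K2'.trans (by gcongr)
  linarith

variable {p : ℝ}

theorem powerFun_resolvent_ae_eq (hd : d ≤ 3) (w : L2 d) :
    powerFun p (resolvent w) =ᵐ[volume] fun x => powerMap (p - 1) (rep w x) := by
  filter_upwards [rep_ae_eq hd w] with x hx
  rw [hx]
  rfl

theorem continuous_powerMap {q : ℝ} (hq : 1 ≤ q) : Continuous (powerMap q) :=
  continuous_iff_continuousAt.2 fun z => (hasFDerivAt_powerMap hq z).continuousAt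

/-- At least quadratic growth puts the nonlinearity of a bounded L² function in L¹, so that its
Fourier transform is an honest integral. -/
theorem norm_powerMap_le {q R : ℝ} (hq : 1 ≤ q) {z : ℂ} (hz : ‖z‖ ≤ R) :
    ‖powerMap q z‖ ≤ R ^ (q - 1) * ‖z‖ ^ 2 := by
  rw [norm_powerMap]
  by_cases h0 : ‖z‖ = 0
  · simp [h0]
  have h1 : ‖z‖ ^ q = ‖z‖ ^ (q - 1) * ‖z‖ := by
    rw [Real.rpow_sub_one h0]; field_simp
  rw [h1, mul_assoc, ← sq]
  gcongr

theorem integrable_powerMap_rep (hd : d ≤ 3) {q : ℝ} (hq : 1 ≤ q) (w : L2 d) :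
    Integrable (fun x => powerMap q (rep w x)) := by
  obtain ⟨c, -, hb⟩ := exists_norm_rep_le_norm hd
  refine ((integrable_rep_sq hd w).const_mul ((c * ‖w‖) ^ (q - 1))).mono'
    ((continuous_powerMap hq).comp (continuous_rep hd w)).aestronglyMeasurable
    (Eventually.of_forall fun x => norm_powerMap_le hq (hb w x))

theorem memLp_powerMap_rep (hd : d ≤ 3) {q : ℝ} (hq : 1 ≤ q) (w : L2 d) :
    MemLp (fun x => powerMap q (rep w x)) 2 volume := by
  obtain ⟨c, hc, hb⟩ := exists_norm_rep_le_norm hd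
  refine (memLp_rep hd w).of_le_mul (c := (c * ‖w‖) ^ q)
    ((continuous_powerMap hq).comp (continuous_rep hd w)).aestronglyMeasurable
    (Eventually.of_forall fun x => ?_)
  rw [norm_powerMap]
  gcongr
  exact hb w x

theorem memLp_powerFun (hd : d ≤ 3) (hp : 2 ≤ p) (w : L2 d) :
    MemLp (powerFun p (resolvent w)) 2 volume :=
  (memLp_powerMap_rep hd (by linarith) w).ae_eq (powerFun_resolvent_ae_eq hd w).symm

theorem nonlinearity_resolvent_ae_eq (hd : d ≤ 3) (hp : 2 ≤ p) (w : L2 d) :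
    nonlinearity p (resolvent w) =ᵐ[volume] fun x => powerMap (p - 1) (rep w x) := by
  rw [nonlinearity, dif_pos (memLp_powerFun hd hp w)]
  exact (MemLp.coeFn_toLp _).trans (powerFun_resolvent_ae_eq hd w)

theorem exists_norm_nonlinearity_sub_le (hd : d ≤ 3) (hp : 2 ≤ p) (M : ℝ) :
    ∃ L : ℝ, 0 ≤ L ∧ ∀ w w' : L2 d, ‖w‖ ≤ M → ‖w'‖ ≤ M →
      ‖nonlinearity p (resolvent w) - nonlinearity p (resolvent w')‖ ≤
        L * ‖resolvent w - resolvent w'‖ := by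
  obtain ⟨c, hc, hb⟩ := exists_norm_rep_le_norm hd
  have hq : 1 ≤ p - 1 := by linarith
  obtain ⟨L, hL, -, h2⟩ := exists_powerMap_bound hq (c * |M|) (by positivity)
  have hbM : ∀ w : L2 d, ‖w‖ ≤ M → ∀ x, ‖rep w x‖ ≤ c * |M| := fun w hw x =>
    (hb w x).trans (by gcongr; exact hw.trans (le_abs_self M))
  refine ⟨L, hL.le, fun w w' hw hw' => Lp.norm_le_mul_norm_of_ae_le_mul ?_⟩
  filter_upwards [Lp.coeFn_sub (nonlinearity p (resolvent w)) (nonlinearity p (resolvent w')),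
    Lp.coeFn_sub (resolvent w) (resolvent w'), nonlinearity_resolvent_ae_eq hd hp w,
    nonlinearity_resolvent_ae_eq hd hp w', rep_ae_eq hd w, rep_ae_eq hd w']
    with x h1 h3 h4 h5 h6 h7
  rw [h1, h3, Pi.sub_apply, Pi.sub_apply, h4, h5, ← h6, ← h7]
  exact norm_powerMap_sub_le hq h2 (hbM w hw x) (hbM w' hw' x)

theorem resolvent_norm_le (w : L2 d) : ‖resolvent w‖ ≤ ‖w‖ := by
  rw [← norm_hatRes, ← Lp.norm_fourier_eq w]
  refine Lp.norm_le_norm_of_ae_le ?_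
  filter_upwards [hatRes_coeFn w] with ξ h
  rw [h, norm_mul]
  exact mul_le_of_le_one_left (norm_nonneg _) (norm_invSymb_le ξ)

/-- The nonlinearity is Lipschitz in `H²` up to an error which is small for `L²`-close arguments. -/
theorem exists_h2Norm_nonlinearity_sub_le (hd : d ≤ 3) (hp : 2 ≤ p) (M : ℝ) :
    ∃ C : ℝ, 0 ≤ C ∧ ∀ ρ > 0, ∃ σ > 0, ∀ w w' : L2 d, ‖w‖ ≤ M → ‖w'‖ ≤ M →
      ‖resolvent w - resolvent w'‖ ≤ σ →
      h2Norm (nonlinearity p (resolvent w) - nonlinearity p (resolvent w')) ≤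
        ENNReal.ofReal (C * ‖w - w'‖ + ρ) := by
  obtain ⟨c, hc, hb⟩ := exists_norm_rep_le_norm hd
  have hq : 1 ≤ p - 1 := by linarith
  obtain ⟨L₂, hL₂, hLip⟩ := exists_norm_nonlinearity_sub_le hd hp M
  set R := c * |M| + 1 with hR
  have hR0 : 0 < R := by positivity
  have hbM : ∀ w : L2 d, ‖w‖ ≤ M → ∀ x, ‖rep w x‖ ≤ R := fun w hw x =>
    (hb w x).trans (by
      have : c * ‖w‖ ≤ c * |M| := by gcongr; exact hw.trans (le_abs_self M)
      linarith)
  obtain ⟨L, hL, hcmp⟩ := exists_secondDiff_compare hq hR0.le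
  refine ⟨L₂ + d * (3 * L), by positivity, fun ρ hρ => ?_⟩
  -- The error occurs once in each of the d coordinate directions.
  set ρ₀ := ρ / (d + 1) with hρ₀
  have hρ₀0 : 0 < ρ₀ := by positivity
  set N := 2 * |M| with hN
  have hρ₀3 : 0 < ρ₀ ^ 2 / 3 := by positivity
  -- The order of choice matters: η and r depend only on M and ρ, they determine κ and C, and the
  -- sup bound S is chosen last, against the possibly huge C. Each of the three error terms receives
  -- a share ρ₀²/3.
  obtain ⟨η, hη, -, hη2⟩ := exists_pos_mul_le (720 * L ^ 2 * R * N ^ 2) hρ₀3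
  obtain ⟨r, hr, hr1, hr2⟩ := exists_pos_mul_le (5 * (1 + 72 * R ^ 2) * N ^ 2) hρ₀3
  obtain ⟨κ, hκ, C, hC, hcmp⟩ := hcmp η hη r hr
  obtain ⟨S₀, hS₀, hS1, hS2⟩ := exists_pos_mul_le (360 * C ^ 2 * N ^ 2) hρ₀3
  set S := min S₀ κ
  have hS : 0 < S := lt_min hS₀ hκ
  obtain ⟨σ, hσ, hsmall⟩ := exists_norm_rep_le_small hd (2 * M) hS
  refine ⟨σ, hσ, fun w w' hw hw' hww => ?_⟩
  set u := rep w' with hu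
  set v := rep w with hv
  have hMn : ‖w - w'‖ ≤ 2 * M := (norm_sub_le _ _).trans (by linarith)
  have huc := continuous_rep hd w'
  have hvc := continuous_rep hd w
  have hvu : (fun x => v x - u x) = rep (w - w') := by
    ext x; rw [rep_sub hd]
  have heS : ∀ x, ‖v x - u x‖ ≤ S := by
    intro x
    rw [← rep_sub hd]
    exact hsmall _ hMn (by rwa [map_sub]) x
  set f : Dom d → ℂ := fun x => powerMap (p - 1) (v x) - powerMap (p - 1) (u x) with hf
  have hfc : Continuous f := ((continuous_powerMap hq).comp hvc).sub
    ((continuous_powerMap hq).comp huc)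
  have hfi : Integrable f := (integrable_powerMap_rep hd hq w).sub (integrable_powerMap_rep hd hq w')
  set g := nonlinearity p (resolvent w) - nonlinearity p (resolvent w') with hg
  have hfg : f =ᵐ[volume] g := by
    filter_upwards [Lp.coeFn_sub (nonlinearity p (resolvent w)) (nonlinearity p (resolvent w')),
      nonlinearity_resolvent_ae_eq hd hp w, nonlinearity_resolvent_ae_eq hd hp w'] with x h1 h2 h3
    rw [hg, h1, Pi.sub_apply, h2, h3]
  have hB : 0 ≤ 3 * L * ‖w - w'‖ + ρ₀ := by positivity
  have H : ∀ j : Fin d, ∀ᶠ t in 𝓝[>] (0 : ℝ),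
      ∫ x, ‖secondDiff (t • EuclideanSpace.single j (1 : ℝ)) f x‖ ^ 2 ≤
        t ^ 4 * (3 * L * ‖w - w'‖ + ρ₀) ^ 2 := by
    intro j
    obtain ⟨δ₁, hδ₁, hu1⟩ := Metric.uniformContinuous_iff_le.1 (uniformContinuous_rep hd w')
      (min κ η) (lt_min hκ hη)
    obtain ⟨δ₂, hδ₂, hv1⟩ := Metric.uniformContinuous_iff_le.1 (uniformContinuous_rep hd w) κ hκ
    filter_upwards [Ioo_mem_nhdsGT (lt_min hδ₁ hδ₂)] with t ht
    set h : Dom d := t • EuclideanSpace.single j (1 : ℝ) with hh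
    have hn : ‖h‖ = t := by
      rw [hh, norm_smul, Real.norm_of_nonneg ht.1.le, PiLp.norm_single]
      simp
    have hdist : ∀ x y : Dom d, ‖y‖ = t → dist (x + y) x ≤ min δ₁ δ₂ := by
      intro x y hy
      rw [dist_eq_norm, add_sub_cancel_left, hy]
      exact ht.2.le
    have hnn : ‖-h‖ = t := by rw [norm_neg, hn]
    have hM0 : M ≤ |M| := le_abs_self M
    have i1 := integral_secondDiff_rep_le hd (w - w') h
    have i2 := integral_secondDiff_rep_le hd w' h
    rw [hn] at i1 i2
    have main := integral_secondDiff_powerMap_sub_le (T := t ^ 4) (D := ‖w - w'‖) (N := N) hR0 hL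
      hη hr hC hcmp huc hvc (integrable_rep_sq hd w')
      (by have := integrable_rep_sq hd (w - w'); simpa only [rep_sub hd] using this)
      (hbM w' hw') (hbM w hw) hS heS (min_le_right _ _) (h := h)
      (fun x => by
        rw [← dist_eq_norm]; exact hu1 ((hdist x h hn).trans (min_le_left _ _)))
      (fun x => by
        rw [← dist_eq_norm]; exact hu1 ((hdist x (-h) hnn).trans (min_le_left _ _)))
      (fun x => by
        rw [← dist_eq_norm]; exact hv1 ((hdist x h hn).trans (min_le_right _ _)))
      (fun x => by
        rw [← dist_eq_norm]; exact hv1 ((hdist x (-h) hnn).trans (min_le_right _ _)))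
      (by rw [hvu]; exact i1)
      (by
        rw [hvu]
        refine i1.trans ?_
        have := ht.1
        gcongr
        linarith)
      (by
        refine i2.trans ?_
        have := ht.1
        gcongr
        linarith [abs_nonneg M])
    refine main.trans (mul_le_mul_of_nonneg_left ?_ (by positivity))
    have k1 := mul_sq_le_of_abs_mul_le (by positivity) hr.le le_rfl hr1 hr2
    have k2 := mul_sq_le_of_abs_mul_le (by positivity) hS.le (min_le_left _ _) hS1 hS2
    have k3 : 720 * L ^ 2 * R * N ^ 2 * η ≤ ρ₀ ^ 2 / 3 := by
      rwa [abs_of_nonneg (by positivity)] at hη2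
    have k4 := five_sq_add_le (Y := L * ‖w - w'‖) (by positivity) hρ₀0.le k1 k2 k3
    calc _ = _ := by ring
      _ ≤ _ := k4
      _ = _ := by ring
  refine (h2Norm_le_of_secondDiff g hfc hfg hfi hB H).trans (ENNReal.ofReal_le_ofReal ?_)
  have h1 : ‖g‖ ≤ L₂ * ‖w - w'‖ := by
    refine (hLip w w' hw hw').trans ?_
    gcongr
    rw [← map_sub]
    exact resolvent_norm_le _
  have h2 : (d : ℝ) * ρ₀ ≤ ρ := by
    rw [hρ₀, ← mul_div_assoc, div_le_iff₀ (by positivity)]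
    nlinarith
  linarith

end NonlinearEstimates

/-! ### The nonlinearity conjugated to L² and the interaction picture field. -/

section InteractionField

variable {d : ℕ} {p : ℝ}

theorem nonlinearity_zero (hd : d ≤ 3) (hp : 2 ≤ p) : nonlinearity p (0 : L2 d) = 0 := by
  have h := nonlinearity_resolvent_ae_eq hd hp (0 : L2 d)
  have h' := rep_ae_eq hd (0 : L2 d)
  rw [map_zero] at h h'
  refine Lp.ext ?_
  filter_upwards [h, h', Lp.coeFn_zero ℂ 2 (volume : Measure (Dom d))] with x h1 h2 h3
  rw [h1, h2, h3, powerMap]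
  simp

/-- The difference estimate, with ρ = 1, speaks only about L²-close arguments. The segment from 0 to
w is therefore cut into n pieces with n > M/σ. Each piece changes the nonlinearity by an H² function
of norm at most CM + 1, and the nonlinearity vanishes at 0. -/
theorem exists_nonlinearity_eq_resolvent (hd : d ≤ 3) (hp : 2 ≤ p) (M : ℝ) :
    ∃ B : ℝ, ∀ w : L2 d, ‖w‖ ≤ M →
      ∃ w', resolvent w' = nonlinearity p (resolvent w) ∧ ‖w'‖ ≤ B := by
  obtain ⟨C, hC, h⟩ := exists_h2Norm_nonlinearity_sub_le (d := d) hd hp M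
  obtain ⟨σ, hσ, h⟩ := h 1 one_pos
  obtain ⟨n, hn⟩ := exists_nat_gt (M / σ)
  refine ⟨n * (C * M + 1), fun w hw => ?_⟩
  have hM : 0 ≤ M := (norm_nonneg w).trans hw
  have hn0 : (0 : ℝ) < n := (div_nonneg hM hσ.le).trans_lt hn
  have hn1 : (1 : ℝ) ≤ n := by exact_mod_cast hn0
  have key : ∀ k : ℕ, k ≤ n → ∃ w',
      resolvent w' = nonlinearity p (resolvent (((k / n : ℝ) : ℂ) • w)) ∧
      ‖w'‖ ≤ k * (C * M + 1) := by
    intro k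
    induction k with
    | zero =>
      intro _
      refine ⟨0, ?_, by simp⟩
      simp [nonlinearity_zero hd hp]
    | succ k ih =>
      intro hk
      obtain ⟨v, hv, hvB⟩ := ih (by omega)
      have hb : ∀ j : ℕ, j ≤ n → ‖((j / n : ℝ) : ℂ) • w‖ ≤ M := by
        intro j hj
        rw [norm_smul, Complex.norm_real, Real.norm_of_nonneg (by positivity)]
        have : (j / n : ℝ) ≤ 1 := (div_le_one hn0).2 (by exact_mod_cast hj)
        exact (mul_le_of_le_one_left (norm_nonneg w) this).trans hw
      have hdiff : (((k + 1 : ℕ) / n : ℝ) : ℂ) • w - ((k / n : ℝ) : ℂ) • w =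
          ((1 / n : ℝ) : ℂ) • w := by
        rw [← sub_smul, ← Complex.ofReal_sub]
        congr 2
        push_cast
        ring
      have hnd : ‖((1 / n : ℝ) : ℂ) • w‖ ≤ M / n := by
        rw [norm_smul, Complex.norm_real, Real.norm_of_nonneg (by positivity), one_div_mul_eq_div]
        gcongr
      have hs := h _ _ (hb (k + 1) hk) (hb k (by omega)) (by
        rw [← map_sub, hdiff]
        refine (resolvent_norm_le _).trans (hnd.trans ?_)
        rw [div_lt_iff₀ hσ] at hn
        rw [div_le_iff₀ hn0]
        linarith)
      rw [hdiff] at hs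
      obtain ⟨e, he⟩ := exists_resolvent_eq (hs.trans_lt ENNReal.ofReal_lt_top)
      rw [← he, h2Norm_resolvent] at hs
      have hB : 0 ≤ C * ‖((1 / n : ℝ) : ℂ) • w‖ + 1 := by positivity
      rw [ENNReal.ofReal_le_ofReal_iff hB] at hs
      refine ⟨v + e, ?_, ?_⟩
      · rw [map_add, hv, he]
        abel
      · have h1 : ‖((1 / n : ℝ) : ℂ) • w‖ ≤ M := hnd.trans (div_le_self hM hn1)
        have h2 : C * ‖((1 / n : ℝ) : ℂ) • w‖ ≤ C * M := by gcongr
        push_cast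
        linarith [norm_add_le v e]
  obtain ⟨w', h1, h2⟩ := key n le_rfl
  rw [div_self hn0.ne', Complex.ofReal_one, one_smul] at h1
  exact ⟨w', h1, h2⟩

/-- The nonlinearity in the variable `w = (1 - Δ) u`. -/
def liftedNonlinearity (p : ℝ) (w : L2 d) : L2 d :=
  Function.invFun resolvent (nonlinearity p (resolvent w))

theorem resolvent_liftedNonlinearity (hd : d ≤ 3) (hp : 2 ≤ p) (w : L2 d) :
    resolvent (liftedNonlinearity p w) = nonlinearity p (resolvent w) := by
  obtain ⟨B, hB⟩ := exists_nonlinearity_eq_resolvent hd hp ‖w‖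
  obtain ⟨w', h, -⟩ := hB w le_rfl
  exact Function.invFun_eq ⟨w', h⟩

theorem exists_norm_liftedNonlinearity_le (hd : d ≤ 3) (hp : 2 ≤ p) (M : ℝ) :
    ∃ B : ℝ, ∀ w : L2 d, ‖w‖ ≤ M → ‖liftedNonlinearity p w‖ ≤ B := by
  obtain ⟨B, hB⟩ := exists_nonlinearity_eq_resolvent (d := d) hd hp M
  refine ⟨B, fun w hw => ?_⟩
  obtain ⟨w', h, hb⟩ := hB w hw
  rwa [resolvent_injective ((resolvent_liftedNonlinearity hd hp w).trans h.symm)]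

theorem exists_norm_liftedNonlinearity_sub_le (hd : d ≤ 3) (hp : 2 ≤ p) (M : ℝ) :
    ∃ C : ℝ, 0 ≤ C ∧ ∀ ρ > 0, ∃ σ > 0, ∀ w w' : L2 d, ‖w‖ ≤ M → ‖w'‖ ≤ M →
      ‖resolvent w - resolvent w'‖ ≤ σ →
      ‖liftedNonlinearity p w - liftedNonlinearity p w'‖ ≤ C * ‖w - w'‖ + ρ := by
  obtain ⟨C, hC, h⟩ := exists_h2Norm_nonlinearity_sub_le (d := d) hd hp M
  refine ⟨C, hC, fun ρ hρ => ?_⟩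
  obtain ⟨σ, hσ, h⟩ := h ρ hρ
  refine ⟨σ, hσ, fun w w' hw hw' hww => ?_⟩
  have := h w w' hw hw' hww
  rwa [← resolvent_liftedNonlinearity hd hp, ← resolvent_liftedNonlinearity hd hp, ← map_sub,
    h2Norm_resolvent, ENNReal.ofReal_le_ofReal_iff (by positivity)] at this

theorem continuous_liftedNonlinearity (hd : d ≤ 3) (hp : 2 ≤ p) :
    Continuous (liftedNonlinearity (d := d) p) := by
  refine Metric.continuous_iff.2 fun w ε hε => ?_
  obtain ⟨C, hC, h⟩ := exists_norm_liftedNonlinearity_sub_le (d := d) hd hp (‖w‖ + 1)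
  obtain ⟨σ, hσ, h⟩ := h (ε / 2) (by positivity)
  refine ⟨min (min 1 σ) (ε / (2 * (C + 1))), by positivity, fun v hv => ?_⟩
  rw [dist_eq_norm] at hv ⊢
  have h1 : ‖v - w‖ < 1 := hv.trans_le ((min_le_left _ _).trans (min_le_left _ _))
  have h2 : ‖v - w‖ < σ := hv.trans_le ((min_le_left _ _).trans (min_le_right _ _))
  have h3 : ‖v - w‖ < ε / (2 * (C + 1)) := hv.trans_le (min_le_right _ _)
  have h4 : ‖v‖ ≤ ‖w‖ + 1 := by
    have := norm_sub_norm_le v w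
    linarith
  have h5 := h v w h4 (by linarith) (by
    rw [← map_sub]; exact (resolvent_norm_le _).trans h2.le)
  rw [lt_div_iff₀ (by positivity)] at h3
  nlinarith [norm_nonneg (v - w)]

theorem continuous_schrodinger_comp {Y : Type*} [TopologicalSpace Y] {g : Y → ℝ} {f : Y → L2 d}
    (hg : Continuous g) (hf : Continuous f) : Continuous fun y => schrodinger (g y) (f y) :=
  (continuous_schrodinger (d := d)).comp (f := fun y => (g y, f y)) (hg.prodMk hf)

/-- The nonlinear term in the interaction picture, in the variable `(1 - Δ) u`. -/
def interactionField (p : ℝ) (a : ℝ) (z : L2 d) : L2 d :=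
  Complex.I • schrodinger (-a) (liftedNonlinearity p (schrodinger a z))

theorem norm_I_smul (f : L2 d) : ‖Complex.I • f‖ = ‖f‖ := by simp [norm_smul]

theorem resolvent_interactionField (hd : d ≤ 3) (hp : 2 ≤ p) (a : ℝ) (z : L2 d) :
    resolvent (interactionField p a z) =
      Complex.I • schrodinger (-a) (nonlinearity p (schrodinger a (resolvent z))) := by
  rw [interactionField, map_smul, resolvent_schrodinger, resolvent_liftedNonlinearity hd hp,
    resolvent_schrodinger]

/-- The weak norm ‖J z‖ is the L² norm of u, the strong norm its H² norm. All bounds are uniform in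
the phase, since e^{iaΔ} is isometric and commutes with the resolvent. -/
theorem quasiLipschitzField_interactionField (hd : d ≤ 3) (hp : 2 ≤ p) :
    QuasiLipschitzField ((resolvent (d := d)).restrictScalars ℝ) (interactionField p) where
  cont := by
    have h1 : Continuous fun q : ℝ × L2 d => liftedNonlinearity p (schrodinger q.1 q.2) :=
      (continuous_liftedNonlinearity hd hp).comp continuous_schrodinger
    have h2 := continuous_schrodinger_comp (continuous_fst (X := ℝ) (Y := L2 d)).neg h1
    exact h2.const_smul Complex.I
  bdd M := by
    obtain ⟨B, hB⟩ := exists_norm_liftedNonlinearity_le (d := d) hd hp M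
    refine ⟨B, fun a z hz => ?_⟩
    rw [interactionField, norm_I_smul, norm_schrodinger]
    exact hB _ (by rwa [norm_schrodinger])
  weak M := by
    obtain ⟨L, -, hL⟩ := exists_norm_nonlinearity_sub_le (d := d) hd hp M
    refine ⟨L, fun a z z' hz hz' => ?_⟩
    have := hL (schrodinger a z) (schrodinger a z') (by rwa [norm_schrodinger])
      (by rwa [norm_schrodinger])
    rw [resolvent_schrodinger, resolvent_schrodinger, ← map_sub, norm_schrodinger] at this
    simp only [ContinuousLinearMap.coe_restrictScalars']
    rwa [resolvent_interactionField hd hp, resolvent_interactionField hd hp, ← smul_sub,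
      ← map_sub, norm_I_smul, norm_schrodinger]
  strong M := by
    obtain ⟨C, -, hC⟩ := exists_norm_liftedNonlinearity_sub_le (d := d) hd hp M
    refine ⟨C, fun ρ hρ => ?_⟩
    obtain ⟨σ, hσ, h⟩ := hC ρ hρ
    refine ⟨σ, hσ, fun a z z' hz hz' hJ => ?_⟩
    simp only [ContinuousLinearMap.coe_restrictScalars'] at hJ
    have := h (schrodinger a z) (schrodinger a z') (by rwa [norm_schrodinger])
      (by rwa [norm_schrodinger]) (by
        rwa [resolvent_schrodinger, resolvent_schrodinger, ← map_sub, norm_schrodinger])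
    rw [← map_sub, norm_schrodinger] at this
    rwa [interactionField, interactionField, ← smul_sub, ← map_sub, norm_I_smul, norm_schrodinger]

end InteractionField

/-! ### Equivalence of Duhamel's formula with the interaction picture equation. -/

section Duhamel

variable {d : ℕ} {p : ℝ}

/-- The cumulative dispersion `Γ(t, t₀) = ∫_{t₀}^t γ`. -/
def cumulative (γ : ℝ → ℝ) (t₀ t : ℝ) : ℝ := ∫ τ in t₀..t, γ τ

variable {γ : ℝ → ℝ} {t₀ : ℝ}

theorem continuous_cumulative (hγ : ∀ a b, IntervalIntegrable γ volume a b) :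
    Continuous (cumulative γ t₀) :=
  intervalIntegral.continuous_primitive hγ t₀

theorem propagator_eq (hγ : ∀ a b, IntervalIntegrable γ volume a b) (t s : ℝ) (f : L2 d) :
    propagator γ t s f =
      schrodinger (cumulative γ t₀ t) (schrodinger (-(cumulative γ t₀ s)) f) := by
  rw [propagator, ← schrodinger_eq, ← schrodinger_add, cumulative, cumulative, ← sub_eq_add_neg,
    intervalIntegral.integral_interval_sub_left (hγ _ _) (hγ _ _)]

theorem propagator_initial (t : ℝ) (f : L2 d) :
    propagator γ t t₀ f = schrodinger (cumulative γ t₀ t) f := rfl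

/-- The propagator factors through time t₀, so its outer factor and the resolvent form one bounded
operator independent of s, which commutes with the Bochner integral. -/
theorem duhamel_integral (hd : d ≤ 3) (hp : 2 ≤ p) (hγ : ∀ a b, IntervalIntegrable γ volume a b)
    {t : ℝ} (ht : t₀ ≤ t) {u z : ℝ → L2 d} (hz : ContinuousOn z (Icc t₀ t))
    (hu : ∀ s ∈ Icc t₀ t, u s = resolvent (schrodinger (cumulative γ t₀ s) (z s))) :
    IntervalIntegrable (fun s => propagator γ t s (nonlinearity p (u s))) volume t₀ t ∧
    Complex.I • ∫ s in t₀..t, propagator γ t s (nonlinearity p (u s)) =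
      resolvent (schrodinger (cumulative γ t₀ t)
        (∫ s in t₀..t, interactionField p (cumulative γ t₀ s) (z s))) := by
  have hF := (quasiLipschitzField_interactionField (p := p) hd hp).cont
  have hG := continuous_cumulative (t₀ := t₀) hγ
  have hi : IntervalIntegrable (fun s => interactionField p (cumulative γ t₀ s) (z s))
      volume t₀ t :=
    ContinuousOn.intervalIntegrable (by
      rw [uIcc_of_le ht]; exact continuousOn_field hF hG hz)
  set A : L2 d →L[ℂ] L2 d := resolvent ∘L schrodinger (cumulative γ t₀ t) with hA
  have key : ∀ s ∈ uIcc t₀ t, Complex.I • propagator γ t s (nonlinearity p (u s)) =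
      A (interactionField p (cumulative γ t₀ s) (z s)) := by
    intro s hs
    rw [uIcc_of_le ht] at hs
    rw [hu s hs, propagator_eq (t₀ := t₀) hγ, hA, ContinuousLinearMap.comp_apply,
      resolvent_schrodinger, resolvent_schrodinger, resolvent_interactionField hd hp, map_smul]
  have hAi : IntervalIntegrable (fun s => A (interactionField p (cumulative γ t₀ s) (z s)))
      volume t₀ t :=
    ⟨A.integrable_comp hi.1, A.integrable_comp hi.2⟩
  have key' : ∀ s ∈ uIcc t₀ t, (-Complex.I) • A (interactionField p (cumulative γ t₀ s) (z s)) =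
      propagator γ t s (nonlinearity p (u s)) := by
    intro s hs
    rw [← key s hs, smul_smul]
    simp
  constructor
  · exact (hAi.smul (-Complex.I)).congr fun s hs => key' s (uIoc_subset_uIcc hs)
  · rw [← intervalIntegral.integral_smul, intervalIntegral.integral_congr key,
      A.intervalIntegral_comp_comm hi]
    rfl

theorem continuousOn_schrodinger_comp {g : ℝ → ℝ} {f : ℝ → L2 d} {s : Set ℝ}
    (hg : ContinuousOn g s) (hf : ContinuousOn f s) :
    ContinuousOn (fun y => schrodinger (g y) (f y)) s :=
  (continuous_schrodinger (d := d)).comp_continuousOn (f := fun y => (g y, f y)) (hg.prodMk hf)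

variable {φ z₀ : L2 d} {Tmax : EReal}

theorem continuousOn_lifespan {Y : Type*} [TopologicalSpace Y] {z : ℝ → Y}
    (h : ∀ T : ℝ, (T : EReal) < Tmax → ContinuousOn z (Icc t₀ T)) :
    ContinuousOn z (lifespan t₀ Tmax) := by
  intro t ht
  obtain ⟨T, h1, h2⟩ := EReal.lt_iff_exists_real_btwn.1 ht.2
  refine (h T h2 t ⟨ht.1, (EReal.coe_lt_coe_iff.1 h1).le⟩).mono_of_mem_nhdsWithin ?_
  filter_upwards [self_mem_nhdsWithin,
    mem_nhdsWithin_of_mem_nhds (Iio_mem_nhds (EReal.coe_lt_coe_iff.1 h1))] with s hs hs'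
  exact ⟨hs.1, (mem_Iio.1 hs').le⟩

theorem Icc_subset_lifespan {T : ℝ} (hT : (T : EReal) < Tmax) : Icc t₀ T ⊆ lifespan t₀ Tmax :=
  fun _ ht => ⟨ht.1, (EReal.coe_le_coe_iff.2 ht.2).trans_lt hT⟩

/-- Solutions of Duhamel's formula in `C([t₀, Tmax), H²)` correspond to continuous solutions of the
integral equation in the interaction picture. -/
theorem isSolution_iff (hd : d ≤ 3) (hp : 2 ≤ p) (hγ : ∀ a b, IntervalIntegrable γ volume a b)
    (hz₀ : resolvent z₀ = φ) {u : ℝ → L2 d} :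
    IsSolution p γ t₀ φ Tmax u ↔ (t₀ : EReal) < Tmax ∧ ∃ z : ℝ → L2 d,
      (∀ T : ℝ, (T : EReal) < Tmax →
        IsMild (interactionField p) (cumulative γ t₀) t₀ T z₀ z) ∧
      ∀ t ∈ lifespan t₀ Tmax, u t = resolvent (schrodinger (cumulative γ t₀ t) (z t)) := by
  have hG := continuous_cumulative (t₀ := t₀) hγ
  constructor
  · intro h
    refine ⟨h.lt_Tmax, ?_⟩
    choose! w hw using fun t ht => memH2_iff_exists_resolvent.1 (h.memH2 t ht)
    have hwc : ContinuousOn w (lifespan t₀ Tmax) := by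
      intro t ht
      refine tendsto_iff_norm_sub_tendsto_zero.2 ?_
      have h1 := (ENNReal.tendsto_toReal ENNReal.zero_ne_top).comp (h.continuous_h2 t ht)
      refine h1.congr' ?_
      filter_upwards [self_mem_nhdsWithin] with s hs
      rw [Function.comp_apply, ← hw s hs, ← hw t ht, ← map_sub, h2Norm_resolvent,
        ENNReal.toReal_ofReal (norm_nonneg _)]
    set z : ℝ → L2 d := fun t => schrodinger (-(cumulative γ t₀ t)) (w t) with hz
    have hzc : ContinuousOn z (lifespan t₀ Tmax) :=
      continuousOn_schrodinger_comp hG.neg.continuousOn hwc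
    have huz : ∀ t ∈ lifespan t₀ Tmax,
        u t = resolvent (schrodinger (cumulative γ t₀ t) (z t)) := by
      intro t ht
      rw [hz, schrodinger_apply_neg, hw t ht]
    refine ⟨z, fun T hT => ⟨hzc.mono (Icc_subset_lifespan hT), fun t ht => ?_⟩, huz⟩
    have htl := Icc_subset_lifespan hT ht
    have hsub : Icc t₀ t ⊆ lifespan t₀ Tmax := Icc_subset_lifespan htl.2
    have e := h.duhamel t htl
    rw [(duhamel_integral hd hp hγ ht.1 (hzc.mono hsub) fun s hs => huz s (hsub hs)).2,
      huz t htl, propagator_initial, ← hz₀, ← resolvent_schrodinger, ← map_add, ← map_add] at e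
    -- Duhamel's formula is an identity in L² between values of the resolvent, so its injectivity
    -- lifts the identity to H². Undoing the outer phase then gives the integral equation.
    have e' := congrArg (schrodinger (-(cumulative γ t₀ t))) (resolvent_injective e)
    rwa [schrodinger_neg_apply, schrodinger_neg_apply] at e'
  · rintro ⟨hlt, z, hm, hu⟩
    have hzc : ContinuousOn z (lifespan t₀ Tmax) := continuousOn_lifespan fun T hT => (hm T hT).1
    have hSc : ContinuousOn (fun t => schrodinger (cumulative γ t₀ t) (z t))
        (lifespan t₀ Tmax) :=
      continuousOn_schrodinger_comp hG.continuousOn hzc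
    have hsub : ∀ t ∈ lifespan t₀ Tmax, Icc t₀ t ⊆ lifespan t₀ Tmax :=
      fun t ht => Icc_subset_lifespan ht.2
    have hduh := fun t (ht : t ∈ lifespan t₀ Tmax) =>
      duhamel_integral hd hp hγ ht.1 (hzc.mono (hsub t ht)) fun s hs => hu s (hsub t ht hs)
    refine ⟨hlt, fun t ht => ?_, fun t ht => ?_, fun t ht => ?_, fun t ht => (hduh t ht).1,
      fun t ht => ?_⟩
    · rw [hu t ht]
      exact memH2_iff_exists_resolvent.2 ⟨_, rfl⟩
    · have h1 := tendsto_iff_norm_sub_tendsto_zero.1 (hSc t ht)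
      have h2 := (ENNReal.continuous_ofReal.tendsto 0).comp h1
      rw [ENNReal.ofReal_zero] at h2
      refine h2.congr' ?_
      filter_upwards [self_mem_nhdsWithin] with s hs
      rw [Function.comp_apply, hu s hs, hu t ht, ← map_sub, h2Norm_resolvent]
    · rw [hu t ht]
      exact memLp_powerFun hd hp _
    · rw [(hduh t ht).2, propagator_initial, ← hz₀, ← resolvent_schrodinger, ← map_add, ← map_add,
        hu t ht]
      congr 2
      exact (hm t ht.2).2 t ⟨ht.1, le_rfl⟩

/-- The Cauchy problem has a maximal solution, described in the interaction picture, and every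
solution is a restriction of it. -/
theorem exists_isMaximalSolution (hd : d ≤ 3) (hp : 2 ≤ p)
    (hγ : ∀ a b, IntervalIntegrable γ volume a b) (hz₀ : resolvent z₀ = φ) :
    ∃ (Tmax : EReal) (z : ℝ → L2 d),
      (∀ T : ℝ, (T : EReal) < Tmax →
        IsMild (interactionField p) (cumulative γ t₀) t₀ T z₀ z) ∧
      (∀ (T : ℝ) (z' : ℝ → L2 d), t₀ ≤ T →
        IsMild (interactionField p) (cumulative γ t₀) t₀ T z₀ z' → (T : EReal) < Tmax) ∧
      IsMaximalSolution p γ t₀ φ Tmax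
        (fun t => resolvent (schrodinger (cumulative γ t₀ t) (z t))) ∧
      ∀ (T' : EReal) (v : ℝ → L2 d), IsSolution p γ t₀ φ T' v → T' ≤ Tmax ∧
        EqOn v (fun t => resolvent (schrodinger (cumulative γ t₀ t) (z t))) (lifespan t₀ T') := by
  have hG := continuous_cumulative (t₀ := t₀) hγ
  have hF := quasiLipschitzField_interactionField (p := p) hd hp
  obtain ⟨Tmax, z, hlt, hm, hmax⟩ := hF.exists_maximal hG t₀ z₀
  have restr : ∀ (T' : EReal) (v : ℝ → L2 d), IsSolution p γ t₀ φ T' v → T' ≤ Tmax ∧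
      EqOn v (fun t => resolvent (schrodinger (cumulative γ t₀ t) (z t))) (lifespan t₀ T') := by
    intro T' v hv
    obtain ⟨-, z', hm', hv'⟩ := (isSolution_iff hd hp hγ hz₀).1 hv
    have hle : T' ≤ Tmax := by
      by_contra! hcon
      -- A solution reaching beyond Tmax would provide a mild solution up to some real r > Tmax.
      obtain ⟨r, h1, h2⟩ := EReal.lt_iff_exists_real_btwn.1 hcon
      have hr : t₀ ≤ r := (EReal.coe_lt_coe_iff.1 (hlt.trans h1)).le
      exact (hmax r z' hr (hm' r h2)).not_gt h1
    refine ⟨hle, fun t ht => ?_⟩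
    have e := (hm' t ht.2).unique hF hG (hm t (ht.2.trans_le hle)) ⟨ht.1, le_rfl⟩
    simp only [hv' t ht, e]
  refine ⟨Tmax, z, hm, hmax, ⟨(isSolution_iff hd hp hγ hz₀).2 ⟨hlt, z, hm, fun t _ => rfl⟩,
    fun T' v hv hT' _ => le_antisymm (restr T' v hv).1 hT'⟩, restr⟩

theorem hasUniqueMaximalSolution (hd : d ≤ 3) (hp : 2 ≤ p)
    (hγ : ∀ a b, IntervalIntegrable γ volume a b) (hφ : MemH2 φ) :
    HasUniqueMaximalSolution p γ t₀ φ := by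
  obtain ⟨z₀, hz₀⟩ := memH2_iff_exists_resolvent.1 hφ
  obtain ⟨Tmax, z, -, -, h1, h2⟩ := exists_isMaximalSolution (t₀ := t₀) hd hp hγ hz₀
  exact ⟨Tmax, _, h1, h2⟩

/-- Any maximal solution is a restriction of the constructed one, and its maximality then forces
equal lifespans. -/
theorem IsMaximalSolution.exists_isMild (hd : d ≤ 3) (hp : 2 ≤ p)
    (hγ : ∀ a b, IntervalIntegrable γ volume a b) (hz₀ : resolvent z₀ = φ) {u : ℝ → L2 d}
    (hu : IsMaximalSolution p γ t₀ φ Tmax u) :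
    ∃ z : ℝ → L2 d,
      (∀ T : ℝ, (T : EReal) < Tmax →
        IsMild (interactionField p) (cumulative γ t₀) t₀ T z₀ z) ∧
      (∀ (T : ℝ) (z' : ℝ → L2 d), t₀ ≤ T →
        IsMild (interactionField p) (cumulative γ t₀) t₀ T z₀ z' → (T : EReal) < Tmax) ∧
      ∀ t ∈ lifespan t₀ Tmax, u t = resolvent (schrodinger (cumulative γ t₀ t) (z t)) := by
  obtain ⟨T', z, hm, hmax, h1, h2⟩ := exists_isMaximalSolution (t₀ := t₀) hd hp hγ hz₀
  obtain ⟨hle, heq⟩ := h2 Tmax u hu.isSolution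
  obtain rfl : T' = Tmax := hu.maximal T' _ h1.isSolution hle heq.symm
  exact ⟨z, hm, hmax, heq⟩

end Duhamel

/-! ### Uniform closeness of the cumulative dispersions. -/

section Averaging

variable {γ : ℝ → ℝ} {K : ℝ}

theorem abs_average_le (hK : ∀ t, |γ t| ≤ K) : |average γ| ≤ K := by
  have := intervalIntegral.norm_integral_le_of_norm_le_const (a := (0 : ℝ)) (b := 1) (f := γ)
    (C := K) fun t _ => hK t
  simpa [average] using this

/-- Whole periods cancel exactly against the mean. What remains is an interval of length at most 1,
contributing at most K from γ and K from its mean. -/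
theorem abs_integral_sub_average_le (hγ : ∀ a b, IntervalIntegrable γ volume a b)
    (hper : Function.Periodic γ 1) (hK : ∀ t, |γ t| ≤ K) (a b : ℝ) :
    |(∫ s in a..b, γ s) - (b - a) * average γ| ≤ 2 * K := by
  set n : ℤ := ⌊b - a⌋
  have h1 : ∫ s in a..a + n • (1 : ℝ), γ s = n • average γ := by
    rw [hper.intervalIntegral_add_zsmul_eq n a (fun _ _ => hγ _ _), average,
      hper.intervalIntegral_add_eq a 0, zero_add]
  have h2 := intervalIntegral.integral_add_adjacent_intervals (hγ a (a + n • (1 : ℝ)))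
    (hγ (a + n • (1 : ℝ)) b)
  have hn : |b - a - n| ≤ 1 := by
    rw [abs_of_nonneg (sub_nonneg.2 (Int.floor_le _))]
    linarith [Int.lt_floor_add_one (b - a)]
  have hK0 : 0 ≤ K := (abs_nonneg _).trans (hK 0)
  have h3 : |∫ s in (a + n • (1 : ℝ))..b, γ s| ≤ K := by
    have := intervalIntegral.norm_integral_le_of_norm_le_const (a := a + n • (1 : ℝ)) (b := b)
      (f := γ) (C := K) fun t _ => hK t
    refine this.trans (mul_le_of_le_one_right hK0 ?_)
    rw [zsmul_eq_mul, mul_one, ← sub_sub]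
    exact hn
  have h4 : |(b - a - n) * average γ| ≤ K := by
    rw [abs_mul]
    exact (mul_le_of_le_one_left (abs_nonneg _) hn).trans (abs_average_le hK)
  rw [← h2, h1, zsmul_eq_mul, show ∀ x : ℝ, n * average γ + x - (b - a) * average γ =
    x - (b - a - n) * average γ by intro x; ring]
  exact (abs_sub _ _).trans (by linarith)

theorem abs_cumulative_sub_le (hγ : ∀ a b, IntervalIntegrable γ volume a b)
    (hper : Function.Periodic γ 1) (hK : ∀ t, |γ t| ≤ K) {ε : ℝ} (hε : 0 < ε) (t₀ t : ℝ) :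
    |cumulative (fun s => γ (s / ε)) t₀ t - cumulative (fun _ => average γ) t₀ t| ≤
      ε * (2 * K) := by
  have h := abs_integral_sub_average_le hγ hper hK (t₀ / ε) (t / ε)
  have e : cumulative (fun s => γ (s / ε)) t₀ t - cumulative (fun _ => average γ) t₀ t =
      ε * ((∫ s in t₀ / ε..t / ε, γ s) - (t / ε - t₀ / ε) * average γ) := by
    rw [cumulative, cumulative, intervalIntegral.integral_comp_div _ hε.ne',
      intervalIntegral.integral_const, smul_eq_mul, smul_eq_mul]
    field_simp
  rw [e, abs_mul, abs_of_pos hε]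
  gcongr

variable {γp γm tp : ℝ}

theorem abs_dispersionMap_le (t : ℝ) : |dispersionMap γp γm tp t| ≤ max |γp| |γm| := by
  unfold dispersionMap
  split_ifs
  · exact le_max_left _ _
  · rw [abs_neg]
    exact le_max_right _ _

theorem periodic_dispersionMap : Function.Periodic (dispersionMap γp γm tp) 1 := by
  intro t
  simp only [dispersionMap, Int.ceil_add_one, Int.cast_add, Int.cast_one]
  congr 2
  ring

theorem measurable_dispersionMap : Measurable (dispersionMap γp γm tp) := by
  refine Measurable.ite (measurableSet_le ?_ measurable_const) measurable_const measurable_const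
  exact measurable_id.sub ((measurable_from_top.comp Int.measurable_ceil).sub measurable_const)

theorem intervalIntegrable_of_measurable_of_bound (hm : Measurable γ) (hK : ∀ t, |γ t| ≤ K)
    (a b : ℝ) : IntervalIntegrable γ volume a b :=
  (intervalIntegrable_const (c := K)).mono_fun hm.aestronglyMeasurable
    (Eventually.of_forall fun t => (hK t).trans (le_abs_self K))

end Averaging

/-! ### Convergence of the maximal solutions. -/

section Convergence

variable {d : ℕ} {p : ℝ}

/-- Uniform `H²` closeness on a compact interval of the maximal solutions for two dispersion maps
whose cumulative dispersions are close. -/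
theorem exists_forall_h2Norm_sub_le (hd : d ≤ 3) (hp : 2 ≤ p) {γ : ℝ → ℝ}
    (hγ : ∀ a b, IntervalIntegrable γ volume a b) {t₀ T : ℝ} (hT : t₀ ≤ T) {φ : L2 d}
    (hφ : MemH2 φ) {Tmax : EReal} (hTmax : (T : EReal) < Tmax) {u : ℝ → L2 d}
    (hu : IsMaximalSolution p γ t₀ φ Tmax u) {δ : ℝ} (hδ : 0 < δ) :
    ∃ η > 0, ∀ γ' : ℝ → ℝ, (∀ a b, IntervalIntegrable γ' volume a b) →
      (∀ t, |cumulative γ' t₀ t - cumulative γ t₀ t| ≤ η) →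
      ∀ (Tmax' : EReal) (u' : ℝ → L2 d), IsMaximalSolution p γ' t₀ φ Tmax' u' →
        (T : EReal) < Tmax' ∧
          ∀ t ∈ Icc t₀ T, h2Norm (u' t - u t) ≤ ENNReal.ofReal δ := by
  obtain ⟨z₀, hz₀⟩ := memH2_iff_exists_resolvent.1 hφ
  have hF := quasiLipschitzField_interactionField (p := p) hd hp
  have hG := continuous_cumulative (t₀ := t₀) hγ
  obtain ⟨z, hz, -, huz⟩ := hu.exists_isMild hd hp hγ hz₀
  obtain ⟨η₁, hη₁, h1⟩ := hF.stability hG hT (hz T hTmax) (half_pos hδ)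
  obtain ⟨η₂, hη₂, h2⟩ := uniform_near_compact (Φ := fun a (f : L2 d) => schrodinger a f)
    continuous_schrodinger hG (hz T hTmax).1 (half_pos hδ)
  refine ⟨min η₁ η₂, lt_min hη₁ hη₂, fun γ' hγ' hcl Tmax' u' hu' => ?_⟩
  have hG' := continuous_cumulative (t₀ := t₀) hγ'
  obtain ⟨z', hz', hmax', huz'⟩ := hu'.exists_isMild hd hp hγ' hz₀
  -- Stability produces a perturbed solution on all of [t₀, T]. Its existence gives T < Tmax', and
  -- uniqueness identifies it with the maximal one.
  obtain ⟨y, hy, hyz⟩ := h1 _ hG' fun t _ => (hcl t).trans (min_le_left _ _)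
  have hT' := hmax' T y hT hy
  refine ⟨hT', fun t ht => ?_⟩
  rw [huz t (Icc_subset_lifespan hTmax ht), huz' t (Icc_subset_lifespan hT' ht), ← map_sub,
    h2Norm_resolvent, (hz' T hT').unique hF hG' hy ht]
  refine ENNReal.ofReal_le_ofReal ?_
  have a1 := hyz t ht
  have a2 := h2 t ht _ ((hcl t).trans (min_le_right _ _))
  rw [← norm_schrodinger (cumulative γ' t₀ t), map_sub] at a1
  rw [norm_sub_rev]
  -- One half of δ pays for the change of phase on the fixed orbit of z, the other for z - y under
  -- the isometric perturbed phase.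
  calc _ ≤ _ := norm_sub_le_norm_sub_add_norm_sub _ (schrodinger (cumulative γ' t₀ t) (z t)) _
    _ ≤ δ / 2 + δ / 2 := add_le_add a2 a1
    _ = δ := add_halves δ

end Convergence
end FastDispersionNLS
end

theorem theorem4p3 (d : ℕ) (hd₁ : 1 ≤ d) (hd₃ : d ≤ 3) (p : ℝ) (hp : 2 ≤ p)
    (γp γm tp : ℝ) (hγp : 0 < γp) (hγm : 0 < γm) (htp₀ : 0 < tp) (htp₁ : tp < 1)
    (γ : ℝ → ℝ) (hγ : γ = FastDispersionNLS.dispersionMap γp γm tp)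
    (t₀ : ℝ) (φ : FastDispersionNLS.L2 d) (hφ : FastDispersionNLS.MemH2 φ) :
    -- well-posedness of the averaged problem and of the problem with fast dispersion map
    FastDispersionNLS.HasUniqueMaximalSolution p
      (fun _ => FastDispersionNLS.average γ) t₀ φ ∧
    (∀ ε : ℝ, 0 < ε →
      FastDispersionNLS.HasUniqueMaximalSolution p (fun t => γ (t / ε)) t₀ φ) ∧
    -- convergence of the maximal solutions
    ∀ (Tstar : EReal) (u₀ : ℝ → FastDispersionNLS.L2 d)
      (Tmax : ℝ → EReal) (u : ℝ → ℝ → FastDispersionNLS.L2 d),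
      FastDispersionNLS.IsMaximalSolution p
        (fun _ => FastDispersionNLS.average γ) t₀ φ Tstar u₀ →
      (∀ ε : ℝ, 0 < ε →
        FastDispersionNLS.IsMaximalSolution p (fun t => γ (t / ε)) t₀ φ (Tmax ε) (u ε)) →
      ∀ T : ℝ, t₀ < T → (T : EReal) < Tstar →
        (∀ᶠ ε in 𝓝[>] (0 : ℝ), (T : EReal) < Tmax ε) ∧
        Tendsto (fun ε => ⨆ t ∈ Icc t₀ T, FastDispersionNLS.h2Norm (u ε t - u₀ t))
          (𝓝[>] (0 : ℝ)) (𝓝 0) := by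
  have hm : Measurable γ := hγ ▸ FastDispersionNLS.measurable_dispersionMap
  have hper : Function.Periodic γ 1 := hγ ▸ FastDispersionNLS.periodic_dispersionMap
  have hK : ∀ t, |γ t| ≤ max |γp| |γm| := fun t => hγ ▸ FastDispersionNLS.abs_dispersionMap_le t
  have hi := FastDispersionNLS.intervalIntegrable_of_measurable_of_bound hm hK
  have hiε : ∀ ε : ℝ, ∀ a b, IntervalIntegrable (fun t => γ (t / ε)) volume a b := fun ε =>
    FastDispersionNLS.intervalIntegrable_of_measurable_of_bound
      (hm.comp (measurable_id.div_const ε)) fun t => hK (t / ε)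
  have hi₀ : ∀ a b, IntervalIntegrable (fun _ : ℝ => FastDispersionNLS.average γ) volume a b :=
    fun _ _ => intervalIntegrable_const
  refine ⟨FastDispersionNLS.hasUniqueMaximalSolution hd₃ hp hi₀ hφ, fun ε _ =>
    FastDispersionNLS.hasUniqueMaximalSolution hd₃ hp (hiε ε) hφ,
    fun Tstar u₀ Tmax u hu₀ hu T hT hTs => ?_⟩
  have key : ∀ δ : ℝ, 0 < δ → ∀ᶠ ε in 𝓝[>] (0 : ℝ), (T : EReal) < Tmax ε ∧
      ∀ t ∈ Icc t₀ T, FastDispersionNLS.h2Norm (u ε t - u₀ t) ≤ ENNReal.ofReal δ := by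
    intro δ hδ
    obtain ⟨η, hη, h⟩ := FastDispersionNLS.exists_forall_h2Norm_sub_le hd₃ hp hi₀ hT.le hφ hTs
      hu₀ hδ
    have hlim : Tendsto (fun ε : ℝ => ε * (2 * max |γp| |γm|)) (𝓝[>] 0) (𝓝 0) := by
      have : Tendsto (fun ε : ℝ => ε * (2 * max |γp| |γm|)) (𝓝 0) (𝓝 (0 * (2 * max |γp| |γm|))) :=
        tendsto_id.mul_const _
      rw [zero_mul] at this
      exact this.mono_left nhdsWithin_le_nhds
    filter_upwards [hlim.eventually (ge_mem_nhds hη), self_mem_nhdsWithin] with ε h1 hε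
    exact h _ (hiε ε) (fun t =>
      (FastDispersionNLS.abs_cumulative_sub_le hi hper hK hε t₀ t).trans h1) _ _ (hu ε hε)
  refine ⟨(key 1 one_pos).mono fun ε h => h.1, ENNReal.tendsto_nhds_zero.2 fun e he => ?_⟩
  -- The tolerance e may be infinite, so it is replaced by a smaller positive finite r.
  obtain ⟨r, hr0, hr⟩ := ENNReal.lt_iff_exists_nnreal_btwn.1 he
  filter_upwards [key r (by exact_mod_cast hr0)] with ε h
  exact iSup₂_le fun t ht => (h.2 t ht).trans (by rw [ENNReal.ofReal_coe_nnreal]; exact hr.le)
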